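/- Let $\alpha,\alpha'>0$, $\rho<1$, $C_{\mathcal X}>0$, and assume $\beta:=\alpha/\alpha'-1+\rho\in(0,1)$. Let $q$ be a $(0,1)$-valued random variable with density $p(x)=x^{-\rho}L(1/x)$, $x\in(0,1)$, where $L$ is slowly varying at infinity. Given $q$, let $(\eta_j)_{j\ge1}$ be conditionally i.i.d. Bernoulli random variables with parameter $q$. Let $\mathcal X$ be a symmetric real random variable, independent of $(q,(\eta_j)_{j\ge1})$, with $\mathbb P(|\mathcal X|>x)\sim C_{\mathcal X}x^{-\alpha}$ as $x\to\infty$. Let $(\mathcal X_i,q_i,(\eta_{i,j})_{j\ge1})$, $i\ge1$, be i.i.d. copies of $(\mathcal X,q,(\eta_j)_{j\ge1})$ and let $\tau_{i,j}:=\sum_{k=1}^j\eta_{i,k}$. Let $(m_n)_{n\ge1}$ be an increasing sequence of positive integers with $m_nL(n)/n^{1-\rho}\to\infty$; if $\alpha\ge2$, assume in addition that $m_n\le Kn^{\kappa}$ for all $n\ge 1$, for some constants $K$ and $\kappa\in(0,2\beta/(\alpha-2))$ (where $2\beta/(\alpha-2)=\infty$ if $\alpha=2$). Set $$a_n:=\Big(C_{\mathcal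 X}\,\frac{\Gamma(1-\beta)}{\beta}\,n^{\beta}m_nL(n)\Big)^{1/\alpha}.$$ Let $(\Gamma_\ell)_{\ell\ge1}$ be the consecutive arrival times of a standard Poisson process on $\mathbb R_+$, $(\varepsilon_\ell)_{\ell\ge1}$ i.i.d. Rademacher random variables, $(Q_{\beta,\ell})_{\ell\ge1}$ i.i.d. $\beta$-Sibuya random variables, that is $\mathbb P(Q_{\beta,\ell}=k)=\frac{\beta}{\Gamma(1-\beta)}\frac{\Gamma(k-\beta)}{\Gamma(k+1)}$ for $k\ge1$, and $(U_{\ell,j})_{\ell,j\ge1}$ i.i.d. uniform random variables on $(0,1)$, the four families being independent. Let $U_{\ell,1:Q_{\beta,\ell}}<\dots<U_{\ell,Q_{\beta,\ell}:Q_{\beta,\ell}}$ be the order statistics of $U_{\ell,1},\dots,U_{\ell,Q_{\beta,\ell}}$. Let $E:=([-\infty,\infty]\setminus\{0\})\times[0,1]$ and let $\mathfrak M_p(E)$ be the space of Radon point measures on $E$ with the vague topology; point masses located outside $E$ are discarded. Then the measures $\xi$ and $\hat\xi$ below are almost surely in $\mathfrak M_p(E)$ and, as $n\to\infty$, weakly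 in $\mathfrak M_p(E)$, $$\sum_{i=1}^{m_n}\sum_{j=1}^n\eta_{i,j}\,\delta_{\left(\mathcal X_i/(a_nq_i^{1/\alpha'}),\,j/n\right)}\Rightarrow \xi:=\sum_{\ell=1}^\infty\sum_{j=1}^{Q_{\beta,\ell}}\delta_{\left(\varepsilon_\ell\Gamma_\ell^{-1/\alpha},\,U_{\ell,j}\right)}$$ and $$\sum_{i=1}^{m_n}\sum_{j=1}^n\eta_{i,j}\,\delta_{\left((-1)^{\tau_{i,j}}\mathcal X_i/(a_nq_i^{1/\alpha'}),\,j/n\right)}\Rightarrow \hat\xi:=\sum_{\ell=1}^\infty\sum_{j=1}^{Q_{\beta,\ell}}\delta_{\left((-1)^j\varepsilon_\ell\Gamma_\ell^{-1/\alpha},\,U_{\ell,j:Q_{\beta,\ell}}\right)}.$$ -/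

import Mathlib

open MeasureTheory ProbabilityTheory Filter Topology
open scoped CompactlySupported ENNReal

noncomputable section

/-! ### Radon point measures with the vague topology -/

/-- `μ` is a Radon point measure: a countable sum of unit point masses (repetitions allowed)
that is finite on compact sets. -/
def IsRadonPointMeasure {E : Type*} [TopologicalSpace E] [MeasurableSpace E]
    (μ : Measure E) : Prop :=
  IsFiniteMeasureOnCompacts μ ∧
    ∃ (I : Set ℕ) (x : I → E), μ = Measure.sum fun i : I => Measure.dirac (x i)

/-- The space `𝔐_p(E)` of Radon point measures on `E`. -/
def PointMeasureSpace (E : Type*) [TopologicalSpace E] [MeasurableSpace E] : Type _ :=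
  {μ : Measure E // IsRadonPointMeasure μ}

/-- The vague topology: the coarsest topology for which `μ ↦ ∫ f dμ` is continuous for every
continuous compactly supported `f`. -/
instance PointMeasureSpace.instTopologicalSpace (E : Type*) [TopologicalSpace E]
    [MeasurableSpace E] : TopologicalSpace (PointMeasureSpace E) :=
  ⨅ f : C_c(E, ℝ),
    TopologicalSpace.induced (fun μ : PointMeasureSpace E => ∫ x, f x ∂μ.1) inferInstance

instance PointMeasureSpace.instMeasurableSpace (E : Type*) [TopologicalSpace E]
    [MeasurableSpace E] : MeasurableSpace (PointMeasureSpace E) :=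
  borel (PointMeasureSpace E)

instance PointMeasureSpace.instBorelSpace (E : Type*) [TopologicalSpace E]
    [MeasurableSpace E] : BorelSpace (PointMeasureSpace E) :=
  ⟨rfl⟩

theorem isRadonPointMeasure_zero {E : Type*} [TopologicalSpace E] [MeasurableSpace E] :
    IsRadonPointMeasure (0 : Measure E) :=
  ⟨⟨fun _ _ => by simp⟩, ∅, fun i => i.2.elim, by
    ext s hs
    rw [Measure.sum_apply _ hs]
    simp⟩

open Classical in
/-- A measure regarded as an element of `𝔐_p(E)`. The value `0` is used for measures that are not
Radon point measures; `PointProcessConverges` requires this to happen with probability `0`. -/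
def toPointMeasure {E : Type*} [TopologicalSpace E] [MeasurableSpace E] (μ : Measure E) :
    PointMeasureSpace E :=
  if h : IsRadonPointMeasure μ then ⟨μ, h⟩ else ⟨0, isRadonPointMeasure_zero⟩

/-- `N n ⇒ N'` in `𝔐_p(E)`: the random measures `N n` and `N'` are almost surely Radon point
measures, they are random elements of `𝔐_p(E)`, and their laws on `𝔐_p(E)` converge weakly
with respect to the vague topology. -/
def PointProcessConverges {E : Type*} [TopologicalSpace E] [MeasurableSpace E]
    {Ω Ω' : Type*} [MeasurableSpace Ω] [MeasurableSpace Ω']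
    (P : Measure Ω) [IsProbabilityMeasure P] (P' : Measure Ω') [IsProbabilityMeasure P']
    (N : ℕ → Ω → Measure E) (N' : Ω' → Measure E) : Prop :=
  (∀ n, ∀ᵐ ω ∂P, IsRadonPointMeasure (N n ω)) ∧
  (∀ᵐ ω ∂P', IsRadonPointMeasure (N' ω)) ∧
  TendstoInDistribution (fun n ω => toPointMeasure (N n ω)) atTop
    (fun ω => toPointMeasure (N' ω)) (fun _ => P) P'

/-- The space `([-∞, ∞] \ {0}) × [0, 1]`. -/
abbrev MarkSpace : Type := {x : EReal // x ≠ 0} × unitInterval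

open Classical in
/-- The restriction to `([-∞, ∞] \ {0}) × [0, 1]` of the unit point mass at `(x, t)`: it vanishes
if `(x, t)` lies outside that space. -/
def pointMass (x t : ℝ) : Measure MarkSpace :=
  if h : (x : EReal) ≠ 0 ∧ t ∈ unitInterval then
    Measure.dirac (⟨(x : EReal), h.1⟩, ⟨t, h.2⟩) else 0

/-! ### The model -/

/-- `L` is slowly varying at infinity. -/
def IsSlowlyVarying (L : ℝ → ℝ) : Prop :=
  Measurable L ∧ (∀ᶠ x in atTop, 0 < L x) ∧
    ∀ t : ℝ, 0 < t → Tendsto (fun x => L (t * x) / L x) atTop (𝓝 1)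

/-- The measure on `(0, 1)` with density `x ↦ x ^ (-ρ) L(1 / x)`. -/
def parameterLaw (ρ : ℝ) (L : ℝ → ℝ) : Measure ℝ :=
  (volume.restrict (Set.Ioo 0 1)).withDensity fun x => ENNReal.ofReal (x ^ (-ρ) * L (1 / x))

/-- `((X i, q i, (η i j)_j))_i` are i.i.d. copies of `(𝒳, q, (η_j)_j)` where `𝒳` has law `ν`,
`q` has law `π`, the `η_j` are conditionally i.i.d. Bernoulli with parameter `q` given `q`, and
`𝒳` is independent of `(q, (η_j)_j)`. The index `j : ℕ` stands for time `j + 1`. -/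
structure IsAggregatedSample {Ω : Type*} [MeasurableSpace Ω] (P : Measure Ω)
    (ν π : Measure ℝ) (X q : ℕ → Ω → ℝ) (η : ℕ → ℕ → Ω → ℕ) : Prop where
  measurable_X : ∀ i, Measurable (X i)
  measurable_q : ∀ i, Measurable (q i)
  measurable_η : ∀ i j, Measurable (η i j)
  law_X : ∀ i, HasLaw (X i) ν P
  law_q : ∀ i, HasLaw (q i) π P
  /-- Conditionally on `q i`, the probability that, among the first `n` variables `η i j`, exactly
  those with `j ∈ S` equal `1` and the others equal `0`, is the Bernoulli product. -/
  bernoulli : ∀ (i n : ℕ) (S : Finset ℕ) (B : Set ℝ), MeasurableSet B →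
    P {ω | q i ω ∈ B ∧ ∀ j < n, η i j ω = if j ∈ S then 1 else 0} =
      ∫⁻ ω in {ω | q i ω ∈ B},
        ∏ j ∈ Finset.range n, ENNReal.ofReal (if j ∈ S then q i ω else 1 - q i ω) ∂P
  indep_X : ∀ i, IndepFun (X i) (fun ω => (q i ω, fun j => η i j ω)) P
  indep : iIndepFun (fun i ω => (X i ω, q i ω, fun j => η i j ω)) P

/-- `τ i j`, the number of successes up to time `j + 1`. -/
def successCount {Ω : Type*} (η : ℕ → ℕ → Ω → ℕ) (i j : ℕ) (ω : Ω) : ℕ :=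
  ∑ k ∈ Finset.range (j + 1), η i k ω

/-- `a_n = (C · Γ(1 - β) / β · n ^ β · m_n · L(n)) ^ (1 / α)`. -/
def scaling (α β C : ℝ) (L : ℝ → ℝ) (m : ℕ → ℕ) (n : ℕ) : ℝ :=
  (C * (Real.Gamma (1 - β) / β) * (n : ℝ) ^ β * (m n : ℝ) * L n) ^ (1 / α)

/-- The point process with a point `(X_i / (a_n q_i ^ (1 / α')), j / n)` for every `i ≤ m_n` and
`j ≤ n` such that `η_{i,j} = 1`. -/
def summandProcess {Ω : Type*} (α' : ℝ) (a : ℕ → ℝ) (m : ℕ → ℕ) (X q : ℕ → Ω → ℝ)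
    (η : ℕ → ℕ → Ω → ℕ) (n : ℕ) (ω : Ω) : Measure MarkSpace :=
  ∑ i ∈ Finset.range (m n), ∑ j ∈ Finset.range n,
    η i j ω • pointMass (X i ω / (a n * q i ω ^ (1 / α'))) (((j : ℝ) + 1) / n)

/-- The version of `summandProcess` with the alternating signs `(-1) ^ τ_{i,j}`. -/
def signedSummandProcess {Ω : Type*} (α' : ℝ) (a : ℕ → ℝ) (m : ℕ → ℕ) (X q : ℕ → Ω → ℝ)
    (η : ℕ → ℕ → Ω → ℕ) (n : ℕ) (ω : Ω) : Measure MarkSpace :=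
  ∑ i ∈ Finset.range (m n), ∑ j ∈ Finset.range n,
    η i j ω • pointMass ((-1) ^ successCount η i j ω * X i ω / (a n * q i ω ^ (1 / α')))
      (((j : ℝ) + 1) / n)

/-! ### The limit -/

/-- The Rademacher distribution. -/
def rademacherLaw : Measure ℝ :=
  (2⁻¹ : ℝ≥0∞) • Measure.dirac 1 + (2⁻¹ : ℝ≥0∞) • Measure.dirac (-1)

/-- The ingredients of the limit: unit exponential waiting times `w ℓ` of a standard Poisson
process, Rademacher signs `ε ℓ`, `β`-Sibuya variables `Q ℓ`, and uniform variables `U (ℓ, j)`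
on `(0, 1)`, all of them independent. -/
structure IsLimitFamily {Ω : Type*} [MeasurableSpace Ω] (P : Measure Ω) (β : ℝ)
    (w ε : ℕ → Ω → ℝ) (Q : ℕ → Ω → ℕ) (U : ℕ × ℕ → Ω → ℝ) : Prop where
  measurable_w : ∀ ℓ, Measurable (w ℓ)
  measurable_ε : ∀ ℓ, Measurable (ε ℓ)
  measurable_Q : ∀ ℓ, Measurable (Q ℓ)
  measurable_U : ∀ p, Measurable (U p)
  law_w : ∀ ℓ, HasLaw (w ℓ) (expMeasure 1) P
  law_ε : ∀ ℓ, HasLaw (ε ℓ) rademacherLaw P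
  law_Q : ∀ ℓ k : ℕ, 1 ≤ k → P {ω | Q ℓ ω = k} =
    ENNReal.ofReal (β / Real.Gamma (1 - β) * (Real.Gamma (k - β) / Real.Gamma (k + 1)))
  law_U : ∀ p, HasLaw (U p) (volume.restrict (Set.Ioo 0 1)) P
  indep : iIndepFun
    (Sum.elim w (Sum.elim ε (Sum.elim (fun ℓ ω => (Q ℓ ω : ℝ)) U)) :
      ℕ ⊕ ℕ ⊕ ℕ ⊕ (ℕ × ℕ) → Ω → ℝ) P

/-- The arrival time number `ℓ + 1` of the Poisson process with waiting times `w`. -/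
def arrivalTime {Ω : Type*} (w : ℕ → Ω → ℝ) (ℓ : ℕ) (ω : Ω) : ℝ :=
  ∑ k ∈ Finset.range (ℓ + 1), w k ω

/-- The order statistic number `j + 1` of `u 0, …, u (k - 1)`. -/
def orderStatistic (u : ℕ → ℝ) (k : ℕ) (j : Fin k) : ℝ :=
  let v : Fin k → ℝ := fun i => u i
  v (Tuple.sort v j)

/-- `ξ = ∑_ℓ ∑_{j ≤ Q_ℓ} δ_(ε_ℓ Γ_ℓ ^ (-1 / α), U_{ℓ,j})`. -/
def limitProcess {Ω : Type*} (α : ℝ) (w ε : ℕ → Ω → ℝ) (Q : ℕ → Ω → ℕ)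
    (U : ℕ × ℕ → Ω → ℝ) (ω : Ω) : Measure MarkSpace :=
  Measure.sum fun ℓ : ℕ => ∑ j ∈ Finset.range (Q ℓ ω),
    pointMass (ε ℓ ω * arrivalTime w ℓ ω ^ (-(1 / α))) (U (ℓ, j) ω)

/-- `ξ̂ = ∑_ℓ ∑_{j ≤ Q_ℓ} δ_((-1) ^ j ε_ℓ Γ_ℓ ^ (-1 / α), U_{ℓ, j : Q_ℓ})`. -/
def signedLimitProcess {Ω : Type*} (α : ℝ) (w ε : ℕ → Ω → ℝ) (Q : ℕ → Ω → ℕ)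
    (U : ℕ × ℕ → Ω → ℝ) (ω : Ω) : Measure MarkSpace :=
  Measure.sum fun ℓ : ℕ => ∑ j : Fin (Q ℓ ω),
    pointMass ((-1) ^ ((j : ℕ) + 1) * ε ℓ ω * arrivalTime w ℓ ω ^ (-(1 / α)))
      (orderStatistic (fun i => U (ℓ, i) ω) (Q ℓ ω) j)

end

/-! The proof works with characteristic functionals. The vague topology is induced by countably many
integrals of test functions, so Lévy's theorem for finitely many integrals and the portmanteau
inequality for open sets suffice (`tendstoInDistribution_of_charFunctional`). No tightness argument
is needed, since the limit law already lives on the space. Both assertions are one: a sign `s r`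
with `|s r| = 1` is attached to the point of rank `r` in its cluster, with `s = 1` for ξ and `s r =
(-1) ^ r` for the alternating version.

Call `1 - exp(i S)` the defect of a cluster, where `S` is the sum of the test function over its
points. The rows of the sample are i.i.d., so its functional is `(1 - d_n) ^ m_n` with `d_n` the
mean defect of one row, and the limit of `m_n d_n` is needed. Only parameters `q = u / n` matter.
For these, the successes among `n` trials become a Poisson(`u`) number of uniform points, and the
quantile function of `|X|`, rescaled, becomes a power. The choice of `a_n` makes the product of
`m_n`, the density of `n q` at `u` and the tail scale of `X` converge to `β / (C Γ(1 - β)) u ^ (-1 -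
β)`. Potter's bound and the estimate `2 min(1, u)` for the defect justify dominated convergence
(`tendsto_integral_binomialDefect`). Mixing Poisson(`u`) weights over `β / Γ(1 - β) u ^ (-1 - β) du`
produces the Sibuya weights (`integral_rpow_mul_symPoissonDefect`); the mixture is infinite at `k =
0`, but an empty cluster has no defect. Hence `m_n d_n → ∫ D` over `(0, ∞)`, where `D y` is the mean
defect of a Sibuya cluster with mark `± y ^ (-1 / α)`.

The functional of the limit is `exp (-∫ D)`. Indeed `Φ x = exp (-∫_x^∞ D)` solves the renewal
equation `Φ x = E[(1 - D (x + w)) Φ (x + w)]` with `w` exponential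
(`integral_mul_poissonFunctional`). So the product of the exponential factors of the first `n`
clusters, times `Φ` at the `n`-th arrival time, has constant mean `Φ 0`. Since `D` vanishes beyond a
finite point and arrival times tend to infinity, the compensating factor is eventually 1. -/

noncomputable section

/-! ### Countable generation of the vague topology -/

section VagueTopology

variable {E : Type*} [TopologicalSpace E]

/-- Continuous functions supported in a fixed compact set contain a countable uniformly dense
subset. -/
theorem exists_countable_dense_supportedIn [T2Space E] [LocallyCompactSpace E]
    [SecondCountableTopology E] {K : Set E} (hK : IsCompact K) :
    ∃ D : Set C_c(E, ℝ), D.Countable ∧ (∀ g ∈ D, ∀ x ∉ K, g x = 0) ∧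
      ∀ f : C_c(E, ℝ), (∀ x ∉ K, f x = 0) → ∀ δ > 0, ∃ g ∈ D, ∀ x, |f x - g x| < δ := by
  -- In the compact-open topology `C(E, ℝ)` is second countable, so `T` is separable. On `T`
  -- closeness on `K` is closeness everywhere.
  let T : Set C(E, ℝ) := {g | ∀ x ∉ K, g x = 0}
  have hcs : ∀ g : T, HasCompactSupport g.1 := fun g =>
    HasCompactSupport.intro hK fun x hx => g.2 x hx
  let F : T → C_c(E, ℝ) := fun g => ⟨g.1, hcs g⟩
  have : Nonempty T := ⟨⟨0, fun _ _ => rfl⟩⟩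
  refine ⟨Set.range fun n => F (TopologicalSpace.denseSeq T n), Set.countable_range _, ?_, ?_⟩
  · rintro _ ⟨n, rfl⟩ x hx
    exact (TopologicalSpace.denseSeq T n).2 x hx
  · intro f hf δ hδ
    let f' : T := ⟨⟨f, f.continuous⟩, hf⟩
    have hopen : IsOpen {g : T | ∀ x ∈ K, |f x - g.1 x| < δ} := by
      have h1 : IsOpen {g : C(E, ℝ) | Set.MapsTo (fun x => g x - f x) K (Metric.ball 0 δ)} := by
        have : Continuous fun g : C(E, ℝ) => g - (f' : C(E, ℝ)) := by fun_prop
        exact (ContinuousMap.isOpen_setOfPred_mapsTo hK Metric.isOpen_ball).preimage this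
      convert! h1.preimage (continuous_subtype_val (p := (· ∈ T))) using 1
      ext g
      change (∀ x ∈ K, |f x - g.1 x| < δ) ↔
        ∀ ⦃x⦄, x ∈ K → (g.1 x - f x) ∈ Metric.ball (0 : ℝ) δ
      simp [abs_sub_comm]
    obtain ⟨n, hn⟩ := (TopologicalSpace.denseRange_denseSeq T).exists_mem_open hopen
      ⟨f', fun x _ => by simpa [f'] using hδ⟩
    refine ⟨_, ⟨n, rfl⟩, fun x => ?_⟩
    by_cases hx : x ∈ K
    · exact hn x hx
    · have : F (TopologicalSpace.denseSeq T n) x = 0 := (TopologicalSpace.denseSeq T n).2 x hx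
      simpa [hf x hx, this] using hδ

variable [MeasurableSpace E]

theorem PointMeasureSpace.continuous_integral (f : C_c(E, ℝ)) :
    Continuous fun μ : PointMeasureSpace E => ∫ x, f x ∂μ.1 :=
  continuous_iff_le_induced.2 (iInf_le _ f)

theorem PointMeasureSpace.integrable [OpensMeasurableSpace E] [SecondCountableTopology E]
    (μ : PointMeasureSpace E) (f : C_c(E, ℝ)) : Integrable f μ.1 :=
  have := μ.2.1
  f.continuous.integrable_of_hasCompactSupport f.hasCompactSupport

/-- The vague topology is determined by countably many test functions. -/
theorem exists_countable_isInducing [OpensMeasurableSpace E] [T2Space E] [LocallyCompactSpace E]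
    [SecondCountableTopology E] :
    ∃ D : Set C_c(E, ℝ), D.Countable ∧
      IsInducing fun (μ : PointMeasureSpace E) (f : D) => ∫ x, f.1 x ∂μ.1 := by
  let K := CompactExhaustion.choice E
  choose D hDc hDs hDd using fun n => exists_countable_dense_supportedIn (E := E) (K.isCompact n)
  -- Replacing `f` by a uniformly close `g` costs the distance times the mass of `K n`. The bumps `χ
  -- n` belong to the countable family in order to bound this mass locally.
  have hχ : ∀ n, ∃ χ : C_c(E, ℝ), (∀ x ∈ K n, χ x = 1) ∧ ∀ x, 0 ≤ χ x := fun n => by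
    obtain ⟨χ, h1, _, h2, h3⟩ := exists_continuous_one_zero_of_isCompact (K.isCompact n)
      isClosed_empty (Set.disjoint_empty _)
    exact ⟨⟨χ, h2⟩, fun x hx => h1 hx, fun x => (h3 x).1⟩
  choose χ hχ1 hχ0 using hχ
  refine ⟨(⋃ n, D n) ∪ Set.range χ,
    (Set.countable_iUnion hDc).union (Set.countable_range χ), ?_⟩
  set A := (⋃ n, D n) ∪ Set.range χ
  refine ⟨le_antisymm (continuous_iff_le_induced.1
    (continuous_pi fun f => PointMeasureSpace.continuous_integral f.1)) ?_⟩
  refine le_iInf fun f => continuous_iff_le_induced.1 ?_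
  let tA : TopologicalSpace (PointMeasureSpace E) :=
    TopologicalSpace.induced (fun μ (f : A) => ∫ x, f.1 x ∂μ.1) inferInstance
  have hcont : ∀ g ∈ A, @Continuous _ _ tA _ fun μ : PointMeasureSpace E => ∫ x, g x ∂μ.1 :=
    fun g hg => (continuous_apply (⟨g, hg⟩ : A)).comp
      (@continuous_induced_dom _ _ (fun (μ : PointMeasureSpace E) (f : A) => ∫ x, f.1 x ∂μ.1) _)
  obtain ⟨n, hn⟩ := K.exists_superset_of_isCompact f.hasCompactSupport
  have hf : ∀ x ∉ K n, f x = 0 := fun x hx => image_eq_zero_of_notMem_tsupport fun h => hx (hn h)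
  have hχc := hcont (χ n) (Or.inr ⟨n, rfl⟩)
  refine @continuous_of_locally_uniform_approx_of_continuousAt _ _ tA _ _ fun μ₀ u hu => ?_
  obtain ⟨r, hr, hru⟩ := Metric.mem_uniformity_dist.1 hu
  set M := ∫ x, χ n x ∂μ₀.1 + 1
  -- On the neighbourhood `{μ | ∫ χ n dμ < M}` of `μ₀`, an approximation of `f` within `r / M` gives
  -- integrals within `r`.
  have hM : 0 < M := add_pos_of_nonneg_of_pos (integral_nonneg fun x => hχ0 n x) one_pos
  obtain ⟨g, hgD, hg⟩ := hDd n f hf (r / M) (div_pos hr hM)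
  refine ⟨{μ | ∫ x, χ n x ∂μ.1 < M}, ?_, fun μ => ∫ x, g x ∂μ.1,
    (hcont g (Or.inl (Set.mem_iUnion.2 ⟨n, hgD⟩))).continuousAt, fun μ hμ => hru ?_⟩
  · exact (isOpen_Iio.preimage hχc).mem_nhds (by simp [M])
  · rw [Real.dist_eq, ← integral_sub (μ.integrable f) (μ.integrable g)]
    calc |∫ x, f x - g x ∂μ.1| ≤ ∫ x, |f x - g x| ∂μ.1 := abs_integral_le_integral_abs
      _ ≤ ∫ x, r / M * χ n x ∂μ.1 := by
          refine integral_mono ((μ.integrable f).sub (μ.integrable g)).abs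
            ((μ.integrable (χ n)).const_mul _) fun x => ?_
          by_cases hx : x ∈ K n
          · simpa [hχ1 n x hx] using (hg x).le
          · simpa [hf x hx, hDs n g hgD x hx] using
              mul_nonneg (div_pos hr hM).le (hχ0 n x)
      _ = r / M * ∫ x, χ n x ∂μ.1 := integral_const_mul _ _
      _ < r / M * M := mul_lt_mul_of_pos_left hμ (div_pos hr hM)
      _ = r := div_mul_cancel₀ _ hM.ne'

end VagueTopology

/-! ### From characteristic functions to convergence in distribution -/

section WeakConvergence

variable {Y J : Type*} [TopologicalSpace Y] [MeasurableSpace Y] [BorelSpace Y]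

/-- The Borel σ-algebra of `Y` is the pullback along `φ`. A measurable modification of `φ ∘ T` may
leave the range of `φ`, so `T` itself is modified: it is made constant on a null set that contains
the exceptional points. -/
theorem aemeasurable_of_isInducing [Countable J] [Nonempty Y] {φ : Y → J → ℝ} (hφ : IsInducing φ)
    {Ω : Type*} [MeasurableSpace Ω] {P : Measure Ω} {T : Ω → Y}
    (h : ∀ j, AEMeasurable (fun ω => φ (T ω) j) P) : AEMeasurable T P := by
  classical
  have h' : AEMeasurable (fun ω => φ (T ω)) P := aemeasurable_pi_iff.2 h
  obtain ⟨A, hAs, hA, hA0⟩ := exists_measurable_superset_of_null (ae_iff.1 h'.ae_eq_mk)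
  let y₀ : Y := Classical.arbitrary Y
  refine ⟨fun ω => if ω ∈ A then y₀ else T ω, ?_, ?_⟩
  · have hY : ‹MeasurableSpace Y› = (borel (J → ℝ)).comap φ := by
      rw [‹BorelSpace Y›.measurable_eq, hφ.eq_induced, borel_comap]
    have : Measurable fun ω => φ (if ω ∈ A then y₀ else T ω) := by
      have : (fun ω => φ (if ω ∈ A then y₀ else T ω)) =
          fun ω => if ω ∈ A then φ y₀ else h'.mk _ ω := by
        ext1 ω
        by_cases hω : ω ∈ A
        · simp [hω]
        · have : φ (T ω) = h'.mk _ ω := by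
            by_contra hne
            exact hω (hAs hne)
          simp [hω, this]
      rw [this]
      exact Measurable.ite hA measurable_const h'.measurable_mk
    rw [hY, ← BorelSpace.measurable_eq (α := J → ℝ)]
    exact measurable_comap_iff.2 this
  · filter_upwards [measure_eq_zero_iff_ae_notMem.1 hA0] with ω hω
    simp [hω]

theorem charFun_map_toLp {Ω : Type*} [MeasurableSpace Ω] {P : Measure Ω} {s : Finset J}
    {T : Ω → J → ℝ} (hT : ∀ j, AEMeasurable (fun ω => T ω j) P) (t : EuclideanSpace ℝ s) :
    charFun (P.map fun ω => (WithLp.toLp 2 fun j : s => T ω j : EuclideanSpace ℝ s)) t =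
      ∫ ω, Complex.exp (Complex.I * ((∑ j : s, t j * T ω j : ℝ) : ℂ)) ∂P := by
  rw [charFun_apply, integral_map]
  · refine integral_congr_ae (ae_of_all _ fun ω => ?_)
    simp [PiLp.inner_apply, mul_comm]
  · exact (WithLp.measurable_toLp 2 _).comp_aemeasurable (aemeasurable_pi_iff.2 fun j => hT j)
  · fun_prop

/-- Lévy's theorem yields convergence of finite-dimensional marginals. An open set of the product is
an increasing union of open cylinders; the portmanteau inequality holds on each of them and passes
to the union by continuity from below of the limit law. -/
theorem tendstoInDistribution_of_charFun [Countable J] [Nonempty Y] {φ : Y → J → ℝ}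
    (hφ : IsInducing φ) {Ω Ω' : Type*} [MeasurableSpace Ω] [MeasurableSpace Ω']
    {P : Measure Ω} [IsProbabilityMeasure P] {P' : Measure Ω'} [IsProbabilityMeasure P']
    {T : ℕ → Ω → Y} {T' : Ω' → Y}
    (hT : ∀ n j, AEMeasurable (fun ω => φ (T n ω) j) P)
    (hT' : ∀ j, AEMeasurable (fun ω => φ (T' ω) j) P')
    (h : ∀ (s : Finset J) (t : s → ℝ), Tendsto
      (fun n => ∫ ω, Complex.exp (Complex.I * ((∑ j : s, t j * φ (T n ω) j : ℝ) : ℂ)) ∂P) atTop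
      (𝓝 (∫ ω, Complex.exp (Complex.I * ((∑ j : s, t j * φ (T' ω) j : ℝ) : ℂ)) ∂P'))) :
    TendstoInDistribution T atTop T' (fun _ => P) P' := by
  have hTm : ∀ n, AEMeasurable (T n) P := fun n => aemeasurable_of_isInducing hφ (hT n)
  have hTm' : AEMeasurable T' P' := aemeasurable_of_isInducing hφ hT'
  refine ⟨hTm, hTm', ?_⟩
  refine tendsto_of_forall_isOpen_le_liminf' fun G hG => ?_
  obtain ⟨W, hW, rfl⟩ := hφ.isOpen_iff.1 hG
  let r : (s : Finset J) → (J → ℝ) → EuclideanSpace ℝ s := fun s x => WithLp.toLp 2 fun j : s => x j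
  have hr : ∀ s, Continuous (r s) := fun s => by
    unfold r
    fun_prop
  -- The largest open base of a cylinder over `s` inside `W`; being largest makes the cylinders
  -- increase with `s`.
  let V : (s : Finset J) → Set (EuclideanSpace ℝ s) := fun s => ⋃₀ {O | IsOpen O ∧ r s ⁻¹' O ⊆ W}
  have hV : ∀ s, IsOpen (V s) := fun s => isOpen_sUnion fun O hO => hO.1
  have hVW : ∀ s, r s ⁻¹' V s ⊆ W := fun s x hx => by
    obtain ⟨O, hO, hxO⟩ := hx
    exact hO.2 hxO
  have hmono : Monotone fun s => r s ⁻¹' V s := by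
    rintro s s' hs x ⟨O, hO, hxO⟩
    let p : EuclideanSpace ℝ s' → EuclideanSpace ℝ s :=
      fun y => WithLp.toLp 2 fun j : s => y ⟨j, hs j.2⟩
    have hp : Continuous p := by
      unfold p
      fun_prop
    exact ⟨p ⁻¹' O, ⟨hO.1.preimage hp, hO.2⟩, hxO⟩
  have hWU : W = ⋃ s, r s ⁻¹' V s := by
    refine subset_antisymm (fun x hx => ?_) (Set.iUnion_subset hVW)
    obtain ⟨s, u, hu, hsub⟩ := isOpen_pi_iff.1 hW x hx
    refine Set.mem_iUnion.2 ⟨s, {y | ∀ j : s, y j ∈ u j}, ⟨?_, ?_⟩, fun j => (hu j j.2).2⟩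
    · have : {y : EuclideanSpace ℝ s | ∀ j : s, y j ∈ u j} =
          ⋂ j : s, (fun y : EuclideanSpace ℝ s => y j) ⁻¹' u j := by
        ext y
        simp
      rw [this]
      exact isOpen_iInter_of_finite fun j => (hu j j.2).1.preimage (by fun_prop)
    · exact fun y hy => hsub fun j hj => hy ⟨j, hj⟩
  have key : ∀ s, P'.map T' (φ ⁻¹' (r s ⁻¹' V s)) ≤
      liminf (fun n => P.map (T n) (φ ⁻¹' W)) atTop := by
    intro s
    have hrφ : Measurable fun y => r s (φ y) := ((hr s).comp hφ.continuous).measurable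
    have hm : ∀ n, AEMeasurable (fun ω => r s (φ (T n ω))) P := fun n => hrφ.comp_aemeasurable (hTm n)
    have hm' : AEMeasurable (fun ω => r s (φ (T' ω))) P' := hrφ.comp_aemeasurable hTm'
    let μ : ℕ → ProbabilityMeasure (EuclideanSpace ℝ s) := fun n =>
      ⟨P.map fun ω => r s (φ (T n ω)), Measure.isProbabilityMeasure_map (hm n)⟩
    let μ' : ProbabilityMeasure (EuclideanSpace ℝ s) :=
      ⟨P'.map fun ω => r s (φ (T' ω)), Measure.isProbabilityMeasure_map hm'⟩
    have hlim : Tendsto μ atTop (𝓝 μ') := by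
      refine ProbabilityMeasure.tendsto_of_tendsto_charFun fun t => ?_
      have e1 : ∀ n, charFun (μ n : Measure (EuclideanSpace ℝ s)) t = _ :=
        fun n => charFun_map_toLp (hT n) t
      have e2 : charFun (μ' : Measure (EuclideanSpace ℝ s)) t = _ := charFun_map_toLp hT' t
      simp_rw [e1, e2]
      exact h s t
    have := ProbabilityMeasure.le_liminf_measure_open_of_tendsto hlim (hV s)
    have hVm := (hV s).measurableSet
    have hm2 : MeasurableSet (φ ⁻¹' (r s ⁻¹' V s)) := hrφ hVm
    calc P'.map T' (φ ⁻¹' (r s ⁻¹' V s)) = (μ' : Measure (EuclideanSpace ℝ s)) (V s) := by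
          rw [Measure.map_apply_of_aemeasurable hTm' hm2]
          exact (Measure.map_apply_of_aemeasurable hm' hVm).symm
      _ ≤ _ := this
      _ ≤ _ := by
          refine liminf_le_liminf (Eventually.of_forall fun n => ?_)
          have : (μ n : Measure (EuclideanSpace ℝ s)) (V s) =
              P.map (T n) (φ ⁻¹' (r s ⁻¹' V s)) := by
            rw [Measure.map_apply_of_aemeasurable (hTm n) hm2]
            exact Measure.map_apply_of_aemeasurable (hm n) hVm
          rw [this]
          exact measure_mono (Set.preimage_mono (hVW s))
  change P'.map T' (φ ⁻¹' W) ≤ liminf (fun n => P.map (T n) (φ ⁻¹' W)) atTop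
  conv_lhs => rw [hWU, Set.preimage_iUnion]
  rw [Directed.measure_iUnion]
  · exact iSup_le key
  · exact Monotone.directed_le fun s s' hs => Set.preimage_mono (hmono hs)

/-- Convergence of characteristic functionals implies convergence in distribution in the vague
topology. -/
theorem tendstoInDistribution_of_charFunctional {E : Type*} [TopologicalSpace E]
    [MeasurableSpace E] [OpensMeasurableSpace E] [T2Space E] [LocallyCompactSpace E]
    [SecondCountableTopology E] {Ω Ω' : Type*} [MeasurableSpace Ω] [MeasurableSpace Ω']
    {P : Measure Ω} [IsProbabilityMeasure P] {P' : Measure Ω'} [IsProbabilityMeasure P']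
    {T : ℕ → Ω → PointMeasureSpace E} {T' : Ω' → PointMeasureSpace E}
    (hT : ∀ (n : ℕ) (f : C_c(E, ℝ)), AEMeasurable (fun ω => ∫ x, f x ∂(T n ω).1) P)
    (hT' : ∀ f : C_c(E, ℝ), AEMeasurable (fun ω => ∫ x, f x ∂(T' ω).1) P')
    (h : ∀ f : C_c(E, ℝ), Tendsto
      (fun n => ∫ ω, Complex.exp (Complex.I * ((∫ x, f x ∂(T n ω).1 : ℝ) : ℂ)) ∂P) atTop
      (𝓝 (∫ ω, Complex.exp (Complex.I * ((∫ x, f x ∂(T' ω).1 : ℝ) : ℂ)) ∂P'))) :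
    TendstoInDistribution T atTop T' (fun _ => P) P' := by
  obtain ⟨D, hDc, hD⟩ := exists_countable_isInducing (E := E)
  have := hDc.to_subtype
  have : Nonempty (PointMeasureSpace E) := ⟨⟨0, isRadonPointMeasure_zero⟩⟩
  refine tendstoInDistribution_of_charFun hD (fun n f => hT n f.1) (fun f => hT' f.1)
    fun s t => ?_
  -- Cramér–Wold: a linear combination of test functions is a test function, so single integrals are
  -- enough.
  have e : ∀ μ : PointMeasureSpace E, ∑ j : s, t j * ∫ x, j.1.1 x ∂μ.1 =
      ∫ x, (∑ j : s, t j • j.1.1 : C_c(E, ℝ)) x ∂μ.1 := fun μ => by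
    simp_rw [← integral_const_mul]
    rw [← integral_finsetSum _ fun j _ => (μ.integrable j.1.1).const_mul _]
    simp
  simp_rw [e]
  exact h _

end WeakConvergence

/-! ### Sums of point masses and test functions on the mark space -/

section PointMasses

/-- A measure that is a countable sum of unit point masses. -/
def IsDiracSum {E : Type*} [MeasurableSpace E] (μ : Measure E) : Prop :=
  ∃ (ι : Type) (_ : Countable ι) (x : ι → E), μ = Measure.sum fun i => Measure.dirac (x i)

namespace IsDiracSum

variable {E : Type*} [MeasurableSpace E]

theorem isRadonPointMeasure [TopologicalSpace E] {μ : Measure E} (h : IsDiracSum μ)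
    (hμ : ∀ K, IsCompact K → μ K < ∞) : IsRadonPointMeasure μ := by
  obtain ⟨ι, hι, x, rfl⟩ := h
  obtain ⟨e, he⟩ := exists_injective_nat ι
  refine ⟨⟨fun K hK => hμ K hK⟩, Set.range e, fun i => x ((Equiv.ofInjective e he).symm i), ?_⟩
  ext s hs
  rw [Measure.sum_apply _ hs, Measure.sum_apply _ hs]
  exact ((Equiv.ofInjective e he).symm.tsum_eq fun i => Measure.dirac (x i) s).symm

theorem zero : IsDiracSum (0 : Measure E) :=
  ⟨Empty, inferInstance, fun i => i.elim, by simp⟩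

theorem dirac (x : E) : IsDiracSum (Measure.dirac x) :=
  ⟨Unit, inferInstance, fun _ => x, by simp [Measure.sum_fintype]⟩

theorem sum {κ : Type} [Countable κ] {μ : κ → Measure E} (h : ∀ k, IsDiracSum (μ k)) :
    IsDiracSum (Measure.sum μ) := by
  choose ι hι x hx using h
  refine ⟨Σ k, ι k, inferInstance, fun p => x p.1 p.2, ?_⟩
  ext s hs
  rw [Measure.sum_apply _ hs, Measure.sum_apply _ hs, ENNReal.tsum_sigma']
  exact tsum_congr fun k => by
    conv_lhs => rw [hx k, Measure.sum_apply _ hs]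

theorem finsetSum {κ : Type} [Countable κ] {μ : κ → Measure E} (s : Finset κ)
    (h : ∀ k, IsDiracSum (μ k)) : IsDiracSum (∑ k ∈ s, μ k) := by
  rw [← Measure.sum_coe_finset]
  exact sum fun k => h k

theorem nsmul {μ : Measure E} (h : IsDiracSum μ) (n : ℕ) : IsDiracSum (n • μ) := by
  have := finsetSum (Finset.range n) (fun _ : ℕ => h)
  simpa using this

end IsDiracSum

theorem IsDiracSum.pointMass (x t : ℝ) : IsDiracSum (pointMass x t) := by
  unfold _root_.pointMass
  split_ifs
  · exact IsDiracSum.dirac _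
  · exact IsDiracSum.zero

theorem pointMass_apply_le_one (x t : ℝ) (s : Set MarkSpace) : pointMass x t s ≤ 1 := by
  unfold pointMass
  split_ifs
  · exact prob_le_one
  · simp

instance (x t : ℝ) : IsFiniteMeasure (pointMass x t) :=
  ⟨(pointMass_apply_le_one x t _).trans_lt ENNReal.one_lt_top⟩

instance : LocallyCompactSpace {x : EReal // x ≠ 0} :=
  isOpen_ne.locallyCompactSpace

/-- A compact subset of the mark space is bounded away from `0`. -/
theorem exists_pointMass_apply_eq_zero {K : Set MarkSpace} (hK : IsCompact K) :
    ∃ δ > 0, ∀ x t : ℝ, |x| < δ → pointMass x t K = 0 := by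
  -- The marks of `K` form a compact, hence closed, subset of `EReal` that misses `0`.
  have hK' : IsCompact ((fun p : MarkSpace => (p.1 : EReal)) '' K) := hK.image (by fun_prop)
  have h0 : {x : ℝ | (x : EReal) ∉ (fun p : MarkSpace => (p.1 : EReal)) '' K} ∈ 𝓝 (0 : ℝ) := by
    refine (hK'.isClosed.isOpen_compl.preimage continuous_coe_real_ereal).mem_nhds ?_
    rintro ⟨p, -, hp⟩
    exact p.1.2 hp
  obtain ⟨δ, hδ, hsub⟩ := Metric.mem_nhds_iff.1 h0
  refine ⟨δ, hδ, fun x t hx => ?_⟩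
  unfold pointMass
  split_ifs with h
  · rw [Measure.dirac_apply' _ hK.measurableSet, Set.indicator_of_notMem]
    intro hmem
    exact hsub (by simpa using hx) ⟨_, hmem, rfl⟩
  · simp

open Classical in
/-- A function on the mark space, extended by zero to pairs of real numbers. -/
def markExtend (f : MarkSpace → ℝ) (x t : ℝ) : ℝ :=
  if h : (x : EReal) ≠ 0 ∧ t ∈ unitInterval then f (⟨(x : EReal), h.1⟩, ⟨t, h.2⟩) else 0

theorem integral_pointMass (f : MarkSpace → ℝ) (x t : ℝ) :
    ∫ p, f p ∂(pointMass x t) = markExtend f x t := by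
  unfold pointMass markExtend
  split_ifs
  · exact integral_dirac _ _
  · simp

/-- The properties of test functions, extended by zero, that matter for the limit theorem. -/
structure IsTestFunction (g : ℝ → ℝ → ℝ) (δ : ℝ) : Prop where
  pos : 0 < δ
  measurable : Measurable (Function.uncurry g)
  eq_zero : ∀ x t, |x| < δ → g x t = 0
  continuousOn : ContinuousOn (Function.uncurry g) ({0}ᶜ ×ˢ Set.Icc 0 1)

/-- Extension by zero may jump at the times 0 and 1, so continuity is relative to the strip of
admissible pairs. Compactness of the support gives the gap `δ` around the mark 0. -/
theorem exists_isTestFunction (f : C_c(MarkSpace, ℝ)) : ∃ δ, IsTestFunction (markExtend f) δ := by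
  have hcont : ContinuousOn (Function.uncurry (markExtend f)) ({0}ᶜ ×ˢ Set.Icc 0 1) := by
    rw [continuousOn_iff_continuous_domRestrict]
    let e : ({0}ᶜ ×ˢ Set.Icc 0 1 : Set (ℝ × ℝ)) → MarkSpace := fun p =>
      (⟨(p.1.1 : EReal), by simpa using p.2.1⟩, ⟨p.1.2, p.2.2⟩)
    have he : Continuous e := by
      refine Continuous.prodMk (Continuous.subtype_mk ?_ _) (Continuous.subtype_mk ?_ _)
      · exact continuous_coe_real_ereal.comp (by fun_prop)
      · fun_prop
    convert f.continuous.comp he using 1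
    ext p
    have h : (p.1.1 : EReal) ≠ 0 ∧ p.1.2 ∈ unitInterval := ⟨by simpa using p.2.1, p.2.2⟩
    simp [markExtend, Function.uncurry, h, e]
  obtain ⟨δ, hδ, h0⟩ := exists_pointMass_apply_eq_zero f.hasCompactSupport
  refine ⟨δ, hδ, ?_, fun x t hx => ?_, hcont⟩
  · have hs : MeasurableSet ({0}ᶜ ×ˢ Set.Icc 0 1 : Set (ℝ × ℝ)) :=
      (measurableSet_singleton _).compl.prod measurableSet_Icc
    have : Function.uncurry (markExtend f) =
        ({0}ᶜ ×ˢ Set.Icc 0 1 : Set (ℝ × ℝ)).indicator (Function.uncurry (markExtend f)) := by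
      refine (Set.indicator_eq_self.2 fun p hp => ?_).symm
      by_contra hne
      refine hp ?_
      have h : ¬ ((p.1 : EReal) ≠ 0 ∧ p.2 ∈ unitInterval) := fun h =>
        hne ⟨by simpa using h.1, h.2⟩
      exact dif_neg h
    rw [this, ← Set.piecewise_eq_indicator]
    exact hcont.measurable_piecewise (g := 0) continuousOn_const hs
  · rw [← integral_pointMass]
    refine integral_eq_zero_of_ae ?_
    have h1 := measure_eq_zero_iff_ae_notMem.1 (h0 x t hx)
    filter_upwards [h1] with p hp
    exact image_eq_zero_of_notMem_tsupport hp

end PointMasses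

/-! ### Uniform convergence theorem and Potter's bound -/

section SlowVariation

/-- The uniform convergence theorem for slowly varying functions, in additive form. -/
theorem exists_forall_abs_sub_le_of_tendsto {h : ℝ → ℝ} (hm : Measurable h)
    (hh : ∀ t, Tendsto (fun x => h (x + t) - h x) atTop (𝓝 0)) {ε : ℝ} (hε : 0 < ε) :
    ∃ X, ∀ x ≥ X, ∀ t ∈ Set.Icc (0 : ℝ) 1, |h (x + t) - h x| ≤ ε := by
  by_contra! hcon
  choose x hx t ht hxt using fun n : ℕ => hcon n
  -- For each shift `l` in an interval of length 2, the increments along `z n → ∞` eventually stay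
  -- below `ε / 2`. The good shifts therefore fill more than `3 / 2` of the interval from some `N`
  -- on.
  have large : ∀ z : ℕ → ℝ, (∀ n : ℕ, (n : ℝ) ≤ z n) → ∀ᶠ N : ℕ in atTop, ENNReal.ofReal (3 / 2) <
      volume {l | l ∈ Set.Icc (0 : ℝ) 2 ∧ ∀ n ≥ N, |h (z n + l) - h (z n)| < ε / 2} := by
    intro z hz
    have hzt : Tendsto z atTop atTop := tendsto_atTop_mono hz tendsto_natCast_atTop_atTop
    have hmono : Monotone fun N : ℕ =>
        {l | l ∈ Set.Icc (0 : ℝ) 2 ∧ ∀ n ≥ N, |h (z n + l) - h (z n)| < ε / 2} :=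
      fun N M hNM l hl => ⟨hl.1, fun n hn => hl.2 n (hNM.trans hn)⟩
    have hU : ⋃ N : ℕ, {l | l ∈ Set.Icc (0 : ℝ) 2 ∧ ∀ n ≥ N, |h (z n + l) - h (z n)| < ε / 2} =
        Set.Icc 0 2 := by
      refine subset_antisymm (Set.iUnion_subset fun N l hl => hl.1) fun l hl => ?_
      have := ((hh l).comp hzt).eventually (Metric.ball_mem_nhds 0 (half_pos hε))
      obtain ⟨N, hN⟩ := eventually_atTop.1 this
      exact Set.mem_iUnion.2 ⟨N, hl, fun n hn => by simpa using hN n hn⟩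
    have hlim := tendsto_measure_iUnion_atTop (μ := volume) hmono
    rw [hU, Real.volume_Icc] at hlim
    refine hlim.eventually (lt_mem_nhds ?_)
    rw [ENNReal.ofReal_lt_ofReal_iff] <;> norm_num
  obtain ⟨N, hV, hW⟩ := ((large x hx).and (large (fun n => x n + t n)
    fun n => le_add_of_le_of_nonneg (hx n) (ht n).1)).exists
  set V := {l | l ∈ Set.Icc (0 : ℝ) 2 ∧ ∀ n ≥ N, |h (x n + l) - h (x n)| < ε / 2}
  set W := {l | l ∈ Set.Icc (0 : ℝ) 2 ∧ ∀ n ≥ N, |h (x n + t n + l) - h (x n + t n)| < ε / 2}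
  have hWm : MeasurableSet W := by
    refine MeasurableSet.inter measurableSet_Icc ?_
    have : {l | ∀ n ≥ N, |h (x n + t n + l) - h (x n + t n)| < ε / 2} =
        ⋂ n, ⋂ (_ : n ≥ N), {l | |h (x n + t n + l) - h (x n + t n)| < ε / 2} := by
      ext l
      simp
    refine (congrArg MeasurableSet this).mpr ?_
    exact MeasurableSet.iInter fun n => MeasurableSet.iInter fun _ =>
      measurableSet_lt (by fun_prop) measurable_const
  -- `V` and the translate of `W` lie in `[0, 3]` and have measure above `3 / 2` each, so they must
  -- meet. A common point compares both `h (x N)` and `h (x N + t N)` with one value of `h`, against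
  -- the choice of `t N`.
  let W' := (fun l => l + -t N) ⁻¹' W
  have hW' : volume W' = volume W := measure_preimage_add_right _ _ _
  have hdisj : Disjoint V W' := by
    refine Set.disjoint_left.2 fun l hl hl' => ?_
    have h1 := hl.2 N le_rfl
    have h2 := hl'.2 N le_rfl
    rw [show x N + t N + (l + -t N) = x N + l by ring] at h2
    have h3 := hxt N
    rw [abs_lt] at h1 h2
    have : |h (x N + t N) - h (x N)| < ε := abs_lt.2 ⟨by linarith, by linarith⟩
    linarith
  have hsub : V ∪ W' ⊆ Set.Icc 0 3 := by
    rintro l (hl | hl)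
    · exact ⟨hl.1.1, hl.1.2.trans (by norm_num)⟩
    · have h1 : 0 ≤ l + -t N ∧ l + -t N ≤ 2 := hl.1
      have h2 := ht N
      exact ⟨by linarith [h2.1], by linarith [h2.2]⟩
  have h3 := measure_mono (μ := volume) hsub
  rw [measure_union hdisj (hWm.preimage (by fun_prop)), hW', Real.volume_Icc] at h3
  have h4 := (ENNReal.add_lt_add hV hW).trans_le h3
  rw [← ENNReal.ofReal_add (by norm_num) (by norm_num)] at h4
  norm_num at h4

/-- Chaining steps of length at most one costs `ε` per step, and `|y - x| + 1` bounds their number.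
-/
theorem exists_forall_abs_sub_le_mul_of_tendsto {h : ℝ → ℝ} (hm : Measurable h)
    (hh : ∀ t, Tendsto (fun x => h (x + t) - h x) atTop (𝓝 0)) {ε : ℝ} (hε : 0 < ε) :
    ∃ X, ∀ x ≥ X, ∀ y ≥ X, |h y - h x| ≤ ε * (|y - x| + 1) := by
  obtain ⟨X, hX⟩ := exists_forall_abs_sub_le_of_tendsto hm hh hε
  have key : ∀ n : ℕ, ∀ x ≥ X, ∀ t : ℝ, 0 ≤ t → t ≤ n → |h (x + t) - h x| ≤ ε * n := by
    intro n
    induction n with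
    | zero =>
      intro x _ t ht ht'
      have : t = 0 := le_antisymm (by simpa using ht') ht
      simp [this]
    | succ n ih =>
      intro x hx t ht ht'
      push_cast at ht' ⊢
      rcases le_total t 1 with h1 | h1
      · refine (hX x hx t ⟨ht, h1⟩).trans (le_mul_of_one_le_right hε.le ?_)
        linarith [n.cast_nonneg (α := ℝ)]
      · have e1 := ih (x + 1) (by linarith) (t - 1) (by linarith) (by linarith)
        have e2 := hX x hx 1 ⟨zero_le_one, le_rfl⟩
        rw [show x + 1 + (t - 1) = x + t by ring] at e1
        calc |h (x + t) - h x| ≤ |h (x + t) - h (x + 1)| + |h (x + 1) - h x| := abs_sub_le _ _ _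
          _ ≤ ε * n + ε := add_le_add e1 e2
          _ = ε * (n + 1) := by ring
  have key2 : ∀ x ≥ X, ∀ y ≥ x, |h y - h x| ≤ ε * (|y - x| + 1) := by
    intro x hx y hy
    have h0 : 0 ≤ y - x := sub_nonneg.2 hy
    have := key ⌈y - x⌉₊ x hx (y - x) h0 (Nat.le_ceil _)
    rw [add_sub_cancel] at this
    refine this.trans (mul_le_mul_of_nonneg_left ?_ hε.le)
    rw [abs_of_nonneg h0]
    exact (Nat.ceil_lt_add_one h0).le
  refine ⟨X, fun x hx y hy => ?_⟩
  rcases le_total x y with hxy | hxy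
  · exact key2 x hx y hxy
  · rw [abs_sub_comm, abs_sub_comm y x]
    exact key2 y hy x hxy

namespace IsSlowlyVarying

variable {L : ℝ → ℝ}

/-- Slow variation of `L` says that the increments of `log ∘ L ∘ exp` vanish at infinity; this is
Potter's bound in logarithmic form. -/
theorem exists_abs_log_sub_le (hL : IsSlowlyVarying L) {ε : ℝ} (hε : 0 < ε) :
    ∃ x₀ ≥ 1, ∀ x ≥ x₀, 0 < L x ∧ ∀ y ≥ x₀,
      |Real.log (L y) - Real.log (L x)| ≤ ε * (|Real.log y - Real.log x| + 1) := by
  obtain ⟨hm, hpos, hlim⟩ := hL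
  have hpos' : ∀ᶠ x in atTop, 0 < L (Real.exp x) := Real.tendsto_exp_atTop.eventually hpos
  obtain ⟨X, hX⟩ := exists_forall_abs_sub_le_mul_of_tendsto
    (h := fun x => Real.log (L (Real.exp x))) (by fun_prop) (fun t => by
      have h1 := (hlim (Real.exp t) (Real.exp_pos t)).comp Real.tendsto_exp_atTop
      have h2 := (Real.continuousAt_log one_ne_zero).tendsto.comp h1
      rw [Real.log_one] at h2
      refine h2.congr' ?_
      filter_upwards [hpos', (tendsto_atTop_add_const_right _ t tendsto_id).eventually hpos']
        with x hx hx'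
      simp only [id_eq] at hx'
      rw [← Real.log_div hx'.ne' hx.ne']
      simp [Real.exp_add, mul_comm]) hε
  obtain ⟨x₁, hx₁⟩ := eventually_atTop.1 hpos
  refine ⟨max 1 (max x₁ (Real.exp X)), le_max_left _ _, fun x hx => ?_⟩
  simp only [ge_iff_le, max_le_iff] at hx
  refine ⟨hx₁ x hx.2.1, fun y hy => ?_⟩
  simp only [ge_iff_le, max_le_iff] at hy
  have hx0 : 0 < x := by linarith
  have hy0 : 0 < y := by linarith
  have := hX (Real.log x) ((Real.le_log_iff_exp_le hx0).2 hx.2.2) (Real.log y)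
    ((Real.le_log_iff_exp_le hy0).2 hy.2.2)
  simpa [Real.exp_log hx0, Real.exp_log hy0] using this

/-- Potter's bound. -/
theorem exists_le_mul (hL : IsSlowlyVarying L) {ε : ℝ} (hε : 0 < ε) :
    ∃ x₀ ≥ 1, ∀ x ≥ x₀, 0 < L x ∧ ∀ u > 0, x₀ ≤ x / u →
      L (x / u) / L x ≤ Real.exp ε * (u ^ ε + u ^ (-ε)) := by
  obtain ⟨x₀, hx₀, h⟩ := hL.exists_abs_log_sub_le hε
  refine ⟨x₀, hx₀, fun x hx => ⟨(h x hx).1, fun u hu hxu => ?_⟩⟩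
  have hx0 : 0 < x := by linarith
  have hLx := (h x hx).1
  have hLy := (h (x / u) hxu).1
  have h1 := (le_abs_self _).trans ((h x hx).2 (x / u) hxu)
  rw [Real.log_div hx0.ne' hu.ne', ← Real.log_div hLy.ne' hLx.ne', Real.log_le_iff_le_exp
    (div_pos hLy hLx)] at h1
  refine h1.trans ?_
  rw [show ε * (|Real.log x - Real.log u - Real.log x| + 1) = ε + ε * |Real.log u| by
    rw [show Real.log x - Real.log u - Real.log x = -Real.log u by ring, abs_neg]; ring,
    Real.exp_add]
  refine mul_le_mul_of_nonneg_left ?_ (Real.exp_pos _).le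
  have p1 := Real.rpow_pos_of_pos hu ε
  have p2 := Real.rpow_pos_of_pos hu (-ε)
  -- `exp (ε |log u|)` is `u ^ ε` or `u ^ (-ε)` according to the sign of `log u`; the sum covers
  -- both.
  rcases abs_cases (Real.log u) with ⟨ha, -⟩ | ⟨ha, -⟩
  · rw [ha, mul_comm, ← Real.rpow_def_of_pos hu]
    linarith
  · rw [ha, mul_neg, ← neg_mul, mul_comm, ← Real.rpow_def_of_pos hu]
    linarith

/-- Potter's bound with exponent `γ / 2` uses up only half of `γ log x`. The sign `s = ±1` serves
both `x ^ γ L x` and `x ^ γ / L x`. -/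
theorem tendsto_mul_log_add (hL : IsSlowlyVarying L) {γ : ℝ} (hγ : 0 < γ) (s : ℝ) (hs : |s| = 1) :
    Tendsto (fun x => γ * Real.log x + s * Real.log (L x)) atTop atTop := by
  obtain ⟨x₀, hx₀, h⟩ := hL.exists_abs_log_sub_le (half_pos hγ)
  have : Tendsto (fun x => γ / 2 * Real.log x +
      (s * Real.log (L x₀) + γ / 2 * Real.log x₀ - γ / 2)) atTop atTop :=
    tendsto_atTop_add_const_right _ _ (Real.tendsto_log_atTop.const_mul_atTop (half_pos hγ))
  refine tendsto_atTop_mono' _ ?_ this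
  filter_upwards [eventually_ge_atTop x₀] with x hx
  have h1 := (h x₀ le_rfl).2 x hx
  have h2 : Real.log x₀ ≤ Real.log x := Real.log_le_log (by linarith) hx
  rw [abs_of_nonneg (sub_nonneg.2 h2)] at h1
  rw [← one_mul |Real.log (L x) - _|, ← hs, ← abs_mul, hs] at h1
  have := (abs_le.1 h1).1
  linarith

theorem tendsto_rpow_mul (hL : IsSlowlyVarying L) {γ : ℝ} (hγ : 0 < γ) :
    Tendsto (fun x => x ^ γ * L x) atTop atTop := by
  refine (Real.tendsto_exp_atTop.comp (hL.tendsto_mul_log_add hγ 1 abs_one)).congr' ?_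
  filter_upwards [hL.2.1, eventually_gt_atTop 0] with x hx hx0
  simp [Real.exp_add, Real.exp_log hx, Real.rpow_def_of_pos hx0, mul_comm]

theorem tendsto_rpow_div (hL : IsSlowlyVarying L) {γ : ℝ} (hγ : 0 < γ) :
    Tendsto (fun x => x ^ γ / L x) atTop atTop := by
  refine (Real.tendsto_exp_atTop.comp (hL.tendsto_mul_log_add hγ (-1) (by simp))).congr' ?_
  filter_upwards [hL.2.1, eventually_gt_atTop 0] with x hx hx0
  simp [Real.exp_add, Real.exp_neg, Real.exp_log hx, Real.rpow_def_of_pos hx0, mul_comm,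
    div_eq_mul_inv]

end IsSlowlyVarying

end SlowVariation

/-! ### Quantile function of the absolute value of a symmetric law -/

section Quantile

/-- The tail of the absolute value of a random variable with law `ν`. -/
def absTail (ν : Measure ℝ) (x : ℝ) : ℝ := ν.real {y | x < |y|}

open Classical in
/-- The upper quantile function of the absolute value of a random variable with law `ν`. -/
def absQuantile (ν : Measure ℝ) (w : ℝ) : ℝ :=
  if w ∈ Set.Ioo (0 : ℝ) 1 then sInf {x | absTail ν x ≤ w} else 0

variable {ν : Measure ℝ} {α C : ℝ}

theorem absTail_mul_rpow_tendsto
    (hν : Asymptotics.IsEquivalent atTop (absTail ν) (fun x : ℝ => C * x ^ (-α))) :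
    Tendsto (fun x => absTail ν x * x ^ α) atTop (𝓝 C) := by
  have h1 : Asymptotics.IsEquivalent atTop (fun x => absTail ν x * x ^ α)
      (fun x => C * x ^ (-α) * x ^ α) := hν.mul .refl
  refine h1.symm.tendsto_nhds (tendsto_const_nhds.congr' ?_)
  filter_upwards [eventually_gt_atTop 0] with x hx
  rw [mul_assoc, ← Real.rpow_add hx]
  simp

variable [IsProbabilityMeasure ν]

theorem measurableSet_lt_abs (x : ℝ) : MeasurableSet {y : ℝ | x < |y|} :=
  measurableSet_lt measurable_const (by fun_prop)

theorem absTail_antitone : Antitone (absTail ν) := fun _ _ h =>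
  measureReal_mono fun _ hz => lt_of_le_of_lt h hz

theorem absTail_le_one (x : ℝ) : absTail ν x ≤ 1 := measureReal_le_one

theorem absTail_of_neg {x : ℝ} (hx : x < 0) : absTail ν x = 1 := by
  have : {y : ℝ | x < |y|} = Set.univ := Set.eq_univ_of_forall fun y => hx.trans_le (abs_nonneg y)
  simp [absTail, this]

theorem bddBelow_absTail_le {w : ℝ} (hw : w < 1) : BddBelow {x | absTail ν x ≤ w} := by
  refine ⟨0, fun x hx => ?_⟩
  by_contra! h
  have : absTail ν x ≤ w := hx
  rw [absTail_of_neg h] at this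
  linarith

theorem absTail_tendsto_zero : Tendsto (absTail ν) atTop (𝓝 0) := by
  have h := tendsto_measure_iInter_atTop (μ := ν) (s := fun x : ℝ => {y : ℝ | x < |y|})
    (fun x => (measurableSet_lt_abs x).nullMeasurableSet) (fun _ _ h _ hz => lt_of_le_of_lt h hz)
    ⟨0, measure_ne_top _ _⟩
  have he : ⋂ x : ℝ, {y : ℝ | x < |y|} = ∅ := by
    ext y
    simp only [Set.mem_iInter, Set.mem_empty_iff_false, iff_false, not_forall]
    exact ⟨|y|, fun h => lt_irrefl |y| h⟩
  rw [he, measure_empty] at h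
  exact (ENNReal.tendsto_toReal ENNReal.zero_ne_top).comp h

/-- The forward direction is right continuity of the tail: `{x < |y|}` is the increasing union of
the sets `{x + 1 / (n + 1) < |y|}`. -/
theorem absQuantile_le_iff {w : ℝ} (hw : w ∈ Set.Ioo (0 : ℝ) 1) (x : ℝ) :
    absQuantile ν w ≤ x ↔ absTail ν x ≤ w := by
  rw [absQuantile, if_pos hw]
  refine ⟨fun h => ?_, fun h => csInf_le (bddBelow_absTail_le hw.2) h⟩
  have hne : {x | absTail ν x ≤ w}.Nonempty :=
    ((absTail_tendsto_zero (ν := ν)).eventually (ge_mem_nhds hw.1)).exists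
  have hgt : ∀ y > x, absTail ν y ≤ w := fun y hy => by
    obtain ⟨z, hz, hzy⟩ := exists_lt_of_csInf_lt hne (h.trans_lt hy)
    exact (absTail_antitone hzy.le).trans hz
  have hmono : Monotone fun n : ℕ => {y : ℝ | x + 1 / ((n : ℝ) + 1) < |y|} := fun n m hnm y hy => by
    have hy' : x + 1 / ((n : ℝ) + 1) < |y| := hy
    refine lt_of_le_of_lt (add_le_add le_rfl ?_) hy'
    exact one_div_le_one_div_of_le (by positivity) (by exact_mod_cast Nat.succ_le_succ hnm)
  have hU : ⋃ n : ℕ, {y : ℝ | x + 1 / ((n : ℝ) + 1) < |y|} = {y | x < |y|} := by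
    ext y
    refine ⟨fun hy => ?_, fun hy => ?_⟩
    · obtain ⟨n, hn⟩ := Set.mem_iUnion.1 hy
      have hn' : x + 1 / ((n : ℝ) + 1) < |y| := hn
      exact lt_trans (lt_add_of_pos_right x (by positivity)) hn'
    · obtain ⟨n, hn⟩ := exists_nat_one_div_lt (sub_pos.2 (show x < |y| from hy))
      exact Set.mem_iUnion.2 ⟨n, show x + 1 / ((n : ℝ) + 1) < |y| by linarith⟩
  have h := tendsto_measure_iUnion_atTop (μ := ν) hmono
  rw [hU] at h
  refine le_of_tendsto' ((ENNReal.tendsto_toReal (measure_ne_top _ _)).comp h) fun n => ?_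
  exact hgt _ (lt_add_of_pos_right _ (by positivity))

theorem absQuantile_nonneg (w : ℝ) : 0 ≤ absQuantile ν w := by
  by_cases hw : w ∈ Set.Ioo (0 : ℝ) 1
  · by_contra! h
    obtain ⟨x, hx, hx0⟩ := exists_between h
    have := (absQuantile_le_iff hw x).1 hx.le
    rw [absTail_of_neg hx0] at this
    linarith [hw.2]
  · simp [absQuantile, hw]

theorem measurable_absQuantile : Measurable (absQuantile ν) := by
  refine measurable_of_Iic fun x => ?_
  have : absQuantile ν ⁻¹' Set.Iic x = (Set.Ioo 0 1 ∩ Set.Ici (absTail ν x)) ∪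
      ((Set.Ioo (0 : ℝ) 1)ᶜ ∩ {_w | 0 ≤ x}) := by
    ext w
    by_cases hw : w ∈ Set.Ioo (0 : ℝ) 1
    · simp only [Set.mem_preimage, Set.mem_Iic, absQuantile_le_iff hw]
      simp [hw.1, hw.2]
    · simp [absQuantile, hw]
  rw [this]
  exact (measurableSet_Ioo.inter measurableSet_Ici).union
    (measurableSet_Ioo.compl.inter (MeasurableSet.const _))

/-- Inverse transform sampling: among the levels `w` in `(0, 1)`, those with quantile at most `x`
fill the interval from `absTail ν x` to 1. -/
theorem map_absQuantile :
    (volume.restrict (Set.Ioo (0 : ℝ) 1)).map (absQuantile ν) = ν.map (fun x => |x|) := by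
  have : IsProbabilityMeasure (volume.restrict (Set.Ioo (0 : ℝ) 1)) := ⟨by simp⟩
  have := Measure.isProbabilityMeasure_map (μ := volume.restrict (Set.Ioo (0 : ℝ) 1))
    (measurable_absQuantile (ν := ν)).aemeasurable
  refine Measure.ext_of_Iic _ _ fun x => ?_
  rw [Measure.map_apply measurable_absQuantile measurableSet_Iic,
    Measure.map_apply (by fun_prop) measurableSet_Iic,
    Measure.restrict_apply (measurable_absQuantile measurableSet_Iic)]
  have h1 : absQuantile ν ⁻¹' Set.Iic x ∩ Set.Ioo 0 1 = Set.Ioo 0 1 ∩ Set.Ici (absTail ν x) := by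
    ext w
    by_cases hw : w ∈ Set.Ioo (0 : ℝ) 1
    · simp only [Set.mem_inter_iff, Set.mem_preimage, Set.mem_Iic, absQuantile_le_iff hw, hw]
      simp
    · simp [hw]
  have h2 : volume (Set.Ioo 0 1 ∩ Set.Ici (absTail ν x)) = volume (Set.Ico (absTail ν x) 1) := by
    refine measure_congr ?_
    filter_upwards [measure_eq_zero_iff_ae_notMem.1 (measure_singleton (μ := volume) (0 : ℝ))]
      with w hw
    have h0 : 0 ≤ absTail ν x := measureReal_nonneg
    have hw' : w ≠ 0 := hw
    refine propext ⟨fun h => ⟨h.2, h.1.2⟩, fun h => ⟨⟨?_, h.2⟩, h.1⟩⟩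
    exact lt_of_le_of_ne (h0.trans h.1) hw'.symm
  have h3 : (fun x : ℝ => |x|) ⁻¹' Set.Iic x = {y | x < |y|}ᶜ := by
    ext y
    simp
  rw [h1, h2, Real.volume_Ico, h3, prob_compl_eq_one_sub (measurableSet_lt_abs x), absTail,
    ENNReal.ofReal_sub _ measureReal_nonneg, ENNReal.ofReal_one, ofReal_measureReal]

/-- Integrals against a symmetric law in terms of the quantile function. -/
theorem integral_eq_integral_absQuantile (hν : ν.map (fun x => -x) = ν) {g : ℝ → ℂ}
    (hg : Measurable g) {M : ℝ} (hM : ∀ x, ‖g x‖ ≤ M) :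
    ∫ x, g x ∂ν =
      ∫ w in Set.Ioo (0 : ℝ) 1, (g (absQuantile ν w) + g (-absQuantile ν w)) / 2 := by
  have hneg : ∫ x, g (-x) ∂ν = ∫ x, g x ∂ν := by
    conv_rhs => rw [← hν, integral_map (by fun_prop) (by fun_prop)]
  have hi : Integrable g ν := .of_bound (by fun_prop) M (ae_of_all _ hM)
  have hi' : Integrable (fun x => g (-x)) ν :=
    .of_bound (hg.comp measurable_neg).aestronglyMeasurable M (ae_of_all _ fun x => hM (-x))
  calc ∫ x, g x ∂ν = ∫ x, (g x + g (-x)) / 2 ∂ν := by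
        rw [integral_div, integral_add hi hi', hneg]
        ring
    _ = ∫ x, (g |x| + g (-|x|)) / 2 ∂ν := by
        -- The symmetrized integrand is even, so it depends on `|x|` only.
        refine integral_congr_ae (ae_of_all _ fun x => ?_)
        rcases abs_choice x with h | h <;> simp [h, add_comm]
    _ = ∫ x, (g x + g (-x)) / 2 ∂(ν.map fun x => |x|) := by
        rw [integral_map (by fun_prop) (by fun_prop)]
    _ = _ := by
        rw [← map_absQuantile, integral_map measurable_absQuantile.aemeasurable (by fun_prop)]

/-- Beyond some `x₁` the asymptotics give the constant `2 * C`; below it the tail is at most 1 and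
`x ^ α ≤ x₁ ^ α`. Domination requires such a bound at every positive `x`. -/
theorem exists_absTail_le (hα : 0 < α) (hC : 0 < C)
    (hν : Asymptotics.IsEquivalent atTop (absTail ν) (fun x : ℝ => C * x ^ (-α))) :
    ∃ C' > 0, ∀ x > 0, absTail ν x ≤ C' * x ^ (-α) := by
  obtain ⟨x₁, hx₁⟩ := eventually_atTop.1 (((absTail_mul_rpow_tendsto hν).eventually
    (ge_mem_nhds (show C < 2 * C by linarith))).and (eventually_gt_atTop 0))
  have hx₁0 := (hx₁ x₁ le_rfl).2
  refine ⟨max (2 * C) (x₁ ^ α), lt_max_of_lt_left (by linarith), fun x hx => ?_⟩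
  rw [Real.rpow_neg hx.le, ← div_eq_mul_inv, le_div_iff₀ (Real.rpow_pos_of_pos hx α)]
  rcases le_total x₁ x with h | h
  · exact (hx₁ x h).1.trans (le_max_left _ _)
  · refine le_trans ?_ (le_max_right _ _)
    calc absTail ν x * x ^ α ≤ 1 * x ^ α :=
          mul_le_mul_of_nonneg_right (absTail_le_one x) (Real.rpow_nonneg hx.le _)
      _ ≤ x₁ ^ α := by
          rw [one_mul]
          exact Real.rpow_le_rpow hx.le h hα.le

/-- The threshold for `v` does not depend on the scale `c`, so test functions cut all rescaled
integrals to one bounded interval. Using `δ / 2` makes the final inequality strict. -/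
theorem absQuantile_div_lt {C' c v δ : ℝ} (hC' : ∀ x > 0, absTail ν x ≤ C' * x ^ (-α))
    (hc : 0 < c) (hδ : 0 < δ) (hv : C' * (δ / 2) ^ (-α) < v) :
    absQuantile ν (v / c ^ α) / c < δ := by
  rw [div_lt_iff₀ hc]
  by_cases hw : v / c ^ α ∈ Set.Ioo (0 : ℝ) 1
  · refine lt_of_le_of_lt ((absQuantile_le_iff hw (δ / 2 * c)).2 ?_)
      (mul_lt_mul_of_pos_right (half_lt_self hδ) hc)
    refine (hC' _ (by positivity)).trans ?_
    rw [Real.mul_rpow (by positivity) hc.le, ← mul_assoc, Real.rpow_neg hc.le, ← div_eq_mul_inv]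
    exact div_le_div_of_nonneg_right hv.le (Real.rpow_nonneg hc.le _)
  · rw [absQuantile, if_neg hw]
    positivity

/-- Inversion of the power tail: the tail at `r * c n`, multiplied by `c n ^ α`, tends to `C / r ^
α`, and the limit is the solution `l` of `C / l ^ α = v`. Levels `r` on either side of `l` are
compared through `absQuantile_le_iff`. -/
theorem absQuantile_div_tendsto (hα : 0 < α) (hC : 0 < C)
    (hν : Asymptotics.IsEquivalent atTop (absTail ν) (fun x : ℝ => C * x ^ (-α)))
    {c : ℕ → ℝ} (hc : Tendsto c atTop atTop) {v : ℝ} (hv : 0 < v) :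
    Tendsto (fun n => absQuantile ν (v / c n ^ α) / c n) atTop (𝓝 ((v / C) ^ (-(1 / α)))) := by
  have hlim : ∀ r > 0, Tendsto (fun n => absTail ν (r * c n) * c n ^ α) atTop
      (𝓝 (C / r ^ α)) := fun r hr => by
    have h1 := ((absTail_mul_rpow_tendsto hν).comp (hc.const_mul_atTop hr)).div_const (r ^ α)
    refine h1.congr' ?_
    filter_upwards [hc.eventually_gt_atTop 0] with n hn
    have := (Real.rpow_pos_of_pos hr α).ne'
    simp only [Function.comp_apply]
    rw [Real.mul_rpow hr.le hn.le]
    field_simp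
  have hw : ∀ᶠ n in atTop, 0 < c n ∧ v / c n ^ α ∈ Set.Ioo (0 : ℝ) 1 := by
    have h1 : Tendsto (fun n => c n ^ α) atTop atTop := (tendsto_rpow_atTop hα).comp hc
    filter_upwards [hc.eventually_gt_atTop 0, h1.eventually_gt_atTop v] with n hn hn'
    have := Real.rpow_pos_of_pos hn α
    exact ⟨hn, div_pos hv this, (div_lt_one this).2 hn'⟩
  set l := (v / C) ^ (-(1 / α))
  have hl0 : 0 < l := Real.rpow_pos_of_pos (div_pos hv hC) _
  have hlα : l ^ α = C / v := by
    rw [← Real.rpow_mul (div_pos hv hC).le, show -(1 / α) * α = -1 by field_simp,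
      Real.rpow_neg_one, inv_div]
  refine tendsto_order.2 ⟨fun a ha => ?_, fun a ha => ?_⟩
  · obtain ⟨r, hr, hrl⟩ := exists_between (max_lt ha hl0)
    have hr0 : 0 < r := (le_max_right _ _).trans_lt hr
    have h1 : v < C / r ^ α := by
      have := Real.rpow_lt_rpow hr0.le hrl hα
      rw [hlα] at this
      rw [lt_div_iff₀ (Real.rpow_pos_of_pos hr0 α), mul_comm]
      exact (lt_div_iff₀ hv).1 this
    filter_upwards [(hlim r hr0).eventually (lt_mem_nhds h1), hw] with n hn ⟨hcn, hwn⟩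
    rw [lt_div_iff₀ hcn]
    have h2 : ¬ absQuantile ν (v / c n ^ α) ≤ r * c n := by
      rw [absQuantile_le_iff hwn, not_le]
      exact (div_lt_iff₀ (Real.rpow_pos_of_pos hcn α)).2 hn
    refine lt_of_le_of_lt (mul_le_mul_of_nonneg_right ?_ hcn.le) (not_le.1 h2)
    exact ((le_max_left _ _).trans_lt hr).le
  · obtain ⟨r, hr, hra⟩ := exists_between ha
    have hr0 : 0 < r := hl0.trans hr
    have h1 : C / r ^ α < v := by
      have := Real.rpow_lt_rpow hl0.le hr hα
      rw [hlα] at this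
      rw [div_lt_iff₀ (Real.rpow_pos_of_pos hr0 α), mul_comm]
      exact (div_lt_iff₀ hv).1 this
    filter_upwards [(hlim r hr0).eventually (gt_mem_nhds h1), hw] with n hn ⟨hcn, hwn⟩
    rw [div_lt_iff₀ hcn]
    refine lt_of_le_of_lt ((absQuantile_le_iff hwn (r * c n)).2 ?_)
      (mul_lt_mul_of_pos_right hra hcn)
    exact ((lt_div_iff₀ (Real.rpow_pos_of_pos hcn α)).2 hn).le

end Quantile

/-! ### Cluster sums with signs determined by ranks -/

section RankSums

/-- The sum of a test function over `k` points with times `t 0, …, t (k - 1)`, where the mark of a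
point is `y` with the sign that `s` attaches to the rank of its time. -/
def rankSum (g : ℝ → ℝ → ℝ) (s : ℕ → ℝ) (k : ℕ) (y : ℝ) (t : ℕ → ℝ) : ℝ :=
  ∑ j ∈ Finset.range k, g (s (Finset.card {i ∈ Finset.range k | t i ≤ t j}) * y) (t j)

/-- The sum of a test function over the points with times `(j + 1) / n`, `j ∈ S`, where the mark of
a point is `y` with the sign that `s` attaches to the rank of its time. -/
def gridSum (g : ℝ → ℝ → ℝ) (s : ℕ → ℝ) (n : ℕ) (S : Finset ℕ) (y : ℝ) : ℝ :=
  ∑ j ∈ S, g (s (Finset.card {i ∈ S | i ≤ j}) * y) (((j : ℝ) + 1) / n)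

/-- The defect `1 - exp (i x)`. -/
def expDefect (x : ℝ) : ℂ := 1 - Complex.exp (Complex.I * x)

theorem continuous_expDefect : Continuous expDefect := by
  unfold expDefect
  fun_prop

@[fun_prop]
theorem measurable_expDefect : Measurable expDefect := continuous_expDefect.measurable

@[simp]
theorem expDefect_zero : expDefect 0 = 0 := by simp [expDefect]

theorem norm_expDefect_le (x : ℝ) : ‖expDefect x‖ ≤ 2 := by
  refine (norm_sub_le _ _).trans ?_
  rw [mul_comm, Complex.norm_exp_ofReal_mul_I]
  norm_num

variable {g : ℝ → ℝ → ℝ} {s : ℕ → ℝ} {δ : ℝ}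

theorem measurable_rankSum (hg : Measurable (Function.uncurry g)) (k : ℕ) :
    Measurable fun p : ℝ × (ℕ → ℝ) => rankSum g s k p.1 p.2 := by
  refine Finset.measurable_sum _ fun j _ => ?_
  have hc : Measurable fun p : ℝ × (ℕ → ℝ) =>
      Finset.card {i ∈ Finset.range k | p.2 i ≤ p.2 j} := by
    simp_rw [Finset.card_filter]
    exact Finset.measurable_sum _ fun i _ => Measurable.ite
      (measurableSet_le (by fun_prop) (by fun_prop)) measurable_const measurable_const
  have hs : Measurable fun p : ℝ × (ℕ → ℝ) =>
      s (Finset.card {i ∈ Finset.range k | p.2 i ≤ p.2 j}) := (measurable_of_countable s).comp hc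
  exact hg.comp ((hs.mul measurable_fst).prodMk (by fun_prop))

theorem IsTestFunction.sign_mul_eq_zero (hg : IsTestFunction g δ) (hs : ∀ k, |s k| = 1) {y : ℝ}
    (hy : |y| < δ) (k : ℕ) (t : ℝ) : g (s k * y) t = 0 :=
  hg.eq_zero _ _ (by rwa [abs_mul, hs, one_mul])

theorem rankSum_eq_zero (hg : IsTestFunction g δ) (hs : ∀ k, |s k| = 1) {y : ℝ} (hy : |y| < δ)
    (k : ℕ) (t : ℕ → ℝ) : rankSum g s k y t = 0 :=
  Finset.sum_eq_zero fun _ _ => hg.sign_mul_eq_zero hs hy _ _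

theorem gridSum_eq_zero (hg : IsTestFunction g δ) (hs : ∀ k, |s k| = 1) {y : ℝ} (hy : |y| < δ)
    (n : ℕ) (S : Finset ℕ) : gridSum g s n S y = 0 :=
  Finset.sum_eq_zero fun _ _ => hg.sign_mul_eq_zero hs hy _ _

/-- The limiting times are distinct, so eventually the times are ordered as in the limit. The ranks,
and with them the signs, are then frozen, and continuity of `g` away from the mark 0 finishes. -/
theorem rankSum_tendsto (hg : IsTestFunction g δ) (hs : ∀ k, |s k| = 1) {β : Type*}
    {l : Filter β} {k : ℕ} {y : β → ℝ} {y₀ : ℝ} (hy : Tendsto y l (𝓝 y₀)) (hy₀ : y₀ ≠ 0)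
    {t : β → ℕ → ℝ} {t₀ : ℕ → ℝ} (ht : ∀ j, Tendsto (fun n => t n j) l (𝓝 (t₀ j)))
    (ht01 : ∀ n j, t n j ∈ Set.Icc (0 : ℝ) 1) (ht₀ : ∀ j, t₀ j ∈ Set.Icc (0 : ℝ) 1)
    (hinj : Function.Injective t₀) :
    Tendsto (fun n => rankSum g s k (y n) (t n)) l (𝓝 (rankSum g s k y₀ t₀)) := by
  have hsne : ∀ k, s k ≠ 0 := fun k h => by simpa [h] using hs k
  have hcmp : ∀ᶠ n in l, ∀ i ∈ Finset.range k, ∀ j ∈ Finset.range k,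
      (t n i ≤ t n j ↔ t₀ i ≤ t₀ j) := by
    simp only [Filter.eventually_all_finset]
    intro i _ j _
    rcases lt_trichotomy (t₀ i) (t₀ j) with h | h | h
    · filter_upwards [(ht i).eventually_lt (ht j) h] with n hn using iff_of_true hn.le h.le
    · simp [hinj h]
    · filter_upwards [(ht j).eventually_lt (ht i) h] with n hn using
        iff_of_false hn.not_ge h.not_ge
  have hyne : ∀ᶠ n in l, y n ≠ 0 := hy.eventually_ne hy₀
  refine tendsto_finsetSum _ fun j hj => ?_
  set r := Finset.card {i ∈ Finset.range k | t₀ i ≤ t₀ j}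
  have hlim : Tendsto (fun n => g (s r * y n) (t n j)) l (𝓝 (g (s r * y₀) (t₀ j))) := by
    have h := hg.continuousOn (s r * y₀, t₀ j) ⟨mul_ne_zero (hsne r) hy₀, ht₀ j⟩
    refine Tendsto.comp h (tendsto_nhdsWithin_iff.2 ⟨(hy.const_mul _).prodMk_nhds (ht j), ?_⟩)
    filter_upwards [hyne] with n hn
    exact ⟨mul_ne_zero (hsne r) hn, ht01 n j⟩
  refine hlim.congr' ?_
  filter_upwards [hcmp] with n hn
  rw [Finset.filter_congr fun i hi => hn i hi j hj]

/-- Injectivity of `a` makes the rank of a time among the `k` points equal to the rank of its cell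
in the image set. -/
theorem rankSum_eq_gridSum {k n : ℕ} (hn : 0 < n) (a : ℕ → ℕ)
    (ha : Set.InjOn a (Finset.range k)) (y : ℝ) :
    rankSum g s k y (fun j => ((a j : ℝ) + 1) / n) =
      gridSum g s n ((Finset.range k).image a) y := by
  have hn' : (0 : ℝ) < n := by exact_mod_cast hn
  unfold rankSum gridSum
  rw [Finset.sum_image ha]
  refine Finset.sum_congr rfl fun j _ => ?_
  rw [Finset.filter_image, Finset.card_image_of_injOn (ha.mono fun i hi => by simp_all)]
  simp [div_le_div_iff_of_pos_right hn']

end RankSums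

/-! ### Subsets of a grid as cells of uniform points -/

section UniformSequences

/-- The law of a sequence of independent uniform random variables on `(0, 1)`. -/
def uniformSeq : Measure (ℕ → ℝ) :=
  Measure.infinitePi fun _ => volume.restrict (Set.Ioo (0 : ℝ) 1)

instance isProbabilityMeasure_restrict_Ioo :
    IsProbabilityMeasure (volume.restrict (Set.Ioo (0 : ℝ) 1)) := ⟨by simp⟩

instance : IsProbabilityMeasure uniformSeq := by
  unfold uniformSeq
  infer_instance

theorem ae_uniformSeq_mem : ∀ᵐ u ∂uniformSeq, ∀ j, u j ∈ Set.Ioo (0 : ℝ) 1 := by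
  refine ae_all_iff.2 fun j => ?_
  have h := (measurePreserving_eval_infinitePi (fun _ : ℕ => volume.restrict (Set.Ioo (0 : ℝ) 1)) j)
  exact h.quasiMeasurePreserving.ae (ae_restrict_mem measurableSet_Ioo)

theorem ae_uniformSeq_injective : ∀ᵐ u ∂uniformSeq, Function.Injective u := by
  have key : ∀ i j : ℕ, i ≠ j → ∀ᵐ u ∂uniformSeq, u i ≠ u j := by
    intro i j hij
    have hmap : uniformSeq.map (fun u => (u i, u j)) = _ :=
      Measure.infinitePi_map_eval_prod (P := fun _ : ℕ => volume.restrict (Set.Ioo (0 : ℝ) 1)) hij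
    have hd : (uniformSeq.map fun u => (u i, u j)) {p : ℝ × ℝ | p.1 = p.2} = 0 := by
      rw [hmap]
      rw [Measure.measure_prod_null (measurableSet_eq_fun (by fun_prop) (by fun_prop))]
      refine ae_of_all _ fun x => ?_
      have : Prod.mk x ⁻¹' {p : ℝ × ℝ | p.1 = p.2} = {x} := by
        ext
        simp [eq_comm]
      simp [this]
    rw [Measure.map_apply (by fun_prop) (measurableSet_eq_fun (by fun_prop) (by fun_prop))] at hd
    exact measure_eq_zero_iff_ae_notMem.1 hd
  have : ∀ᵐ u ∂uniformSeq, ∀ i j, i ≠ j → u i ≠ u j := by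
    simp only [ae_all_iff]
    exact key
  filter_upwards [this] with u hu i j h
  by_contra hne
  exact hu i j hne h

/-- The cell of a grid of mesh `1 / n` that contains each of the points `u j`. -/
def gridCell (n : ℕ) (u : ℕ → ℝ) (j : ℕ) : ℕ := ⌊n * u j⌋₊

theorem measurable_gridCell (n j : ℕ) : Measurable fun u => gridCell n u j :=
  Nat.measurable_floor.comp (by fun_prop)

theorem gridCell_lt {n : ℕ} (hn : 0 < n) {u : ℕ → ℝ} {j : ℕ} (hu : u j ∈ Set.Ioo (0 : ℝ) 1) :
    gridCell n u j < n := by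
  have hn' : (0 : ℝ) < n := by exact_mod_cast hn
  exact (Nat.floor_lt (by have := hu.1; positivity)).2 (mul_lt_of_lt_one_right hn' hu.2)

theorem uniformSeq_gridCell {n : ℕ} (hn : 0 < n) {k : ℕ} (b : Fin k → ℕ) (hb : ∀ j, b j < n) :
    uniformSeq {u | ∀ j : Fin k, gridCell n u j = b j} = ENNReal.ofReal (1 / n) ^ k := by
  have hn' : (0 : ℝ) < n := by exact_mod_cast hn
  let b' : ℕ → ℕ := fun j => if h : j < k then b ⟨j, h⟩ else 0
  let t : ℕ → Set ℝ := fun j => {x | ⌊n * x⌋₊ = b' j}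
  have htm : ∀ j, MeasurableSet (t j) := fun j =>
    (Nat.measurable_floor.comp (measurable_const_mul (n : ℝ))) (measurableSet_singleton (b' j))
  have hset : {u | ∀ j : Fin k, gridCell n u j = b j} = Set.pi (Finset.range k) t := by
    ext u
    simp only [Set.mem_ofPred_eq, Set.mem_pi, Finset.coe_range, Set.mem_Iio]
    refine ⟨fun h j hj => ?_, fun h j => ?_⟩
    · simpa [t, b', hj, gridCell] using h ⟨j, hj⟩
    · simpa [t, b', gridCell] using h j j.2
  rw [hset, uniformSeq, Measure.infinitePi_pi _ fun j _ => htm j]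
  refine (Finset.prod_eq_pow_card (b := ENNReal.ofReal (1 / n)) fun j hj => ?_).trans (by simp)
  have hj' := Finset.mem_range.1 hj
  have hbj : b' j < n := by simpa [b', hj'] using hb ⟨j, hj'⟩
  have hbj' : (b' j : ℝ) + 1 ≤ n := by exact_mod_cast hbj
  rw [Measure.restrict_apply (htm j)]
  have h1 : volume (t j ∩ Set.Ioo 0 1) = volume (Set.Ico ((b' j : ℝ) / n) ((b' j + 1) / n)) := by
    refine measure_congr ?_
    filter_upwards [measure_eq_zero_iff_ae_notMem.1 (measure_singleton (μ := volume) (0 : ℝ))]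
      with x hx
    have hx' : x ≠ 0 := hx
    refine propext ⟨fun h => ?_, fun h => ?_⟩
    · have h2 : ⌊n * x⌋₊ = b' j := h.1
      have h3 : 0 ≤ n * x := by have := h.2.1; positivity
      have h4 := (Nat.floor_eq_iff h3).1 h2
      exact ⟨by rw [div_le_iff₀ hn']; linarith [h4.1], by rw [lt_div_iff₀ hn']; linarith [h4.2]⟩
    · have h2 := h.1
      have h3 := h.2
      rw [div_le_iff₀ hn'] at h2
      rw [lt_div_iff₀ hn'] at h3
      have h0 : 0 ≤ x := le_trans (by positivity) h.1
      refine ⟨(Nat.floor_eq_iff (by positivity)).2 ⟨by linarith, by linarith⟩,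
        lt_of_le_of_ne h0 hx'.symm, ?_⟩
      nlinarith
  rw [h1, Real.volume_Ico]
  congr 1
  ring

theorem integral_gridCell {n : ℕ} (hn : 0 < n) (k : ℕ) (Φ : (Fin k → ℕ) → ℂ) :
    ∫ u, Φ (fun j => gridCell n u j) ∂uniformSeq =
      (1 / n) ^ k * ∑ b ∈ Fintype.piFinset fun _ : Fin k => Finset.range n, Φ b := by
  classical
  have hms : ∀ b : Fin k → ℕ, MeasurableSet {u : ℕ → ℝ | ∀ j : Fin k, gridCell n u j = b j} :=
    fun b => by
      have : {u : ℕ → ℝ | ∀ j : Fin k, gridCell n u j = b j} =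
          ⋂ j : Fin k, (fun u => gridCell n u j) ⁻¹' {b j} := by
        ext
        simp
      rw [this]
      exact MeasurableSet.iInter fun j => measurable_gridCell n j (measurableSet_singleton _)
  have hae : (fun u => Φ (fun j => gridCell n u j)) =ᵐ[uniformSeq] fun u =>
      ∑ b ∈ Fintype.piFinset fun _ : Fin k => Finset.range n,
        {u : ℕ → ℝ | ∀ j : Fin k, gridCell n u j = b j}.indicator (fun _ => Φ b) u := by
    filter_upwards [ae_uniformSeq_mem] with u hu
    rw [Finset.sum_eq_single fun j : Fin k => gridCell n u j]
    · simp
    · intro b _ hb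
      refine Set.indicator_of_notMem (fun h => hb ?_) _
      exact funext fun j => (h j).symm
    · intro h
      refine absurd (Fintype.mem_piFinset.2 fun j : Fin k => ?_) h
      exact Finset.mem_range.2 (gridCell_lt hn (hu j))
  rw [integral_congr_ae hae, integral_finsetSum _ fun b _ =>
    (integrable_const (Φ b)).indicator (hms b), Finset.mul_sum]
  refine Finset.sum_congr rfl fun b hb => ?_
  rw [integral_indicator_const _ (hms b), measureReal_def, uniformSeq_gridCell hn b fun j =>
    Finset.mem_range.1 (Fintype.mem_piFinset.1 hb j)]
  rw [← ENNReal.ofReal_pow (by positivity), ENNReal.toReal_ofReal (by positivity)]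
  simp

/-- Injective enumerations of `S` are the same as equivalences between `Fin k` and `S`. -/
theorem card_injective_image_eq (k : ℕ) (S : Finset ℕ) (hS : S.card = k) {A : Finset (Fin k → ℕ)}
    (hA : ∀ b, (∀ j, b j ∈ S) → b ∈ A) :
    Finset.card {b ∈ A | Function.Injective b ∧ Finset.univ.image b = S} = k.factorial := by
  have h1 : Fintype.card (Fin k ≃ S) = k.factorial := by
    rw [Fintype.card_equiv (S.equivFinOfCardEq hS).symm, Fintype.card_fin]
  rw [← h1, ← Finset.card_univ]
  symm
  refine Finset.card_bij (fun (e : Fin k ≃ S) _ j => (e j : ℕ)) (fun e _ => ?_) ?_ ?_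
  · refine Finset.mem_filter.2 ⟨hA _ fun j => (e j).2, Subtype.val_injective.comp e.injective, ?_⟩
    ext x
    simp only [Finset.mem_image, Finset.mem_univ, true_and]
    exact ⟨fun ⟨j, hj⟩ => hj ▸ (e j).2, fun hx => ⟨e.symm ⟨x, hx⟩, by simp⟩⟩
  · intro e _ e' _ h
    ext j
    exact congrFun h j
  · intro b hb
    obtain ⟨-, hinj, himg⟩ := Finset.mem_filter.1 hb
    have hmem : ∀ j, b j ∈ S := fun j => himg ▸ Finset.mem_image_of_mem b (Finset.mem_univ j)
    refine ⟨Equiv.ofBijective (fun j => ⟨b j, hmem j⟩) ⟨fun i j h => hinj ?_, fun x => ?_⟩,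
      Finset.mem_univ _, rfl⟩
    · exact congrArg Subtype.val h
    · have hx : (x : ℕ) ∈ Finset.univ.image b := himg.symm ▸ x.2
      obtain ⟨j, -, hj⟩ := Finset.mem_image.1 hx
      exact ⟨j, Subtype.ext hj⟩

-- Passing to `Fin k` exhibits the integrand as a function of finitely many cells, which has a
-- countable domain.
open Classical in
theorem ite_injOn_gridCell_eq (n k : ℕ) (G : Finset ℕ → ℂ) (u : ℕ → ℝ) :
    (if Set.InjOn (gridCell n u) (Finset.range k) then
      G ((Finset.range k).image (gridCell n u)) else 0) =
    if Function.Injective (fun j : Fin k => gridCell n u j) then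
      G (Finset.univ.image fun j : Fin k => gridCell n u j) else 0 := by
  have h1 : Set.InjOn (gridCell n u) (Finset.range k) ↔
      Function.Injective fun j : Fin k => gridCell n u j := by
    refine ⟨fun h i j hij => Fin.ext (h (by simp) (by simp) hij), fun h i hi j hj hij => ?_⟩
    have := @h ⟨i, by simpa using hi⟩ ⟨j, by simpa using hj⟩ hij
    simpa using this
  have h2 : (Finset.range k).image (gridCell n u) =
      Finset.univ.image fun j : Fin k => gridCell n u j := by
    ext x
    simp only [Finset.mem_image, Finset.mem_range, Finset.mem_univ, true_and]
    exact ⟨fun ⟨j, hj, h⟩ => ⟨⟨j, hj⟩, h⟩, fun ⟨j, h⟩ => ⟨j, j.2, h⟩⟩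
  simp only [h1, h2]

open Classical in
/-- A sum over the `k`-element subsets of a grid as an integral over uniform sequences. -/
theorem sum_powersetCard_eq_integral {n : ℕ} (hn : 0 < n) (k : ℕ) (G : Finset ℕ → ℂ) :
    ∑ S ∈ (Finset.range n).powersetCard k, G S = n ^ k / k.factorial *
      ∫ u, (if Set.InjOn (gridCell n u) (Finset.range k) then
        G ((Finset.range k).image (gridCell n u)) else 0) ∂uniformSeq := by
  let Φ : (Fin k → ℕ) → ℂ := fun b => if Function.Injective b then G (Finset.univ.image b) else 0
  have hΦ : ∀ u : ℕ → ℝ, (if Set.InjOn (gridCell n u) (Finset.range k) then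
      G ((Finset.range k).image (gridCell n u)) else 0) = Φ fun j => gridCell n u j :=
    ite_injOn_gridCell_eq n k G
  have hn' : (n : ℂ) ≠ 0 := by exact_mod_cast hn.ne'
  have hk : (k.factorial : ℂ) ≠ 0 := by exact_mod_cast k.factorial_ne_zero
  simp_rw [hΦ]
  rw [integral_gridCell hn k Φ]
  have hmain : ∑ b ∈ Fintype.piFinset fun _ : Fin k => Finset.range n, Φ b =
      k.factorial * ∑ S ∈ (Finset.range n).powersetCard k, G S := by
    rw [← Finset.sum_filter, ← Finset.sum_fiberwise_of_maps_to
      (t := (Finset.range n).powersetCard k) (g := fun b => Finset.univ.image b), Finset.mul_sum]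
    · refine Finset.sum_congr rfl fun S hS => ?_
      obtain ⟨hSn, hSk⟩ := Finset.mem_powersetCard.1 hS
      rw [Finset.filter_filter]
      rw [Finset.sum_congr rfl fun b hb => by rw [(Finset.mem_filter.1 hb).2.2], Finset.sum_const,
        card_injective_image_eq k S hSk fun b hb => Fintype.mem_piFinset.2 fun j => hSn (hb j)]
      simp
    · intro b hb
      obtain ⟨hb1, hb2⟩ := Finset.mem_filter.1 hb
      refine Finset.mem_powersetCard.2 ⟨fun x hx => ?_, ?_⟩
      · obtain ⟨j, -, rfl⟩ := Finset.mem_image.1 hx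
        exact Fintype.mem_piFinset.1 hb1 j
      · rw [Finset.card_image_of_injective _ hb2]
        simp
  rw [hmain, one_div, inv_pow]
  field_simp

end UniformSequences

/-! ### Poisson limit of the binomial cluster -/

section BinomialDefects

variable (g : ℝ → ℝ → ℝ) (s : ℕ → ℝ)

/-- The expected defect of the sum over the successes among `n` Bernoulli trials. -/
def binomialDefect (n : ℕ) (p y : ℝ) : ℂ :=
  ∑ S ∈ (Finset.range n).powerset,
    ((p ^ S.card * (1 - p) ^ (n - S.card) : ℝ) : ℂ) * expDefect (gridSum g s n S y)

/-- The expected defect of the sum over `k` points with uniform times. -/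
def meanDefect (k : ℕ) (y : ℝ) : ℂ := ∫ t, expDefect (rankSum g s k y t) ∂uniformSeq

/-- The expected defect of the sum over a Poisson number of points with uniform times. -/
def poissonDefect (u y : ℝ) : ℂ :=
  ∑' k : ℕ, ((u ^ k / k.factorial * Real.exp (-u) : ℝ) : ℂ) * meanDefect g s k y

variable {g s} {δ : ℝ}

theorem measurable_binomialDefect (hg : Measurable (Function.uncurry g)) (n : ℕ) {β : Type*}
    [MeasurableSpace β] {p y : β → ℝ} (hp : Measurable p) (hy : Measurable y) :
    Measurable fun b => binomialDefect g s n (p b) (y b) := by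
  refine Finset.measurable_sum _ fun S _ => Measurable.mul (by fun_prop) ?_
  refine measurable_expDefect.comp (Finset.measurable_sum _ fun j _ => ?_)
  exact hg.comp ((hy.const_mul _).prodMk measurable_const)

theorem binomialDefect_eq_zero (hg : IsTestFunction g δ) (hs : ∀ k, |s k| = 1) {y : ℝ}
    (hy : |y| < δ) (n : ℕ) (p : ℝ) : binomialDefect g s n p y = 0 :=
  Finset.sum_eq_zero fun S _ => by simp [gridSum_eq_zero hg hs hy]

/-- The empty pattern has no defect; the other patterns have total probability `1 - (1 - p) ^ n` and
defect at most 2. With Bernoulli's inequality this gives the linear bound that controls small `p`.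
-/
theorem norm_binomialDefect_le {p : ℝ} (hp : p ∈ Set.Icc (0 : ℝ) 1) (n : ℕ) (y : ℝ) :
    ‖binomialDefect g s n p y‖ ≤ 2 * (1 - (1 - p) ^ n) := by
  have hp0 := hp.1
  have hp1 : 0 ≤ 1 - p := sub_nonneg.2 hp.2
  have hsum : ∑ S ∈ (Finset.range n).powerset, p ^ S.card * (1 - p) ^ (n - S.card) = 1 := by
    have := Finset.sum_pow_mul_eq_add_pow p (1 - p) (Finset.range n)
    simpa using this
  have h0 : ∅ ∈ (Finset.range n).powerset := Finset.empty_mem_powerset _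
  rw [← Finset.add_sum_erase _ _ h0] at hsum
  unfold binomialDefect
  rw [← Finset.add_sum_erase _ _ h0]
  have h1 : expDefect (gridSum g s n ∅ y) = 0 := by simp [gridSum]
  rw [h1, mul_zero, zero_add]
  refine (norm_sum_le _ _).trans ?_
  calc ∑ S ∈ (Finset.range n).powerset.erase ∅,
        ‖((p ^ S.card * (1 - p) ^ (n - S.card) : ℝ) : ℂ) * expDefect (gridSum g s n S y)‖
      ≤ ∑ S ∈ (Finset.range n).powerset.erase ∅, p ^ S.card * (1 - p) ^ (n - S.card) * 2 := by
        refine Finset.sum_le_sum fun S _ => ?_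
        rw [norm_mul, Complex.norm_real, Real.norm_of_nonneg (by positivity)]
        exact mul_le_mul_of_nonneg_left (norm_expDefect_le _) (by positivity)
    _ = 2 * (1 - (1 - p) ^ n) := by
        rw [← Finset.sum_mul]
        simp only [Finset.card_empty, pow_zero, one_mul, tsub_zero] at hsum
        linarith

theorem norm_binomialDefect_le_two {p : ℝ} (hp : p ∈ Set.Icc (0 : ℝ) 1) (n : ℕ) (y : ℝ) :
    ‖binomialDefect g s n p y‖ ≤ 2 := by
  have := pow_nonneg (sub_nonneg.2 hp.2) n
  linarith [norm_binomialDefect_le (g := g) (s := s) hp n y]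

theorem norm_binomialDefect_le_mul {p : ℝ} (hp : p ∈ Set.Icc (0 : ℝ) 1) (n : ℕ) (y : ℝ) :
    ‖binomialDefect g s n p y‖ ≤ 2 * (n * p) := by
  have h := one_add_mul_le_pow (show (-2 : ℝ) ≤ -p by linarith [hp.2]) n
  rw [← sub_eq_add_neg] at h
  linarith [norm_binomialDefect_le (g := g) (s := s) hp n y]

theorem norm_meanDefect_le (k : ℕ) (y : ℝ) : ‖meanDefect g s k y‖ ≤ 2 := by
  refine (norm_integral_le_of_norm_le_const (ae_of_all _ fun t => norm_expDefect_le _)).trans ?_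
  simp

theorem meanDefect_eq_zero (hg : IsTestFunction g δ) (hs : ∀ k, |s k| = 1) {y : ℝ}
    (hy : |y| < δ) (k : ℕ) : meanDefect g s k y = 0 := by
  simp [meanDefect, rankSum_eq_zero hg hs hy]

@[simp]
theorem meanDefect_zero (y : ℝ) : meanDefect g s 0 y = 0 := by
  simp [meanDefect, rankSum]

theorem measurable_meanDefect (hg : Measurable (Function.uncurry g)) (k : ℕ) :
    Measurable (meanDefect g s k) := by
  have h : Measurable fun p : ℝ × (ℕ → ℝ) => expDefect (rankSum g s k p.1 p.2) :=
    measurable_expDefect.comp (measurable_rankSum hg k)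
  exact h.stronglyMeasurable.integral_prod_right.measurable

theorem gridPoint_mem (n : ℕ) {t : ℕ → ℝ} (ht : ∀ j, t j ∈ Set.Ioo (0 : ℝ) 1) (j : ℕ) :
    ((gridCell n t j : ℝ) + 1) / n ∈ Set.Icc (0 : ℝ) 1 := by
  refine ⟨by positivity, ?_⟩
  rcases n.eq_zero_or_pos with rfl | hn
  · simp
  · rw [div_le_one (by exact_mod_cast hn)]
    exact_mod_cast gridCell_lt hn (ht j)

theorem gridPoint_tendsto {t : ℕ → ℝ} (ht : ∀ j, t j ∈ Set.Ioo (0 : ℝ) 1) (j : ℕ) :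
    Tendsto (fun n : ℕ => ((gridCell n t j : ℝ) + 1) / n) atTop (𝓝 (t j)) := by
  have h1 := (tendsto_nat_floor_mul_div_atTop (ht j).1.le).comp tendsto_natCast_atTop_atTop
  have h2 := h1.add (tendsto_one_div_atTop_nhds_zero_nat (𝕜 := ℝ))
  rw [add_zero] at h2
  refine h2.congr fun n => ?_
  simp [gridCell, add_div, mul_comm]

-- Almost surely the uniform points are distinct, so they eventually occupy distinct cells, and the
-- cell times converge to them. Dominated convergence applies because defects are bounded by 2.
open Classical in
theorem integral_gridDefect_tendsto (hg : IsTestFunction g δ) (hs : ∀ k, |s k| = 1)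
    {y : ℕ → ℝ} {y₀ : ℝ} (hy : Tendsto y atTop (𝓝 y₀)) (hy₀ : y₀ ≠ 0) (k : ℕ) :
    Tendsto (fun n => ∫ t, (if Set.InjOn (gridCell n t) (Finset.range k) then
      expDefect (gridSum g s n ((Finset.range k).image (gridCell n t)) (y n)) else 0) ∂uniformSeq)
      atTop (𝓝 (meanDefect g s k y₀)) := by
  refine tendsto_integral_of_dominated_convergence (fun _ => 2) (fun n => ?_)
    (integrable_const _) (fun n => ae_of_all _ fun t => ?_) ?_
  · simp_rw [ite_injOn_gridCell_eq n k fun S => expDefect (gridSum g s n S (y n))]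
    have hm : Measurable fun (t : ℕ → ℝ) (j : Fin k) => gridCell n t j :=
      measurable_pi_lambda _ fun j => measurable_gridCell n j
    exact ((measurable_of_countable fun b : Fin k → ℕ => if Function.Injective b then
      expDefect (gridSum g s n (Finset.univ.image b) (y n)) else 0).comp hm).aestronglyMeasurable
  · split_ifs
    · exact norm_expDefect_le _
    · simp
  · filter_upwards [ae_uniformSeq_mem, ae_uniformSeq_injective] with t ht hinj
    have hlim := rankSum_tendsto (k := k) hg hs hy hy₀ (gridPoint_tendsto ht)
      (fun n j => gridPoint_mem n ht j) (fun j => Set.Ioo_subset_Icc_self (ht j)) hinj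
    refine ((continuous_expDefect.tendsto _).comp hlim).congr' ?_
    have hev : ∀ᶠ n : ℕ in atTop, Set.InjOn (gridCell n t) (Finset.range k) := by
      have : ∀ᶠ n : ℕ in atTop, ∀ i ∈ Finset.range k, ∀ j ∈ Finset.range k, i ≠ j →
          ((gridCell n t i : ℝ) + 1) / n ≠ ((gridCell n t j : ℝ) + 1) / n := by
        simp only [Filter.eventually_all_finset, Filter.eventually_imp_distrib_left]
        intro i _ j _ hij
        filter_upwards [((gridPoint_tendsto ht i).sub (gridPoint_tendsto ht j)).eventually_ne
          (sub_ne_zero.2 (hinj.ne hij))] with n hn using sub_ne_zero.1 hn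
      filter_upwards [this] with n hn i hi j hj hij
      by_contra hne
      exact hn i hi j hj hne (by rw [hij])
    filter_upwards [hev, eventually_gt_atTop 0] with n hn hn0
    rw [if_pos hn, ← rankSum_eq_gridSum hn0 _ hn]
    rfl

/-- Grouping patterns by their size `k`, the factor `n ^ k / k!` from counting cancels against `(u /
n) ^ k`. The remaining weight `u ^ k / k! * (1 - u / n) ^ (n - k)` tends to the Poisson weight, with
dominating series `2 u ^ k / k!`. -/
theorem binomialDefect_tendsto (hg : IsTestFunction g δ) (hs : ∀ k, |s k| = 1)
    {y : ℕ → ℝ} {y₀ : ℝ} (hy : Tendsto y atTop (𝓝 y₀)) (hy₀ : y₀ ≠ 0) {u : ℝ} (hu : 0 < u) :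
    Tendsto (fun n : ℕ => binomialDefect g s n (u / n) (y n)) atTop
      (𝓝 (poissonDefect g s u y₀)) := by
  classical
  let D : ℕ → ℕ → ℂ := fun n k => ∫ t, (if Set.InjOn (gridCell n t) (Finset.range k) then
      expDefect (gridSum g s n ((Finset.range k).image (gridCell n t)) (y n)) else 0) ∂uniformSeq
  have hD : ∀ n k, ‖D n k‖ ≤ 2 := fun n k => by
    refine (norm_integral_le_of_norm_le_const (C := 2) (ae_of_all _ fun t => ?_)).trans (by simp)
    split_ifs
    · exact norm_expDefect_le _
    · simp
  -- The value 0 for `k > n` turns the finite sum over sizes into a series.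
  let c : ℕ → ℕ → ℝ := fun n k => if k ≤ n then (1 - u / n) ^ (n - k) else 0
  have hc : ∀ k, Tendsto (fun n => c n k) atTop (𝓝 (Real.exp (-u))) := fun k => by
    have h1 : Tendsto (fun n : ℕ => 1 - u / (n : ℝ)) atTop (𝓝 1) := by
      simpa using (tendsto_const_div_atTop_nhds_zero_nat u).const_sub 1
    have h2 : Tendsto (fun n : ℕ => (1 + -u / (n : ℝ)) ^ n) atTop (𝓝 (Real.exp (-u))) :=
      Real.tendsto_one_add_div_pow_exp (-u)
    have h3 := h2.div (h1.pow k) (by simp)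
    rw [one_pow, div_one] at h3
    refine h3.congr' ?_
    filter_upwards [eventually_ge_atTop k, h1.eventually_ne one_ne_zero] with n hn hne
    simp only [c, if_pos hn, Pi.div_apply]
    rw [neg_div, ← sub_eq_add_neg, div_eq_iff (pow_ne_zero _ hne), ← pow_add, Nat.sub_add_cancel hn]
  have hc01 : ∀ᶠ n : ℕ in atTop, ∀ k, 0 ≤ c n k ∧ c n k ≤ 1 := by
    filter_upwards [tendsto_natCast_atTop_atTop.eventually_ge_atTop u,
      eventually_gt_atTop 0] with n hn hn0 k
    have hn0' : (0 : ℝ) < n := by exact_mod_cast hn0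
    have h1 : 0 ≤ 1 - u / n := sub_nonneg.2 ((div_le_one hn0').2 hn)
    have h2 : 1 - u / n ≤ 1 := sub_le_self _ (by positivity)
    simp only [c]
    split_ifs
    · exact ⟨pow_nonneg h1 _, pow_le_one₀ h1 h2⟩
    · simp
  have hlim : Tendsto (fun n => ∑' k : ℕ, ((u ^ k / k.factorial * c n k : ℝ) : ℂ) * D n k) atTop
      (𝓝 (poissonDefect g s u y₀)) := by
    refine tendsto_tsum_of_dominated_convergence
      (bound := fun k : ℕ => u ^ k / k.factorial * 2) ?_ (fun k => ?_) ?_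
    · exact (Real.summable_pow_div_factorial u).mul_right 2
    · have h := ((hc k).const_mul (u ^ k / k.factorial))
      exact ((Complex.continuous_ofReal.tendsto _).comp h).mul
        (integral_gridDefect_tendsto hg hs hy hy₀ k)
    · filter_upwards [hc01] with n hn k
      rw [norm_mul, Complex.norm_real, Real.norm_of_nonneg
        (mul_nonneg (by positivity) (hn k).1)]
      refine mul_le_mul ?_ (hD n k) (norm_nonneg _) (by positivity)
      exact mul_le_of_le_one_right (by positivity) (hn k).2
  refine hlim.congr' ?_
  filter_upwards [eventually_gt_atTop 0] with n hn
  have hn' : (n : ℂ) ≠ 0 := by exact_mod_cast hn.ne'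
  rw [tsum_eq_sum (s := Finset.range (n + 1))]
  · unfold binomialDefect
    rw [Finset.sum_powerset, Finset.card_range]
    refine Finset.sum_congr rfl fun k hk => ?_
    have hk' : k ≤ n := Nat.lt_succ_iff.1 (Finset.mem_range.1 hk)
    rw [Finset.sum_congr rfl fun S hS => by rw [(Finset.mem_powersetCard.1 hS).2],
      ← Finset.mul_sum, sum_powersetCard_eq_integral hn k fun S => expDefect (gridSum g s n S (y n))]
    simp only [c, if_pos hk', D]
    push_cast
    rw [div_pow]
    field_simp
  · intro k hk
    have : ¬ k ≤ n := fun h => hk (Finset.mem_range.2 (Nat.lt_succ_of_le h))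
    simp [c, this]

end BinomialDefects

/-! ### Averaging the defect over the heavy-tailed mark -/

section TailDefects

/-- The symmetrized expected defect over the successes of `n` Bernoulli trials. -/
def symDefect (g : ℝ → ℝ → ℝ) (s : ℕ → ℝ) (n : ℕ) (p y : ℝ) : ℂ :=
  (binomialDefect g s n p y + binomialDefect g s n p (-y)) / 2

/-- The symmetrized expected defect over a Poisson number of points. -/
def symPoissonDefect (g : ℝ → ℝ → ℝ) (s : ℕ → ℝ) (u y : ℝ) : ℂ :=
  (poissonDefect g s u y + poissonDefect g s u (-y)) / 2

/-- The defect integrated over the rescaled quantile function at scale `c`. -/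
def tailDefect (ν : Measure ℝ) (α : ℝ) (g : ℝ → ℝ → ℝ) (s : ℕ → ℝ) (n : ℕ) (p c : ℝ) : ℂ :=
  ∫ v, symDefect g s n p (absQuantile ν (v / c ^ α) / c)

variable {g : ℝ → ℝ → ℝ} {s : ℕ → ℝ} {δ : ℝ} {ν : Measure ℝ} [IsProbabilityMeasure ν] {α C C' : ℝ}

theorem measurable_symDefect (hg : Measurable (Function.uncurry g)) (n : ℕ) {β : Type*}
    [MeasurableSpace β] {p y : β → ℝ} (hp : Measurable p) (hy : Measurable y) :
    Measurable fun b => symDefect g s n (p b) (y b) :=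
  ((measurable_binomialDefect hg n hp hy).add
    (measurable_binomialDefect hg n hp hy.neg)).div_const 2

theorem symDefect_eq_zero (hg : IsTestFunction g δ) (hs : ∀ k, |s k| = 1) {y : ℝ}
    (hy : |y| < δ) (n : ℕ) (p : ℝ) : symDefect g s n p y = 0 := by
  simp [symDefect, binomialDefect_eq_zero hg hs hy,
    binomialDefect_eq_zero hg hs ((abs_neg y).symm ▸ hy)]

theorem norm_symDefect_le {n : ℕ} {p M : ℝ} (h : ∀ y, ‖binomialDefect g s n p y‖ ≤ M) (y : ℝ) :
    ‖symDefect g s n p y‖ ≤ M := by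
  rw [symDefect, norm_div]
  have := norm_add_le (binomialDefect g s n p y) (binomialDefect g s n p (-y))
  simp only [RCLike.norm_ofNat]
  linarith [h y, h (-y)]

theorem symDefect_absQuantile_eq_zero (hg : IsTestFunction g δ) (hs : ∀ k, |s k| = 1)
    (hC' : ∀ x > 0, absTail ν x ≤ C' * x ^ (-α)) {c : ℝ} (hc : 0 < c) {v : ℝ}
    (hv : v ∉ Set.Ioc 0 (C' * (δ / 2) ^ (-α))) (n : ℕ) (p : ℝ) :
    symDefect g s n p (absQuantile ν (v / c ^ α) / c) = 0 := by
  refine symDefect_eq_zero hg hs ?_ n p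
  rw [abs_of_nonneg (div_nonneg (absQuantile_nonneg _) hc.le)]
  rcases le_or_gt v 0 with h | h
  · have : v / c ^ α ∉ Set.Ioo (0 : ℝ) 1 := fun h' =>
      (div_nonpos_of_nonpos_of_nonneg h (Real.rpow_nonneg hc.le α)).not_gt h'.1
    rw [absQuantile, if_neg this]
    simpa using hg.pos
  · refine absQuantile_div_lt hC' hc hg.pos ?_
    by_contra! h'
    exact hv ⟨h, h'⟩

/-- The quantile representation is followed by the substitution `w = v / c ^ α`. The factor `c ^
(-α)` is the order of the probability that `|X|` reaches the scale `c`. -/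
theorem integral_binomialDefect_eq (hν : ν.map (fun x => -x) = ν) (hg : IsTestFunction g δ)
    (hs : ∀ k, |s k| = 1) {n : ℕ} {p : ℝ} (hp : p ∈ Set.Icc (0 : ℝ) 1) {c : ℝ} (hc : 0 < c) :
    ∫ x, binomialDefect g s n p (x / c) ∂ν = (((c ^ α)⁻¹ : ℝ) : ℂ) * tailDefect ν α g s n p c := by
  have hcα : 0 < c ^ α := Real.rpow_pos_of_pos hc α
  have hm : Measurable fun x => binomialDefect g s n p (x / c) :=
    measurable_binomialDefect hg.measurable n measurable_const (by fun_prop)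
  rw [integral_eq_integral_absQuantile hν hm fun x => norm_binomialDefect_le_two hp n _]
  have h1 : ∫ w in Set.Ioo (0 : ℝ) 1, (binomialDefect g s n p (absQuantile ν w / c) +
      binomialDefect g s n p (-absQuantile ν w / c)) / 2 =
      ∫ w, symDefect g s n p (absQuantile ν w / c) := by
    rw [← integral_indicator measurableSet_Ioo]
    refine integral_congr_ae (ae_of_all _ fun w => ?_)
    by_cases hw : w ∈ Set.Ioo (0 : ℝ) 1
    · simp [Set.indicator_of_mem hw, symDefect, neg_div]
    -- The default value 0 outside the unit interval lies in the gap of the test function, so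
    -- integrating over the whole line changes nothing.
    · have h0 : absQuantile ν w = 0 := if_neg hw
      simp only [Set.indicator_of_notMem hw, h0]
      exact (symDefect_eq_zero hg hs (by simpa using hg.pos) n p).symm
  have h2 : tailDefect ν α g s n p c = |c ^ α| • _ :=
    Measure.integral_comp_div (fun w => symDefect g s n p (absQuantile ν w / c)) (c ^ α)
  rw [h1, h2, abs_of_pos hcα, Complex.real_smul, ← mul_assoc, ← Complex.ofReal_mul,
    inv_mul_cancel₀ hcα.ne', Complex.ofReal_one, one_mul]

theorem norm_tailDefect_le (hg : IsTestFunction g δ) (hs : ∀ k, |s k| = 1)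
    (hC'0 : 0 < C') (hC' : ∀ x > 0, absTail ν x ≤ C' * x ^ (-α)) {c : ℝ} (hc : 0 < c)
    {n : ℕ} {p M : ℝ} (h : ∀ y, ‖binomialDefect g s n p y‖ ≤ M) :
    ‖tailDefect ν α g s n p c‖ ≤ M * (C' * (δ / 2) ^ (-α)) := by
  have hT : 0 ≤ C' * (δ / 2) ^ (-α) :=
    mul_nonneg hC'0.le (Real.rpow_nonneg (half_pos hg.pos).le _)
  have h1 : tailDefect ν α g s n p c = ∫ v in Set.Ioc 0 (C' * (δ / 2) ^ (-α)),
      symDefect g s n p (absQuantile ν (v / c ^ α) / c) :=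
    (setIntegral_eq_integral_of_forall_compl_eq_zero fun v hv =>
      symDefect_absQuantile_eq_zero hg hs hC' hc hv n p).symm
  rw [h1]
  refine (norm_setIntegral_le_of_norm_le_const (by simp) fun v _ => norm_symDefect_le h _).trans ?_
  simp [hT]

/-- The mark and the pattern converge together: the rescaled quantile tends to a nonzero power, the
binomial cluster to the Poisson one. The integrand is bounded by 2 and vanishes off `(0, T]`. -/
theorem tailDefect_tendsto (hα : 0 < α) (hC : 0 < C)
    (hν : Asymptotics.IsEquivalent atTop (absTail ν) (fun x : ℝ => C * x ^ (-α)))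
    (hg : IsTestFunction g δ) (hs : ∀ k, |s k| = 1) {c : ℕ → ℝ} (hc : Tendsto c atTop atTop)
    {u : ℝ} (hu : 0 < u) :
    Tendsto (fun n : ℕ => tailDefect ν α g s n (u / n) (c n)) atTop
      (𝓝 (∫ v in Set.Ioi 0, symPoissonDefect g s u ((v / C) ^ (-(1 / α))))) := by
  obtain ⟨C', hC'0, hC'⟩ := exists_absTail_le hα hC hν
  set T := C' * (δ / 2) ^ (-α)
  have hlim : Tendsto (fun n : ℕ => ∫ v in Set.Ioi 0,
      symDefect g s n (u / n) (absQuantile ν (v / c n ^ α) / c n)) atTop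
      (𝓝 (∫ v in Set.Ioi 0, symPoissonDefect g s u ((v / C) ^ (-(1 / α))))) := by
    refine tendsto_integral_filter_of_dominated_convergence
      ((Set.Ioc 0 T).indicator fun _ => (2 : ℝ)) (Eventually.of_forall fun n => ?_) ?_ ?_ ?_
    · refine (measurable_symDefect hg.measurable n measurable_const ?_).aestronglyMeasurable
      exact (measurable_absQuantile.comp (by fun_prop)).div_const _
    · filter_upwards [hc.eventually_gt_atTop 0, eventually_gt_atTop 0,
        tendsto_natCast_atTop_atTop.eventually_ge_atTop u] with n hcn hn hun
      have hn' : (0 : ℝ) < n := by exact_mod_cast hn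
      refine ae_of_all _ fun v => ?_
      by_cases hv : v ∈ Set.Ioc 0 T
      · rw [Set.indicator_of_mem hv]
        exact norm_symDefect_le (norm_binomialDefect_le_two
          ⟨by positivity, (div_le_one hn').2 hun⟩ n) _
      · rw [Set.indicator_of_notMem hv, symDefect_absQuantile_eq_zero hg hs hC' hcn hv, norm_zero]
    · exact (IntegrableOn.integrable_indicator (integrableOn_const (by simp))
        measurableSet_Ioc).integrableOn
    · filter_upwards [ae_restrict_mem measurableSet_Ioi] with v hv
      have hv' : 0 < v := hv
      have hq := absQuantile_div_tendsto hα hC hν hc hv'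
      have hne : (v / C) ^ (-(1 / α)) ≠ 0 := (Real.rpow_pos_of_pos (div_pos hv' hC) _).ne'
      exact ((binomialDefect_tendsto hg hs hq hne hu).add
        (binomialDefect_tendsto hg hs hq.neg (neg_ne_zero.2 hne) hu)).div_const 2
  refine hlim.congr' ?_
  filter_upwards [hc.eventually_gt_atTop 0] with n hcn
  refine setIntegral_eq_integral_of_forall_compl_eq_zero fun v hv => ?_
  exact symDefect_absQuantile_eq_zero hg hs hC' hcn (fun h => hv h.1) n _

end TailDefects

/-! ### Algebra of the normalizing sequence -/

section Scaling

variable {α α' β ρ C : ℝ} {L : ℝ → ℝ} {m : ℕ → ℕ}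

theorem scaling_pos (hC : 0 < C) (hβ_pos : 0 < β) (hβ_lt : β < 1) {n : ℕ} (hn : 0 < n)
    (hm : 0 < m n) (hL : 0 < L n) : 0 < scaling α β C L m n := by
  have h1 := Real.Gamma_pos_of_pos (sub_pos.2 hβ_lt)
  have h2 : (0 : ℝ) < n := by exact_mod_cast hn
  have h3 : (0 : ℝ) < m n := by exact_mod_cast hm
  exact Real.rpow_pos_of_pos (by positivity) _

theorem scaling_rpow (hα : 0 < α) (hC : 0 < C) (hβ_pos : 0 < β) (hβ_lt : β < 1) {n : ℕ}
    (hL : 0 < L n) : scaling α β C L m n ^ α =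
      C * (Real.Gamma (1 - β) / β) * (n : ℝ) ^ β * (m n : ℝ) * L n := by
  have h1 := Real.Gamma_pos_of_pos (sub_pos.2 hβ_lt)
  rw [scaling, ← Real.rpow_mul (by positivity), one_div_mul_cancel hα.ne', Real.rpow_one]

/-- The exponents of `n` combine through `β - α / α' = ρ - 1`. Thus divergence of `m n * L n / n ^
(1 - ρ)` is what sends the scale of `X` to infinity when `q` is of order `1 / n`. -/
theorem scaling_mul_rpow (hα : 0 < α) (hC : 0 < C) (hβ : β = α / α' - 1 + ρ)
    (hβ_pos : 0 < β) (hβ_lt : β < 1) {n : ℕ} (hn : 0 < n) (hm : 0 < m n) (hL : 0 < L n) {u : ℝ}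
    (hu : 0 < u) : (scaling α β C L m n * (u / n) ^ (1 / α')) ^ α =
      C * (Real.Gamma (1 - β) / β) * u ^ (α / α') * ((m n : ℝ) * L n / (n : ℝ) ^ (1 - ρ)) := by
  have hn' : (0 : ℝ) < n := by exact_mod_cast hn
  rw [Real.mul_rpow (scaling_pos hC hβ_pos hβ_lt hn hm hL).le (by positivity),
    scaling_rpow hα hC hβ_pos hβ_lt hL, ← Real.rpow_mul (by positivity),
    show 1 / α' * α = α / α' by ring, Real.div_rpow hu.le hn'.le,
    show (n : ℝ) ^ β = (n : ℝ) ^ (α / α') / (n : ℝ) ^ (1 - ρ) by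
      rw [← Real.rpow_sub hn', hβ]; ring_nf]
  have := (Real.rpow_pos_of_pos hn' (α / α')).ne'
  field_simp

theorem scaling_mul_rpow_tendsto (hα : 0 < α) (hC : 0 < C) (hβ : β = α / α' - 1 + ρ)
    (hβ_pos : 0 < β) (hβ_lt : β < 1) (hL : IsSlowlyVarying L) (hm_pos : ∀ n, 1 ≤ n → 0 < m n)
    (hm : Tendsto (fun n : ℕ => (m n : ℝ) * L n / (n : ℝ) ^ (1 - ρ)) atTop atTop)
    {u : ℝ} (hu : 0 < u) :
    Tendsto (fun n : ℕ => scaling α β C L m n * (u / n) ^ (1 / α')) atTop atTop := by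
  have h1 := Real.Gamma_pos_of_pos (sub_pos.2 hβ_lt)
  have h2 := (tendsto_rpow_atTop (one_div_pos.2 hα)).comp
    (hm.const_mul_atTop (show 0 < C * (Real.Gamma (1 - β) / β) * u ^ (α / α') by positivity))
  refine h2.congr' ?_
  filter_upwards [eventually_gt_atTop 0,
    tendsto_natCast_atTop_atTop.eventually hL.2.1] with n hn hLn
  have := scaling_pos (α := α) hC hβ_pos hβ_lt hn (hm_pos n hn) hLn
  simp only [Function.comp_apply]
  rw [← scaling_mul_rpow hα hC hβ hβ_pos hβ_lt hn (hm_pos n hn) hLn hu,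
    ← Real.rpow_mul (by positivity), mul_one_div_cancel hα.ne', Real.rpow_one]

/-- This identity dictates the choice of `a_n`: in the product of `m n`, the density of `n q` at `u`
and the tail scale of `X`, all of `n` cancels except a ratio of values of `L` that tends to 1. -/
theorem scaling_density_eq (hα : 0 < α) (hC : 0 < C) (hβ : β = α / α' - 1 + ρ)
    (hβ_pos : 0 < β) (hβ_lt : β < 1) {n : ℕ} (hn : 0 < n) (hm : 0 < m n) (hL : 0 < L n) {u : ℝ}
    (hu : 0 < u) : (m n : ℝ) / n * ((u / n) ^ (-ρ) * L (1 / (u / n)) *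
      ((scaling α β C L m n * (u / n) ^ (1 / α')) ^ α)⁻¹) =
      β / (C * Real.Gamma (1 - β)) * u ^ (-1 - β) * (L (n / u) / L n) := by
  have hn' : (0 : ℝ) < n := by exact_mod_cast hn
  have hm' : (0 : ℝ) < m n := by exact_mod_cast hm
  have h1 := Real.Gamma_pos_of_pos (sub_pos.2 hβ_lt)
  rw [scaling_mul_rpow hα hC hβ hβ_pos hβ_lt hn hm hL hu, one_div_div,
    Real.div_rpow hu.le hn'.le, show u ^ (-1 - β) = u ^ (-ρ) / u ^ (α / α') by
      rw [← Real.rpow_sub hu, hβ]; ring_nf,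
    show (n : ℝ) ^ (1 - ρ) = n * (n : ℝ) ^ (-ρ) by
      rw [sub_eq_add_neg, Real.rpow_add hn', Real.rpow_one]]
  have h2 := (Real.rpow_pos_of_pos hn' (-ρ)).ne'
  have h3 := (Real.rpow_pos_of_pos hu (α / α')).ne'
  field_simp

end Scaling

/-! ### Limit of the rescaled mean defect of one row -/

section DefectLimit

/-- This is the dominating function. Near 0 the factor `u` raises the exponents to `-β ± ε > -1`; at
infinity they are `-1 - β ± ε < -1`. -/
theorem integrableOn_rpow_mul_min {β ε : ℝ} (hε : 0 < ε) (h0 : ε < β) (h1 : β + ε < 1) :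
    IntegrableOn (fun u : ℝ => u ^ (-1 - β) * (u ^ ε + u ^ (-ε)) * min 1 u) (Set.Ioi 0) := by
  rw [← Set.Ioc_union_Ioi_eq_Ioi zero_le_one]
  refine IntegrableOn.union ?_ ?_
  · have h : ∀ r : ℝ, -1 < r → IntegrableOn (fun u : ℝ => u ^ r) (Set.Ioc 0 1) := fun r hr =>
      (intervalIntegrable_iff_integrableOn_Ioc_of_le zero_le_one).1
        (intervalIntegral.intervalIntegrable_rpow' hr)
    refine ((h (-β + ε) (by linarith)).add (h (-β - ε) (by linarith))).congr_fun ?_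
      measurableSet_Ioc
    intro u hu
    simp only [Pi.add_apply]
    rw [min_eq_right hu.2, mul_add, add_mul, ← Real.rpow_add hu.1, ← Real.rpow_add hu.1]
    nth_rw 4 [← Real.rpow_one u]
    nth_rw 6 [← Real.rpow_one u]
    rw [← Real.rpow_add hu.1, ← Real.rpow_add hu.1]
    ring_nf
  · have h : ∀ r : ℝ, r < -1 → IntegrableOn (fun u : ℝ => u ^ r) (Set.Ioi 1) := fun r hr =>
      integrableOn_Ioi_rpow_of_lt hr one_pos
    refine ((h (-1 - β + ε) (by linarith)).add (h (-1 - β - ε) (by linarith))).congr_fun ?_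
      measurableSet_Ioi
    intro u hu
    have hu1 : (1 : ℝ) < u := hu
    have hu0 : 0 < u := by linarith
    simp only [Pi.add_apply]
    rw [min_eq_left hu1.le, mul_one, mul_add, ← Real.rpow_add hu0, ← Real.rpow_add hu0]
    ring_nf

variable {α α' β ρ C : ℝ} {L : ℝ → ℝ} {ν : Measure ℝ} [IsProbabilityMeasure ν] {m : ℕ → ℕ}
  {g : ℝ → ℝ → ℝ} {s : ℕ → ℝ} {δ : ℝ}

theorem parameterLaw_ae_mem : ∀ᵐ p ∂(parameterLaw ρ L), p ∈ Set.Ioo (0 : ℝ) 1 :=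
  (withDensity_absolutelyContinuous _ _).ae_le (ae_restrict_mem measurableSet_Ioo)

theorem setIntegral_parameterLaw (hL : Measurable L) (hL_nonneg : ∀ x, 1 < x → 0 ≤ L x) {b : ℝ}
    (hb : b < 1) (G : ℝ → ℂ) :
    ∫ p in Set.Iic b, G p ∂(parameterLaw ρ L) =
      ∫ p in Set.Ioc 0 b, ((p ^ (-ρ) * L (1 / p) : ℝ) : ℂ) * G p := by
  have hd : Measurable fun x : ℝ => ENNReal.ofReal (x ^ (-ρ) * L (1 / x)) := by fun_prop
  rw [parameterLaw, restrict_withDensity measurableSet_Iic,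
    Measure.restrict_restrict measurableSet_Iic,
    integral_withDensity_eq_integral_toReal_smul hd (ae_of_all _ fun _ => ENNReal.ofReal_lt_top)]
  have : Set.Iic b ∩ Set.Ioo 0 1 = Set.Ioc 0 b := by
    ext x
    simp only [Set.mem_inter_iff, Set.mem_Iic, Set.mem_Ioo, Set.mem_Ioc]
    exact ⟨fun h => ⟨h.2.1, h.1⟩, fun h => ⟨h.2, h.1, h.2.trans_lt hb⟩⟩
  rw [this]
  refine setIntegral_congr_fun measurableSet_Ioc fun p hp => ?_
  have h1 : 0 ≤ L (1 / p) := hL_nonneg _ ((one_lt_div hp.1).2 (hp.2.trans_lt hb))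
  have h2 : 0 ≤ p ^ (-ρ) * L (1 / p) := mul_nonneg (Real.rpow_nonneg hp.1.le _) h1
  simp only [ENNReal.toReal_ofReal h2, Complex.real_smul]

theorem measurable_integral_binomialDefect (hg : Measurable (Function.uncurry g)) (n : ℕ)
    {c : ℝ → ℝ} (hc : Measurable c) :
    Measurable fun p => ∫ x, binomialDefect g s n p (x / c p) ∂ν := by
  have h : Measurable fun q : ℝ × ℝ => binomialDefect g s n q.1 (q.2 / c q.1) :=
    measurable_binomialDefect hg n measurable_fst
      (measurable_snd.div (hc.comp measurable_fst))
  exact h.stronglyMeasurable.integral_prod_right.measurable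

/-- The contribution of parameters of order `1 / n` to the expected defect. -/
theorem tendsto_setIntegral_binomialDefect [IsProbabilityMeasure (parameterLaw ρ L)]
    (hα : 0 < α) (hC : 0 < C) (hL : IsSlowlyVarying L) (hL_nonneg : ∀ x, 1 < x → 0 ≤ L x)
    (hν_symm : ν.map (fun x => -x) = ν)
    (hν_tail : Asymptotics.IsEquivalent atTop (absTail ν) (fun x : ℝ => C * x ^ (-α)))
    (hβ : β = α / α' - 1 + ρ) (hβ_pos : 0 < β) (hβ_lt : β < 1)
    (hm_pos : ∀ n, 1 ≤ n → 0 < m n)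
    (hm : Tendsto (fun n : ℕ => (m n : ℝ) * L n / (n : ℝ) ^ (1 - ρ)) atTop atTop)
    (hg : IsTestFunction g δ) (hs : ∀ k, |s k| = 1) {ε x₁ : ℝ} (hε : 0 < ε) (hεβ : ε < β)
    (hεβ1 : β + ε < 1) (hx₁ : 1 < x₁)
    (hpot : ∀ x ≥ x₁, 0 < L x ∧ ∀ u > 0, x₁ ≤ x / u →
      L (x / u) / L x ≤ Real.exp ε * (u ^ ε + u ^ (-ε))) :
    Tendsto (fun n : ℕ => (m n : ℂ) * ∫ p in Set.Iic (1 / x₁), (∫ x, binomialDefect g s n p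
      (x / (scaling α β C L m n * p ^ (1 / α'))) ∂ν) ∂(parameterLaw ρ L)) atTop
      (𝓝 (∫ u in Set.Ioi 0, ((β / (C * Real.Gamma (1 - β)) * u ^ (-1 - β) : ℝ) : ℂ) *
        ∫ v in Set.Ioi 0, symPoissonDefect g s u ((v / C) ^ (-(1 / α))))) := by
  obtain ⟨C', hC'0, hC'⟩ := exists_absTail_le hα hC hν_tail
  set T := C' * (δ / 2) ^ (-α)
  have hT : 0 ≤ T := mul_nonneg hC'0.le (Real.rpow_nonneg (half_pos hg.pos).le _)
  have hΓ := Real.Gamma_pos_of_pos (sub_pos.2 hβ_lt)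
  have hx₁0 : 0 < x₁ := by linarith
  let a := scaling α β C L m
  let G : ℕ → ℝ → ℂ := fun n p => ∫ x, binomialDefect g s n p (x / (a n * p ^ (1 / α'))) ∂ν
  have hGm : ∀ n, Measurable (G n) := fun n =>
    measurable_integral_binomialDefect hg.measurable n (by fun_prop)
  -- The density of `q` times the conditional defect, cut off at `1 / x₁`; the substitution `p = u /
  -- n` turns it into `Θ`. The condition `u / n ≤ 1 / x₁` is `x₁ ≤ n / u`, the range of Potter's
  -- bound.
  let ψ : ℕ → ℝ → ℂ := fun n p =>
    (Set.Ioc 0 (1 / x₁)).indicator (fun p => ((p ^ (-ρ) * L (1 / p) : ℝ) : ℂ) * G n p) p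
  let Θ : ℕ → ℝ → ℂ := fun n u => (((m n : ℝ) / n : ℝ) : ℂ) * ψ n (u / n)
  have hLm : Measurable L := hL.1
  have hψm : ∀ n, Measurable (ψ n) := fun n => by
    have := hGm n
    exact Measurable.indicator (by fun_prop) measurableSet_Ioc
  have hΘeq : ∀ᶠ n : ℕ in atTop, ∀ u > 0, u / n ≤ 1 / x₁ →
      Θ n u = ((β / (C * Real.Gamma (1 - β)) * u ^ (-1 - β) * (L (n / u) / L n) : ℝ) : ℂ) *
        tailDefect ν α g s n (u / n) (a n * (u / n) ^ (1 / α')) := by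
    filter_upwards [eventually_gt_atTop 0,
      tendsto_natCast_atTop_atTop.eventually hL.2.1] with n hn hLn u hu hux
    have hn' : (0 : ℝ) < n := by exact_mod_cast hn
    have hmem : u / n ∈ Set.Ioc 0 (1 / x₁) := ⟨by positivity, hux⟩
    have h1x : 1 / x₁ ≤ 1 := by rw [div_le_one hx₁0]; exact hx₁.le
    have hcpos : 0 < a n * (u / n) ^ (1 / α') :=
      mul_pos (scaling_pos hC hβ_pos hβ_lt hn (hm_pos n hn) hLn) (Real.rpow_pos_of_pos hmem.1 _)
    have hGn : G n (u / n) = _ :=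
      integral_binomialDefect_eq (α := α) hν_symm hg hs ⟨hmem.1.le, hux.trans h1x⟩ hcpos
    simp only [Θ, ψ]
    rw [Set.indicator_of_mem hmem, hGn,
      ← scaling_density_eq hα hC hβ hβ_pos hβ_lt hn (hm_pos n hn) hLn hu]
    push_cast
    ring
  have hint : ∀ᶠ n : ℕ in atTop, ∫ u in Set.Ioi 0, Θ n u =
      (m n : ℂ) * ∫ p in Set.Iic (1 / x₁), G n p ∂(parameterLaw ρ L) := by
    filter_upwards [eventually_gt_atTop 0] with n hn
    have hn' : (0 : ℝ) < n := by exact_mod_cast hn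
    have h1x : 1 / x₁ < 1 := (div_lt_one hx₁0).2 hx₁
    rw [setIntegral_parameterLaw hLm hL_nonneg h1x, ← integral_indicator measurableSet_Ioc]
    have h1 : ∫ u in Set.Ioi 0, Θ n u = ∫ u, Θ n u := by
      refine setIntegral_eq_integral_of_forall_compl_eq_zero fun u hu => ?_
      have : u / n ∉ Set.Ioc 0 (1 / x₁) := fun h =>
        hu ((div_pos_iff_of_pos_right hn').1 h.1)
      simp only [Θ, ψ, Set.indicator_of_notMem this, mul_zero]
    have h2 : ∫ u, ψ n (u / n) = |(n : ℝ)| • ∫ p, ψ n p := Measure.integral_comp_div (ψ n) n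
    rw [h1]
    simp only [Θ]
    rw [integral_const_mul, h2, abs_of_pos hn', Complex.real_smul, ← mul_assoc, ← Complex.ofReal_mul,
      div_mul_cancel₀ _ hn'.ne', Complex.ofReal_natCast]
  refine Tendsto.congr' hint ?_
  let D : ℝ := β / (C * Real.Gamma (1 - β)) * Real.exp ε * (2 * T)
  refine tendsto_integral_filter_of_dominated_convergence
    (fun u => D * (u ^ (-1 - β) * (u ^ ε + u ^ (-ε)) * min 1 u))
    (Eventually.of_forall fun n => ?_) ?_ ((integrableOn_rpow_mul_min hε hεβ hεβ1).const_mul D) ?_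
  · exact (((hψm n).comp (measurable_id.div_const _)).const_mul _).aestronglyMeasurable
  · filter_upwards [hΘeq, eventually_gt_atTop 0,
      tendsto_natCast_atTop_atTop.eventually_ge_atTop x₁] with n hn hn0 hnx
    have hn' : (0 : ℝ) < n := by exact_mod_cast hn0
    filter_upwards [ae_restrict_mem measurableSet_Ioi] with u hu
    have hu0 : 0 < u := hu
    have hmin : 0 ≤ min 1 u := le_min zero_le_one hu0.le
    have p1 := Real.rpow_pos_of_pos hu0 (-1 - β)
    have p2 := Real.rpow_pos_of_pos hu0 ε
    have p3 := Real.rpow_pos_of_pos hu0 (-ε)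
    by_cases hux : u / n ≤ 1 / x₁
    · have h1x : 1 / x₁ ≤ 1 := by rw [div_le_one hx₁0]; exact hx₁.le
      have hxu : x₁ ≤ n / u := by
        rw [div_le_div_iff₀ hn' hx₁0] at hux
        rw [le_div_iff₀ hu0]
        linarith
      have hLn := (hpot n hnx).1
      have hLu : 0 < L (n / u) := (hpot _ hxu).1
      have hcpos : 0 < a n * (u / n) ^ (1 / α') :=
        mul_pos (scaling_pos hC hβ_pos hβ_lt hn0 (hm_pos n hn0) hLn)
          (Real.rpow_pos_of_pos (by positivity) _)
      have hmem : u / n ∈ Set.Icc (0 : ℝ) 1 := ⟨by positivity, hux.trans h1x⟩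
      -- The bound by 1 serves large `u`. The bound by `u` compensates the singularity `u ^ (-1 -
      -- β)` at 0.
      have hb : ∀ y, ‖binomialDefect g s n (u / n) y‖ ≤ 2 * min 1 u := fun y => by
        rw [mul_min_of_nonneg _ _ zero_le_two, mul_one]
        refine le_min (norm_binomialDefect_le_two hmem n y) ?_
        have := norm_binomialDefect_le_mul (g := g) (s := s) hmem n y
        rwa [mul_div_cancel₀ _ hn'.ne'] at this
      have ht := norm_tailDefect_le hg hs hC'0 hC' hcpos hb
      rw [hn u hu0 hux, norm_mul, Complex.norm_real, Real.norm_of_nonneg (by positivity)]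
      calc _ ≤ β / (C * Real.Gamma (1 - β)) * u ^ (-1 - β) *
            (Real.exp ε * (u ^ ε + u ^ (-ε))) * (2 * min 1 u * T) := by
            refine mul_le_mul (mul_le_mul_of_nonneg_left ((hpot n hnx).2 u hu0 hxu)
              (by positivity)) ht (norm_nonneg _) (by positivity)
        _ = _ := by
            simp only [D]
            ring
    · have : u / n ∉ Set.Ioc 0 (1 / x₁) := fun h => hux h.2
      simp only [Θ, ψ, Set.indicator_of_notMem this, mul_zero, norm_zero]
      positivity
  · filter_upwards [ae_restrict_mem measurableSet_Ioi] with u hu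
    have hu0 : 0 < u := hu
    have hc := scaling_mul_rpow_tendsto hα hC hβ hβ_pos hβ_lt hL hm_pos hm hu0
    have h1 := tailDefect_tendsto hα hC hν_tail hg hs hc hu0
    have h2 : Tendsto (fun n : ℕ => L (n / u) / L n) atTop (𝓝 1) := by
      refine ((hL.2.2 u⁻¹ (inv_pos.2 hu0)).comp tendsto_natCast_atTop_atTop).congr fun n => ?_
      simp only [Function.comp_apply]
      rw [inv_mul_eq_div]
    have h3 := ((Complex.continuous_ofReal.tendsto _).comp
      (h2.const_mul (β / (C * Real.Gamma (1 - β)) * u ^ (-1 - β)))).mul h1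
    rw [mul_one] at h3
    refine h3.congr' ?_
    have h4 : Tendsto (fun n : ℕ => u / (n : ℝ)) atTop (𝓝 0) :=
      tendsto_const_div_atTop_nhds_zero_nat u
    filter_upwards [hΘeq, h4.eventually (ge_mem_nhds (one_div_pos.2 hx₁0))] with n hn hux
    exact (hn u hu0 hux).symm

theorem exists_potter (hL : IsSlowlyVarying L) {ε : ℝ} (hε : 0 < ε) :
    ∃ x₁ > 1, ∀ x ≥ x₁, 0 < L x ∧ ∀ u > 0, x₁ ≤ x / u →
      L (x / u) / L x ≤ Real.exp ε * (u ^ ε + u ^ (-ε)) := by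
  obtain ⟨x₀, hx₀, h⟩ := hL.exists_le_mul hε
  refine ⟨x₀ + 1, by linarith, fun x hx => ⟨(h x (by linarith)).1, fun u hu hxu => ?_⟩⟩
  exact (h x (by linarith)).2 u hu (by linarith)

/-- The limit of the rescaled expected defect. -/
theorem tendsto_integral_binomialDefect [IsProbabilityMeasure (parameterLaw ρ L)]
    (hα : 0 < α) (hα' : 0 < α') (hC : 0 < C) (hL : IsSlowlyVarying L)
    (hL_nonneg : ∀ x, 1 < x → 0 ≤ L x) (hν_symm : ν.map (fun x => -x) = ν)
    (hν_tail : Asymptotics.IsEquivalent atTop (absTail ν) (fun x : ℝ => C * x ^ (-α)))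
    (hβ : β = α / α' - 1 + ρ) (hβ_pos : 0 < β) (hβ_lt : β < 1)
    (hm_pos : ∀ n, 1 ≤ n → 0 < m n)
    (hm : Tendsto (fun n : ℕ => (m n : ℝ) * L n / (n : ℝ) ^ (1 - ρ)) atTop atTop)
    (hg : IsTestFunction g δ) (hs : ∀ k, |s k| = 1) :
    Tendsto (fun n : ℕ => (m n : ℂ) * ∫ p, (∫ x, binomialDefect g s n p
      (x / (scaling α β C L m n * p ^ (1 / α'))) ∂ν) ∂(parameterLaw ρ L)) atTop
      (𝓝 (∫ u in Set.Ioi 0, ((β / (C * Real.Gamma (1 - β)) * u ^ (-1 - β) : ℝ) : ℂ) *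
        ∫ v in Set.Ioi 0, symPoissonDefect g s u ((v / C) ^ (-(1 / α))))) := by
  -- This Potter exponent leaves room on both sides: `ε < β` and `β + ε < 1`.
  have hε : 0 < min β (1 - β) / 2 := half_pos (lt_min hβ_pos (sub_pos.2 hβ_lt))
  have hε1 : min β (1 - β) / 2 < β := by
    linarith [min_le_left β (1 - β)]
  have hε2 : β + min β (1 - β) / 2 < 1 := by
    linarith [min_le_right β (1 - β)]
  obtain ⟨x₁, hx₁, hpot⟩ := exists_potter hL hε
  have hx₁0 : 0 < x₁ := by linarith
  have hmain := tendsto_setIntegral_binomialDefect hα hC hL hL_nonneg hν_symm hν_tail hβ hβ_pos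
    hβ_lt hm_pos hm hg hs hε hε1 hε2 hx₁ hpot
  obtain ⟨C', hC'0, hC'⟩ := exists_absTail_le hα hC hν_tail
  set T := C' * (δ / 2) ^ (-α)
  have hT : 0 ≤ T := mul_nonneg hC'0.le (Real.rpow_nonneg (half_pos hg.pos).le _)
  have hΓ := Real.Gamma_pos_of_pos (sub_pos.2 hβ_lt)
  let a := scaling α β C L m
  let G : ℕ → ℝ → ℂ := fun n p => ∫ x, binomialDefect g s n p (x / (a n * p ^ (1 / α'))) ∂ν
  have hGm : ∀ n, Measurable (G n) := fun n =>
    measurable_integral_binomialDefect hg.measurable n (by fun_prop)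
  have hGi : ∀ n, Integrable (G n) (parameterLaw ρ L) := fun n => by
    refine Integrable.of_bound (hGm n).aestronglyMeasurable 2 ?_
    filter_upwards [parameterLaw_ae_mem] with p hp
    refine (norm_integral_le_of_norm_le_const (ae_of_all _ fun x =>
      norm_binomialDefect_le_two (Set.Ioo_subset_Icc_self hp) n _)).trans ?_
    simp
  -- Parameters above `1 / x₁` keep the scale at least `a n * x₁ ^ (-1 / α')`. They contribute at
  -- most a constant times `m n / a n ^ α`, that is, a constant over `n ^ β * L n`.
  have hrest : Tendsto (fun n : ℕ => (m n : ℂ) *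
      ∫ p in Set.Ioi (1 / x₁), G n p ∂(parameterLaw ρ L)) atTop (𝓝 0) := by
    have hz : Tendsto (fun n : ℕ => 2 * T * x₁ ^ (α / α') / (C * (Real.Gamma (1 - β) / β)) *
        ((n : ℝ) ^ β * L n)⁻¹) atTop (𝓝 0) := by
      rw [← mul_zero (2 * T * x₁ ^ (α / α') / (C * (Real.Gamma (1 - β) / β)))]
      exact (((hL.tendsto_rpow_mul hβ_pos).comp
        tendsto_natCast_atTop_atTop).inv_tendsto_atTop).const_mul _
    refine squeeze_zero_norm' ?_ hz
    filter_upwards [eventually_gt_atTop 0,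
      tendsto_natCast_atTop_atTop.eventually hL.2.1] with n hn hLn
    have hn' : (0 : ℝ) < n := by exact_mod_cast hn
    have hm' : (0 : ℝ) < m n := by exact_mod_cast hm_pos n hn
    have han : 0 < a n := scaling_pos hC hβ_pos hβ_lt hn (hm_pos n hn) hLn
    have hbound : ∀ᵐ p ∂(parameterLaw ρ L), p ∈ Set.Ioi (1 / x₁) →
        ‖G n p‖ ≤ (a n ^ α)⁻¹ * x₁ ^ (α / α') * (2 * T) := by
      filter_upwards [parameterLaw_ae_mem] with p hp hpx
      have hpx' : 1 / x₁ < p := hpx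
      have hcpos : 0 < a n * p ^ (1 / α') := mul_pos han (Real.rpow_pos_of_pos hp.1 _)
      have hp' := Set.Ioo_subset_Icc_self hp
      have hGn : G n p = _ := integral_binomialDefect_eq (α := α) hν_symm hg hs hp' hcpos
      rw [hGn, norm_mul, Complex.norm_real, Real.norm_of_nonneg (by positivity)]
      refine mul_le_mul ?_ (norm_tailDefect_le hg hs hC'0 hC' hcpos fun y =>
        norm_binomialDefect_le_two hp' n y) (norm_nonneg _) (by positivity)
      rw [Real.mul_rpow han.le (Real.rpow_nonneg hp.1.le _), mul_inv]
      refine mul_le_mul_of_nonneg_left ?_ (by positivity)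
      rw [← Real.rpow_mul hp.1.le, one_div_mul_eq_div, ← Real.inv_rpow hp.1.le]
      refine Real.rpow_le_rpow (inv_nonneg.2 hp.1.le) ?_ (by positivity)
      rw [inv_le_comm₀ hp.1 hx₁0, ← one_div]
      exact hpx'.le
    rw [norm_mul, Complex.norm_natCast]
    have h1 := norm_setIntegral_le_of_norm_le_const_ae' (measure_lt_top _ _) hbound
    calc _ ≤ (m n : ℝ) * ((a n ^ α)⁻¹ * x₁ ^ (α / α') * (2 * T)) := by
          refine mul_le_mul_of_nonneg_left (h1.trans ?_) hm'.le
          exact mul_le_of_le_one_right (by positivity) measureReal_le_one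
      _ = _ := by
          rw [show a n ^ α = _ from scaling_rpow hα hC hβ_pos hβ_lt hLn]
          have := (Real.rpow_pos_of_pos hn' β).ne'
          field_simp
  have hsum := hmain.add hrest
  rw [add_zero] at hsum
  refine hsum.congr fun n => ?_
  rw [← mul_add]
  congr 1
  have := integral_add_compl (measurableSet_Iic (a := 1 / x₁)) (hGi n)
  rwa [Set.compl_Iic] at this

end DefectLimit

/-! ### Sibuya weights as a mixture of Poisson weights -/

section SibuyaMixture

/-- The weights of the `β`-Sibuya distribution. -/
def sibuyaWeight (β : ℝ) (k : ℕ) : ℝ :=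
  if k = 0 then 0 else β / Real.Gamma (1 - β) * (Real.Gamma (k - β) / Real.Gamma (k + 1))

/-- The symmetrized expected defect over `k` points with uniform times. -/
def symMeanDefect (g : ℝ → ℝ → ℝ) (s : ℕ → ℝ) (k : ℕ) (y : ℝ) : ℂ :=
  (meanDefect g s k y + meanDefect g s k (-y)) / 2

/-- The intensity of defects at position `y` of the unit Poisson process. -/
def sibuyaDefect (α β : ℝ) (g : ℝ → ℝ → ℝ) (s : ℕ → ℝ) (y : ℝ) : ℂ :=
  ∑' k : ℕ, (sibuyaWeight β k : ℂ) * symMeanDefect g s k (y ^ (-(1 / α)))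

variable {α β C : ℝ} {g : ℝ → ℝ → ℝ} {s : ℕ → ℝ} {δ : ℝ}

theorem sibuyaWeight_nonneg (hβ_pos : 0 < β) (hβ_lt : β < 1) (k : ℕ) : 0 ≤ sibuyaWeight β k := by
  unfold sibuyaWeight
  split_ifs with hk
  · exact le_rfl
  · have h1 : (1 : ℝ) ≤ k := by exact_mod_cast Nat.one_le_iff_ne_zero.2 hk
    have h2 := Real.Gamma_pos_of_pos (sub_pos.2 hβ_lt)
    have h3 := Real.Gamma_pos_of_pos (show 0 < (k : ℝ) - β by linarith)
    have h4 := Real.Gamma_pos_of_pos (show 0 < (k : ℝ) + 1 by linarith)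
    positivity

theorem norm_symMeanDefect_le (k : ℕ) (y : ℝ) : ‖symMeanDefect g s k y‖ ≤ 2 := by
  rw [symMeanDefect, norm_div]
  have := norm_add_le (meanDefect g s k y) (meanDefect g s k (-y))
  simp only [RCLike.norm_ofNat]
  linarith [norm_meanDefect_le (g := g) (s := s) k y, norm_meanDefect_le (g := g) (s := s) k (-y)]

@[simp]
theorem symMeanDefect_zero (y : ℝ) : symMeanDefect g s 0 y = 0 := by
  simp [symMeanDefect]

theorem measurable_symMeanDefect (hg : Measurable (Function.uncurry g)) (k : ℕ) :
    Measurable (symMeanDefect g s k) :=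
  ((measurable_meanDefect hg k).add ((measurable_meanDefect hg k).comp measurable_neg)).div_const 2

theorem abs_rpow_neg_inv_lt (hα : 0 < α) {y : ℝ} (hδ : 0 < δ) (hy : δ ^ (-α) < y) :
    |y ^ (-(1 / α))| < δ := by
  have hδα := Real.rpow_pos_of_pos hδ (-α)
  have hy0 := hδα.trans hy
  rw [abs_of_pos (Real.rpow_pos_of_pos hy0 _)]
  have h1 := Real.rpow_lt_rpow_of_neg hδα hy (neg_neg_of_pos (one_div_pos.2 hα))
  rwa [← Real.rpow_mul hδ.le, show -α * -(1 / α) = 1 by field_simp, Real.rpow_one] at h1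

theorem symMeanDefect_rpow_eq_zero (hα : 0 < α) (hg : IsTestFunction g δ) (hs : ∀ k, |s k| = 1)
    (k : ℕ) {y : ℝ} (hy : δ ^ (-α) < y) : symMeanDefect g s k (y ^ (-(1 / α))) = 0 := by
  have h := abs_rpow_neg_inv_lt hα hg.pos hy
  have h' : |-y ^ (-(1 / α))| < δ := by rwa [abs_neg]
  rw [symMeanDefect, meanDefect_eq_zero hg hs h, meanDefect_eq_zero hg hs h']
  simp

theorem norm_symMeanDefect_rpow_le (hα : 0 < α) (hg : IsTestFunction g δ) (hs : ∀ k, |s k| = 1)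
    (k : ℕ) {y : ℝ} (hy : 0 < y) : ‖symMeanDefect g s k (y ^ (-(1 / α)))‖ ≤
      (Set.Ioc 0 (δ ^ (-α))).indicator (fun _ => 2) y := by
  by_cases h : y ≤ δ ^ (-α)
  · rw [Set.indicator_of_mem (show y ∈ Set.Ioc 0 (δ ^ (-α)) from ⟨hy, h⟩)]
    exact norm_symMeanDefect_le k _
  · rw [symMeanDefect_rpow_eq_zero hα hg hs k (not_le.1 h), norm_zero]
    exact Set.indicator_nonneg (fun _ _ => zero_le_two) _

theorem integrableOn_symMeanDefect_rpow (hα : 0 < α) (hg : IsTestFunction g δ)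
    (hs : ∀ k, |s k| = 1) (k : ℕ) :
    IntegrableOn (fun y : ℝ => symMeanDefect g s k (y ^ (-(1 / α)))) (Set.Ioi 0) := by
  have hi : IntegrableOn ((Set.Ioc 0 (δ ^ (-α))).indicator fun _ => (2 : ℝ)) (Set.Ioi 0) :=
    (IntegrableOn.integrable_indicator (integrableOn_const (by simp)) measurableSet_Ioc).integrableOn
  refine Integrable.mono' hi
    ((measurable_symMeanDefect hg.measurable k).comp (by fun_prop)).aestronglyMeasurable ?_
  filter_upwards [ae_restrict_mem measurableSet_Ioi] with y hy
  exact norm_symMeanDefect_rpow_le hα hg hs k hy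

theorem integral_norm_symMeanDefect_rpow_le (hα : 0 < α) (hg : IsTestFunction g δ)
    (hs : ∀ k, |s k| = 1) (k : ℕ) :
    ∫ y in Set.Ioi 0, ‖symMeanDefect g s k (y ^ (-(1 / α)))‖ ≤ 2 * δ ^ (-α) := by
  have hδα := Real.rpow_pos_of_pos hg.pos (-α)
  have hi : IntegrableOn ((Set.Ioc 0 (δ ^ (-α))).indicator fun _ => (2 : ℝ)) (Set.Ioi 0) :=
    (IntegrableOn.integrable_indicator (integrableOn_const (by simp)) measurableSet_Ioc).integrableOn
  calc _ ≤ ∫ y in Set.Ioi 0, (Set.Ioc 0 (δ ^ (-α))).indicator (fun _ => (2 : ℝ)) y := by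
        refine integral_mono_ae (integrableOn_symMeanDefect_rpow hα hg hs k).norm hi ?_
        filter_upwards [ae_restrict_mem measurableSet_Ioi] with y hy
        exact norm_symMeanDefect_rpow_le hα hg hs k hy
    _ = 2 * δ ^ (-α) := by
        rw [setIntegral_indicator measurableSet_Ioc,
          Set.inter_eq_self_of_subset_right Set.Ioc_subset_Ioi_self, setIntegral_const]
        simp [hδα.le, mul_comm]

/-- The defect of `k` points with uniform times integrated over the unit Poisson process. -/
def defectMass (α : ℝ) (g : ℝ → ℝ → ℝ) (s : ℕ → ℝ) (k : ℕ) : ℂ :=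
  ∫ y in Set.Ioi 0, symMeanDefect g s k (y ^ (-(1 / α)))

theorem norm_defectMass_le (hα : 0 < α) (hg : IsTestFunction g δ) (hs : ∀ k, |s k| = 1) (k : ℕ) :
    ‖defectMass α g s k‖ ≤ 2 * δ ^ (-α) :=
  (norm_integral_le_integral_norm _).trans (integral_norm_symMeanDefect_rpow_le hα hg hs k)

@[simp]
theorem defectMass_zero : defectMass α g s 0 = 0 := by simp [defectMass]

/-- Sum and integral may be exchanged because each term has L¹ norm at most `2 * δ ^ (-α)`, whatever
`k`. The general weights `b` cover the Sibuya and the Poisson case. -/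
theorem integral_tsum_mul_symMeanDefect (hα : 0 < α) (hg : IsTestFunction g δ)
    (hs : ∀ k, |s k| = 1) {b : ℕ → ℝ} (hb : ∀ k, 0 ≤ b k) (hbs : Summable b) :
    ∫ y in Set.Ioi 0, ∑' k, (b k : ℂ) * symMeanDefect g s k (y ^ (-(1 / α))) =
      ∑' k, (b k : ℂ) * defectMass α g s k := by
  have h := hasSum_integral_of_summable_integral_norm (μ := volume.restrict (Set.Ioi (0 : ℝ)))
    (F := fun k y => (b k : ℂ) * symMeanDefect g s k (y ^ (-(1 / α))))
    (fun k => (integrableOn_symMeanDefect_rpow hα hg hs k).const_mul _) ?_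
  · rw [← h.tsum_eq]
    exact tsum_congr fun k => integral_const_mul _ _
  · refine Summable.of_nonneg_of_le (fun k => integral_nonneg fun y => norm_nonneg _) (fun k => ?_)
      (hbs.mul_right (2 * δ ^ (-α)))
    simp_rw [norm_mul, Complex.norm_real, Real.norm_of_nonneg (hb k)]
    rw [integral_const_mul]
    exact mul_le_mul_of_nonneg_left (integral_norm_symMeanDefect_rpow_le hα hg hs k) (hb k)

theorem integral_sibuyaDefect (hα : 0 < α) (hβ_pos : 0 < β) (hβ_lt : β < 1)
    (hg : IsTestFunction g δ) (hs : ∀ k, |s k| = 1) (hβs : Summable (sibuyaWeight β)) :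
    ∫ y in Set.Ioi 0, sibuyaDefect α β g s y = ∑' k, (sibuyaWeight β k : ℂ) * defectMass α g s k :=
  integral_tsum_mul_symMeanDefect hα hg hs (sibuyaWeight_nonneg hβ_pos hβ_lt) hβs

theorem summable_poissonDefect {u : ℝ} (hu : 0 ≤ u) (y : ℝ) : Summable fun k : ℕ =>
    ((u ^ k / k.factorial * Real.exp (-u) : ℝ) : ℂ) * meanDefect g s k y := by
  refine Summable.of_norm_bounded (g := fun k : ℕ => u ^ k / k.factorial * Real.exp (-u) * 2)
    (((Real.summable_pow_div_factorial u).mul_right _).mul_right _) fun k => ?_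
  rw [norm_mul, Complex.norm_real, Real.norm_of_nonneg (by positivity)]
  exact mul_le_mul_of_nonneg_left (norm_meanDefect_le k y) (by positivity)

theorem symPoissonDefect_eq {u : ℝ} (hu : 0 ≤ u) (y : ℝ) : symPoissonDefect g s u y =
    ∑' k : ℕ, ((u ^ k / k.factorial * Real.exp (-u) : ℝ) : ℂ) * symMeanDefect g s k y := by
  unfold symPoissonDefect poissonDefect symMeanDefect
  rw [← (summable_poissonDefect hu y).tsum_add (summable_poissonDefect hu (-y)), ← tsum_div_const]
  exact tsum_congr fun k => by ring

/-- The substitution `v = C y` produces the factor `C` that cancels the tail constant in the mixing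
density. -/
theorem integral_symPoissonDefect (hα : 0 < α) (hC : 0 < C) (hg : IsTestFunction g δ)
    (hs : ∀ k, |s k| = 1) {u : ℝ} (hu : 0 ≤ u) :
    ∫ v in Set.Ioi 0, symPoissonDefect g s u ((v / C) ^ (-(1 / α))) =
      C * ∑' k : ℕ, ((u ^ k / k.factorial * Real.exp (-u) : ℝ) : ℂ) * defectMass α g s k := by
  have h := integral_comp_mul_left_Ioi (fun v : ℝ => symPoissonDefect g s u (v ^ (-(1 / α)))) 0
    (inv_pos.2 hC)
  simp_rw [inv_mul_eq_div] at h
  rw [h, inv_inv, zero_div, Complex.real_smul]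
  congr 1
  simp_rw [symPoissonDefect_eq hu]
  exact integral_tsum_mul_symMeanDefect hα hg hs (fun k => by positivity)
    ((Real.summable_pow_div_factorial u).mul_right _)

/-- This is Euler's integral for `Γ(k - β)`; `k ≥ 1` and `β < 1` make the argument positive. -/
theorem integral_rpow_mul_pow_mul_exp (hβ_lt : β < 1) {k : ℕ} (hk : k ≠ 0) :
    IntegrableOn (fun u : ℝ => β / Real.Gamma (1 - β) * u ^ (-1 - β) *
      (u ^ k / k.factorial * Real.exp (-u))) (Set.Ioi 0) ∧
    ∫ u in Set.Ioi (0 : ℝ), β / Real.Gamma (1 - β) * u ^ (-1 - β) *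
      (u ^ k / k.factorial * Real.exp (-u)) = sibuyaWeight β k := by
  have h1 : (1 : ℝ) ≤ k := by exact_mod_cast Nat.one_le_iff_ne_zero.2 hk
  have hkβ : 0 < (k : ℝ) - β := by linarith
  have heq : Set.EqOn (fun u : ℝ => β / Real.Gamma (1 - β) / k.factorial *
      (Real.exp (-u) * u ^ ((k : ℝ) - β - 1))) (fun u : ℝ => β / Real.Gamma (1 - β) *
      u ^ (-1 - β) * (u ^ k / k.factorial * Real.exp (-u))) (Set.Ioi 0) := fun u hu => by
    have hu0 : (0 : ℝ) < u := hu
    simp only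
    rw [show (k : ℝ) - β - 1 = (-1 - β) + k by ring, Real.rpow_add hu0, Real.rpow_natCast]
    ring
  have hi := (Real.GammaIntegral_convergent hkβ).const_mul (β / Real.Gamma (1 - β) / k.factorial)
  refine ⟨IntegrableOn.congr_fun hi heq measurableSet_Ioi, ?_⟩
  rw [← setIntegral_congr_fun measurableSet_Ioi heq, integral_const_mul,
    ← Real.Gamma_eq_integral hkβ, sibuyaWeight, if_neg hk, Real.Gamma_nat_eq_factorial]
  ring

/-- A `Gamma` mixture of Poisson distributions is a Sibuya distribution. -/
theorem integral_rpow_mul_symPoissonDefect (hα : 0 < α) (hC : 0 < C) (hβ_pos : 0 < β)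
    (hβ_lt : β < 1) (hg : IsTestFunction g δ) (hs : ∀ k, |s k| = 1)
    (hβs : Summable (sibuyaWeight β)) :
    ∫ u in Set.Ioi (0 : ℝ), ((β / (C * Real.Gamma (1 - β)) * u ^ (-1 - β) : ℝ) : ℂ) *
        ∫ v in Set.Ioi (0 : ℝ), symPoissonDefect g s u ((v / C) ^ (-(1 / α))) =
      ∫ y in Set.Ioi 0, sibuyaDefect α β g s y := by
  rw [integral_sibuyaDefect hα hβ_pos hβ_lt hg hs hβs]
  have hΓ := Real.Gamma_pos_of_pos (sub_pos.2 hβ_lt)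
  let F : ℕ → ℝ → ℂ := fun k u => ((β / Real.Gamma (1 - β) * u ^ (-1 - β) *
      (u ^ k / k.factorial * Real.exp (-u)) : ℝ) : ℂ) * defectMass α g s k
  have h1 : ∫ u in Set.Ioi (0 : ℝ), ((β / (C * Real.Gamma (1 - β)) * u ^ (-1 - β) : ℝ) : ℂ) *
      ∫ v in Set.Ioi (0 : ℝ), symPoissonDefect g s u ((v / C) ^ (-(1 / α))) =
      ∫ u in Set.Ioi (0 : ℝ), ∑' k, F k u := by
    refine setIntegral_congr_fun measurableSet_Ioi fun u hu => ?_
    have hu0 : (0 : ℝ) ≤ u := le_of_lt hu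
    have hC' : (C : ℂ) ≠ 0 := by exact_mod_cast hC.ne'
    have hΓ' : (Real.Gamma (1 - β) : ℂ) ≠ 0 := by exact_mod_cast hΓ.ne'
    rw [integral_symPoissonDefect hα hC hg hs hu0, ← mul_assoc, ← tsum_mul_left]
    refine tsum_congr fun k => ?_
    simp only [F]
    push_cast
    field_simp
  -- The mixing density is not integrable at 0 against the weight of `k = 0`, but `F 0` vanishes
  -- since `defectMass` is 0 there.
  have hFi : ∀ k, IntegrableOn (F k) (Set.Ioi 0) := fun k => by
    rcases eq_or_ne k 0 with rfl | hk
    · simp [F, IntegrableOn]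
    · exact ((integral_rpow_mul_pow_mul_exp hβ_lt hk).1.ofReal).mul_const _
  have hFn : ∀ k, ∫ u in Set.Ioi (0 : ℝ), ‖F k u‖ = sibuyaWeight β k * ‖defectMass α g s k‖ := by
    intro k
    rcases eq_or_ne k 0 with rfl | hk
    · simp [F]
    · rw [← (integral_rpow_mul_pow_mul_exp hβ_lt hk).2, ← integral_mul_const]
      refine setIntegral_congr_fun measurableSet_Ioi fun u hu => ?_
      have hu0 : (0 : ℝ) < u := hu
      simp only [F]
      rw [norm_mul, Complex.norm_real, Real.norm_of_nonneg (by positivity)]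
  have h2 := hasSum_integral_of_summable_integral_norm (μ := volume.restrict (Set.Ioi (0 : ℝ)))
    hFi (by
      simp_rw [hFn]
      refine Summable.of_nonneg_of_le (fun k => mul_nonneg (sibuyaWeight_nonneg hβ_pos hβ_lt k)
        (norm_nonneg _)) (fun k => ?_) (hβs.mul_right (2 * δ ^ (-α)))
      exact mul_le_mul_of_nonneg_left (norm_defectMass_le hα hg hs k)
        (sibuyaWeight_nonneg hβ_pos hβ_lt k))
  rw [h1, ← h2.tsum_eq]
  refine tsum_congr fun k => ?_
  rcases eq_or_ne k 0 with rfl | hk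
  · simp [F]
  · rw [← (integral_rpow_mul_pow_mul_exp hβ_lt hk).2, ← integral_complex_ofReal,
      ← integral_mul_const]

end SibuyaMixture

/-! ### Renewal equation of a marked Poisson process -/

section RenewalEquation

theorem integral_expMeasure_one (f : ℝ → ℂ) :
    ∫ x, f x ∂(expMeasure 1) = ∫ x in Set.Ioi (0 : ℝ), (Real.exp (-x) : ℂ) * f x := by
  have h : expMeasure 1 = volume.withDensity (exponentialPDF 1) := rfl
  have hm : Measurable (exponentialPDF 1) :=
    (measurable_exponentialPDFReal 1).ennreal_ofReal
  rw [h, integral_withDensity_eq_integral_toReal_smul hm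
    (ae_of_all _ fun _ => ENNReal.ofReal_lt_top)]
  rw [← integral_indicator measurableSet_Ioi]
  refine integral_congr_ae ?_
  filter_upwards [measure_eq_zero_iff_ae_notMem.1 (measure_singleton (μ := volume) (0 : ℝ))]
    with x hx
  have hx' : x ≠ 0 := hx
  rcases lt_or_gt_of_ne hx' with h | h
  · rw [exponentialPDF_of_neg h, Set.indicator_of_notMem (by simpa using h.le)]
    simp
  · rw [exponentialPDF_of_nonneg h.le, Set.indicator_of_mem (by simpa using h),
      ENNReal.toReal_ofReal (by positivity), Complex.real_smul]
    simp

variable {D : ℝ → ℂ} {B T : ℝ}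

/-- The characteristic functional of a marked unit Poisson process on `(x, ∞)`, where `D y` is the
mean defect of a mark at `y`. -/
def poissonFunctional (D : ℝ → ℂ) (x : ℝ) : ℂ :=
  Complex.exp ((∫ y in (0 : ℝ)..x, D y) - ∫ y in Set.Ioi 0, D y)

theorem intervalIntegrable_of_bound (hm : Measurable D) (hB : ∀ y, ‖D y‖ ≤ B) (a b : ℝ) :
    IntervalIntegrable D volume a b :=
  (intervalIntegrable_const (c := B)).mono_fun hm.aestronglyMeasurable
    (ae_of_all _ fun y => (hB y).trans (le_abs_self B))

theorem continuous_poissonFunctional (hm : Measurable D) (hB : ∀ y, ‖D y‖ ≤ B) :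
    Continuous (poissonFunctional D) := by
  have h := intervalIntegral.continuous_primitive (intervalIntegrable_of_bound hm hB) 0
  unfold poissonFunctional
  fun_prop

theorem poissonFunctional_zero : poissonFunctional D 0 = Complex.exp (-∫ y in Set.Ioi 0, D y) := by
  simp [poissonFunctional]

theorem poissonFunctional_eq_one (hT : ∀ y > T, D y = 0) {x : ℝ} (hx : T ≤ x) (hx0 : 0 ≤ x) :
    poissonFunctional D x = 1 := by
  have : ∫ y in Set.Ioi 0, D y = ∫ y in (0 : ℝ)..x, D y := by
    rw [intervalIntegral.integral_of_le hx0]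
    refine setIntegral_eq_of_subset_of_forall_sdiff_eq_zero measurableSet_Ioi
      Set.Ioc_subset_Ioi_self fun y hy => hT y ?_
    have h1 : (0 : ℝ) < y := hy.1
    by_contra! h2
    exact hy.2 ⟨h1, h2.trans hx⟩
  simp [poissonFunctional, this]

theorem exists_norm_poissonFunctional_le (hm : Measurable D) (hB : ∀ y, ‖D y‖ ≤ B)
    (hT : ∀ y > T, D y = 0) : ∃ M, ∀ x ≥ 0, ‖poissonFunctional D x‖ ≤ M := by
  obtain ⟨M, hM⟩ := (isCompact_Icc (a := (0 : ℝ)) (b := max T 0)).exists_bound_of_continuousOn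
    (continuous_poissonFunctional hm hB).continuousOn
  refine ⟨max M 1, fun x hx => ?_⟩
  rcases le_total x (max T 0) with h | h
  · exact (hM x ⟨hx, h⟩).trans (le_max_left _ _)
  · rw [poissonFunctional_eq_one hT ((le_max_left _ _).trans h) hx]
    simp

theorem poissonFunctional_hasDerivAt (hm : Measurable D) (hB : ∀ y, ‖D y‖ ≤ B) {x : ℝ}
    (hc : ContinuousAt D x) :
    HasDerivAt (poissonFunctional D) (poissonFunctional D x * D x) x := by
  have h := intervalIntegral.integral_hasDerivAt_right (intervalIntegrable_of_bound hm hB 0 x)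
    hm.stronglyMeasurable.stronglyMeasurableAtFilter hc
  exact (h.sub_const _).cexp

/-- The renewal equation for the characteristic functional of a marked Poisson process. -/
theorem integral_mul_poissonFunctional (hm : Measurable D) (hB : ∀ y, ‖D y‖ ≤ B)
    (hT : ∀ y > T, D y = 0) (hc : ∀ x > 0, ContinuousAt D x) {x : ℝ} (hx : 0 ≤ x) :
    ∫ w, (1 - D (x + w)) * poissonFunctional D (x + w) ∂(expMeasure 1) =
      poissonFunctional D x := by
  obtain ⟨M, hM⟩ := exists_norm_poissonFunctional_le hm hB hT
  have hH := continuous_poissonFunctional hm hB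
  rw [integral_expMeasure_one]
  have hexp : ∀ w : ℝ, HasDerivAt (fun w : ℝ => (Real.exp (-w) : ℂ)) (-(Real.exp (-w) : ℂ)) w :=
    fun w => by
      have := ((Real.hasDerivAt_exp (-w)).comp w (hasDerivAt_neg w)).ofReal_comp
      simpa using this
  -- Since `Φ' = Φ D`, the integrand is an exact derivative. Only `w > 0` is considered, because `D`
  -- need not be continuous at 0; continuity of `Φ` takes care of the endpoint.
  have hderiv : ∀ w ∈ Set.Ioi (0 : ℝ),
      HasDerivAt (fun w : ℝ => -((Real.exp (-w) : ℂ) * poissonFunctional D (x + w)))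
        ((Real.exp (-w) : ℂ) * ((1 - D (x + w)) * poissonFunctional D (x + w))) w := by
    intro w hw
    have hw0 : (0 : ℝ) < w := hw
    have h1 := (poissonFunctional_hasDerivAt hm hB (hc (x + w) (by linarith))).comp_const_add x w
    convert! ((hexp w).mul h1).neg using 1
    ring
  have hint : IntegrableOn (fun w : ℝ => (Real.exp (-w) : ℂ) *
      ((1 - D (x + w)) * poissonFunctional D (x + w))) (Set.Ioi 0) := by
    refine Integrable.mono' ((integrableOn_exp_neg_Ioi 0).mul_const ((1 + B) * M)) ?_ ?_
    · have := hH.measurable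
      exact Measurable.aestronglyMeasurable (by fun_prop)
    · filter_upwards [ae_restrict_mem measurableSet_Ioi] with w hw
      have hw0 : (0 : ℝ) < w := hw
      rw [norm_mul, Complex.norm_real, Real.norm_of_nonneg (Real.exp_pos _).le, norm_mul]
      refine mul_le_mul_of_nonneg_left (mul_le_mul ?_ (hM _ (by linarith)) (norm_nonneg _) ?_)
        (Real.exp_pos _).le
      · refine (norm_sub_le _ _).trans ?_
        simpa using hB _
      · linarith [(norm_nonneg _).trans (hB 0)]
  have hlim : Tendsto (fun w : ℝ => -((Real.exp (-w) : ℂ) * poissonFunctional D (x + w))) atTop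
      (𝓝 0) := by
    have h1 : Tendsto (fun w : ℝ => Real.exp (-w) * M) atTop (𝓝 0) := by
      simpa using (Real.tendsto_exp_neg_atTop_nhds_zero).mul_const M
    refine squeeze_zero_norm' ?_ h1
    filter_upwards [eventually_ge_atTop 0] with w hw
    rw [norm_neg, norm_mul, Complex.norm_real, Real.norm_of_nonneg (Real.exp_pos _).le]
    exact mul_le_mul_of_nonneg_left (hM _ (by linarith)) (Real.exp_pos _).le
  rw [integral_Ioi_of_hasDerivAt_of_tendsto (Continuous.continuousWithinAt (by fun_prop)) hderiv
    hint hlim]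
  simp

end RenewalEquation

/-! ### Regularity of the mean defect of a Sibuya cluster -/

section SibuyaDefect

variable {α β : ℝ} {g : ℝ → ℝ → ℝ} {s : ℕ → ℝ} {δ : ℝ}

/-- For almost all times, which are distinct, the cluster sum is continuous in the mark away from 0;
defects are bounded. -/
theorem continuousAt_meanDefect (hg : IsTestFunction g δ) (hs : ∀ k, |s k| = 1) (k : ℕ) {y : ℝ}
    (hy : y ≠ 0) : ContinuousAt (meanDefect g s k) y := by
  refine tendsto_integral_filter_of_dominated_convergence (fun _ => 2)
    (Eventually.of_forall fun z => ?_) (Eventually.of_forall fun z => ae_of_all _ fun t =>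
      norm_expDefect_le _) (integrable_const _) ?_
  · exact (measurable_expDefect.comp ((measurable_rankSum hg.measurable k).comp
      measurable_prodMk_left)).aestronglyMeasurable
  · filter_upwards [ae_uniformSeq_mem, ae_uniformSeq_injective] with t ht hinj
    have ht' := fun j => Set.Ioo_subset_Icc_self (ht j)
    exact (continuous_expDefect.tendsto _).comp (rankSum_tendsto hg hs tendsto_id hy
      (fun j => tendsto_const_nhds) (fun _ => ht') ht' hinj)

theorem norm_sibuyaDefect_term_le (hβ_pos : 0 < β) (hβ_lt : β < 1) (k : ℕ) (y : ℝ) :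
    ‖(sibuyaWeight β k : ℂ) * symMeanDefect g s k (y ^ (-(1 / α)))‖ ≤ sibuyaWeight β k * 2 := by
  rw [norm_mul, Complex.norm_real, Real.norm_of_nonneg (sibuyaWeight_nonneg hβ_pos hβ_lt k)]
  exact mul_le_mul_of_nonneg_left (norm_symMeanDefect_le k _) (sibuyaWeight_nonneg hβ_pos hβ_lt k)

theorem continuousAt_sibuyaDefect (hβ_pos : 0 < β) (hβ_lt : β < 1)
    (hβs : Summable (sibuyaWeight β)) (hg : IsTestFunction g δ) (hs : ∀ k, |s k| = 1) {y : ℝ}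
    (hy : 0 < y) : ContinuousAt (sibuyaDefect α β g s) y := by
  have h : ContinuousOn (sibuyaDefect α β g s) (Set.Ioi 0) := by
    refine continuousOn_tsum (fun k => ?_) (hβs.mul_right 2) fun k y _ =>
      norm_sibuyaDefect_term_le hβ_pos hβ_lt k y
    intro y hy
    have hy0 : (0 : ℝ) < y := hy
    have hr : ContinuousAt (fun y : ℝ => y ^ (-(1 / α))) y :=
      Real.continuousAt_rpow_const _ _ (Or.inl hy0.ne')
    have hne := (Real.rpow_pos_of_pos hy0 (-(1 / α))).ne'
    have h1 : ContinuousAt (fun y : ℝ => meanDefect g s k (y ^ (-(1 / α)))) y :=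
      ContinuousAt.comp (f := fun y : ℝ => y ^ (-(1 / α))) (g := meanDefect g s k)
        (continuousAt_meanDefect hg hs k hne) hr
    have h2 : ContinuousAt (fun y : ℝ => meanDefect g s k (-y ^ (-(1 / α)))) y :=
      ContinuousAt.comp (f := fun y : ℝ => -y ^ (-(1 / α))) (g := meanDefect g s k)
        (continuousAt_meanDefect hg hs k (neg_ne_zero.2 hne)) hr.neg
    exact (continuousAt_const.mul ((h1.add h2).div_const 2)).continuousWithinAt
  exact h.continuousAt (Ioi_mem_nhds hy)

theorem measurable_sibuyaDefect (hβ_pos : 0 < β) (hβ_lt : β < 1)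
    (hβs : Summable (sibuyaWeight β)) (hg : IsTestFunction g δ) :
    Measurable (sibuyaDefect α β g s) := by
  have h : ∀ y, HasSum (fun k => (sibuyaWeight β k : ℂ) *
      symMeanDefect g s k (y ^ (-(1 / α)))) (sibuyaDefect α β g s y) := fun y =>
    (Summable.of_norm_bounded (hβs.mul_right 2) fun k =>
      norm_sibuyaDefect_term_le hβ_pos hβ_lt k y).hasSum
  refine measurable_of_tendsto_metrizable (f := fun n y => ∑ k ∈ Finset.range n,
    (sibuyaWeight β k : ℂ) * symMeanDefect g s k (y ^ (-(1 / α)))) (fun n => ?_)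
    (tendsto_pi_nhds.2 fun y => (h y).tendsto_sum_nat)
  exact Finset.measurable_sum _ fun k _ =>
    ((measurable_symMeanDefect hg.measurable k).comp (by fun_prop)).const_mul _

theorem norm_sibuyaDefect_le (hβ_pos : 0 < β) (hβ_lt : β < 1) (hβs : Summable (sibuyaWeight β))
    (y : ℝ) : ‖sibuyaDefect α β g s y‖ ≤ ∑' k, sibuyaWeight β k * 2 :=
  tsum_of_norm_bounded (hβs.mul_right 2).hasSum fun k =>
    norm_sibuyaDefect_term_le hβ_pos hβ_lt k y

theorem sibuyaDefect_eq_zero (hα : 0 < α) (hg : IsTestFunction g δ) (hs : ∀ k, |s k| = 1) {y : ℝ}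
    (hy : y > δ ^ (-α)) : sibuyaDefect α β g s y = 0 := by
  simp [sibuyaDefect, -one_div, symMeanDefect_rpow_eq_zero hα hg hs _ hy]

end SibuyaDefect

/-! ### Independence of blocks of an independent family -/

section Independence

/-- Functions of disjoint parts of an independent family are independent. -/
theorem indepFun_of_measurable_iSup {ι Ω β γ : Type*} {mΩ : MeasurableSpace Ω} {P : Measure Ω}
    {mβ : MeasurableSpace β} {mγ : MeasurableSpace γ} {F : ι → Ω → ℝ} (hF : iIndepFun F P)
    (hFm : ∀ i, Measurable (F i)) {S T : Set ι} (hST : Disjoint S T) {X : Ω → β} {Y : Ω → γ}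
    (hX : Measurable[⨆ i ∈ S, MeasurableSpace.comap (F i) inferInstance] X)
    (hY : Measurable[⨆ i ∈ T, MeasurableSpace.comap (F i) inferInstance] Y) : IndepFun X Y P := by
  rw [IndepFun_iff_Indep]
  exact indep_of_indep_of_le (indep_iSup_of_disjoint (fun i => (hFm i).comap_le) hF.iIndep hST)
    hX.comap_le hY.comap_le

theorem measurable_of_mem_iSup_comap {ι Ω : Type*} {F : ι → Ω → ℝ} {S : Set ι} {i : ι}
    (hi : i ∈ S) : Measurable[⨆ i ∈ S, MeasurableSpace.comap (F i) inferInstance] (F i) :=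
  Measurable.of_comap_le (le_iSup₂_of_le i hi le_rfl)

theorem measurable_rankSum_count {g : ℝ → ℝ → ℝ} {s : ℕ → ℝ}
    (hg : Measurable (Function.uncurry g)) :
    Measurable fun p : ℕ × ℝ × (ℕ → ℝ) => rankSum g s p.1 p.2.1 p.2.2 :=
  measurable_from_prod_countable_right fun k => measurable_rankSum hg k

end Independence

/-! ### Joint law of arrival times and marks -/

section LimitFamily

/-- The mark attached to an arrival time. -/
def limitMark {Ω : Type*} (ε : ℕ → Ω → ℝ) (Q : ℕ → Ω → ℕ) (U : ℕ × ℕ → Ω → ℝ) (ℓ : ℕ) (ω : Ω) :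
    ℝ × ℕ × (ℕ → ℝ) := (ε ℓ ω, Q ℓ ω, fun j => U (ℓ, j) ω)

/-- The exponential of the sum of a test function over the points of a mark at position `y`. -/
def markFactor (α : ℝ) (g : ℝ → ℝ → ℝ) (s : ℕ → ℝ) (p : ℝ × ℕ × (ℕ → ℝ)) (y : ℝ) : ℂ :=
  Complex.exp (Complex.I * rankSum g s p.2.1 (p.1 * y ^ (-(1 / α))) p.2.2)

/-- The product of the factors of the first `n` arrivals. -/
def factorProduct {Ω : Type*} (α : ℝ) (g : ℝ → ℝ → ℝ) (s : ℕ → ℝ) (w ε : ℕ → Ω → ℝ)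
    (Q : ℕ → Ω → ℕ) (U : ℕ × ℕ → Ω → ℝ) (n : ℕ) (ω : Ω) : ℂ :=
  ∏ ℓ ∈ Finset.range n, markFactor α g s (limitMark ε Q U ℓ ω) (arrivalTime w ℓ ω)

variable {α β δ : ℝ} {g : ℝ → ℝ → ℝ} {s : ℕ → ℝ}

theorem norm_markFactor (p : ℝ × ℕ × (ℕ → ℝ)) (y : ℝ) : ‖markFactor α g s p y‖ = 1 := by
  rw [markFactor, mul_comm, Complex.norm_exp_ofReal_mul_I]

theorem measurable_markFactor {γ : Type*} {mγ : MeasurableSpace γ}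
    (hg : Measurable (Function.uncurry g)) {p : γ → ℝ × ℕ × (ℕ → ℝ)} (hp : Measurable p)
    {y : γ → ℝ} (hy : Measurable y) : Measurable fun b => markFactor α g s (p b) (y b) := by
  have h : Measurable fun b => rankSum g s (p b).2.1 ((p b).1 * y b ^ (-(1 / α))) (p b).2.2 :=
    (measurable_rankSum_count (s := s) hg).comp
      (f := fun b => ((p b).2.1, (p b).1 * y b ^ (-(1 / α)), (p b).2.2))
      (by fun_prop)
  unfold markFactor
  fun_prop

theorem norm_factorProduct {Ω : Type*} (w ε : ℕ → Ω → ℝ) (Q : ℕ → Ω → ℕ) (U : ℕ × ℕ → Ω → ℝ)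
    (n : ℕ) (ω : Ω) : ‖factorProduct α g s w ε Q U n ω‖ = 1 := by
  rw [factorProduct, norm_prod]
  exact Finset.prod_eq_one fun _ _ => norm_markFactor _ _

/-- The σ-algebra is a variable so that the lemma applies to those generated by blocks of the
family. There `Q` enters as a real variable and is recovered by the floor. -/
theorem measurable_limitMark {Ω : Type*} {mΩ : MeasurableSpace Ω} {ε : ℕ → Ω → ℝ} {Q : ℕ → Ω → ℕ}
    {U : ℕ × ℕ → Ω → ℝ} {ℓ : ℕ} (hε : Measurable (ε ℓ)) (hQ : Measurable fun ω => (Q ℓ ω : ℝ))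
    (hU : ∀ j, Measurable (U (ℓ, j))) : Measurable (limitMark ε Q U ℓ) := by
  have hQ' : Measurable (Q ℓ) := by
    have := Nat.measurable_floor.comp hQ
    simpa [Function.comp_def] using this
  exact hε.prodMk (hQ'.prodMk (measurable_pi_lambda _ hU))

theorem measurable_seq {Ω : Type*} {mΩ : MeasurableSpace Ω} {f : ℕ → Ω → ℝ}
    (hf : ∀ j, Measurable (f j)) : Measurable fun ω j => f j ω :=
  measurable_pi_lambda _ hf

theorem measurable_partialSum {Ω : Type*} {mΩ : MeasurableSpace Ω} {w : ℕ → Ω → ℝ} {n : ℕ}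
    (hw : ∀ ℓ < n, Measurable (w ℓ)) : Measurable fun ω => ∑ k ∈ Finset.range n, w k ω :=
  Finset.measurable_sum _ fun k hk => hw k (Finset.mem_range.1 hk)

theorem measurable_factorProduct {Ω : Type*} {mΩ : MeasurableSpace Ω} {w ε : ℕ → Ω → ℝ}
    {Q : ℕ → Ω → ℕ} {U : ℕ × ℕ → Ω → ℝ} {n : ℕ} (hg : Measurable (Function.uncurry g))
    (hw : ∀ ℓ < n, Measurable (w ℓ)) (hε : ∀ ℓ < n, Measurable (ε ℓ))
    (hQ : ∀ ℓ < n, Measurable fun ω => (Q ℓ ω : ℝ)) (hU : ∀ ℓ < n, ∀ j, Measurable (U (ℓ, j))) :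
    Measurable (factorProduct α g s w ε Q U n) := by
  refine Finset.measurable_prod _ fun ℓ hℓ => ?_
  have hℓ' := Finset.mem_range.1 hℓ
  refine measurable_markFactor hg (measurable_limitMark (hε ℓ hℓ') (hQ ℓ hℓ') (hU ℓ hℓ')) ?_
  exact measurable_partialSum fun k hk => hw k (lt_of_lt_of_le hk hℓ')

namespace IsLimitFamily

variable {Ω : Type*} [MeasurableSpace Ω] {P : Measure Ω}
  {w ε : ℕ → Ω → ℝ} {Q : ℕ → Ω → ℕ} {U : ℕ × ℕ → Ω → ℝ}

theorem measurable_elim (h : IsLimitFamily P β w ε Q U) (i : ℕ ⊕ ℕ ⊕ ℕ ⊕ (ℕ × ℕ)) :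
    Measurable ((Sum.elim w (Sum.elim ε (Sum.elim (fun ℓ ω => (Q ℓ ω : ℝ)) U)) :
      ℕ ⊕ ℕ ⊕ ℕ ⊕ (ℕ × ℕ) → Ω → ℝ) i) := by
  rcases i with i | i | i | i
  · exact h.measurable_w i
  · exact h.measurable_ε i
  · exact (measurable_of_countable (fun k : ℕ => (k : ℝ))).comp (h.measurable_Q i)
  · exact h.measurable_U i

theorem measurable_mark (h : IsLimitFamily P β w ε Q U) (ℓ : ℕ) :
    Measurable (limitMark ε Q U ℓ) :=
  measurable_limitMark (h.measurable_ε ℓ) ((measurable_of_countable (fun k : ℕ => (k : ℝ))).comp (h.measurable_Q ℓ))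
    fun j => h.measurable_U (ℓ, j)

theorem indepFun_w_mark (h : IsLimitFamily P β w ε Q U) (ℓ : ℕ) :
    IndepFun (w ℓ) (limitMark ε Q U ℓ) P := by
  refine indepFun_of_measurable_iSup h.indep h.measurable_elim
    (S := Set.range Sum.inl) (T := Set.range Sum.inr) ?_ ?_ ?_
  · rw [Set.disjoint_left]
    rintro _ ⟨i, rfl⟩ ⟨j, hj⟩
    exact Sum.inr_ne_inl hj
  · exact measurable_of_mem_iSup_comap (i := Sum.inl ℓ) ⟨ℓ, rfl⟩
  · refine measurable_limitMark ?_ ?_ fun j => ?_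
    · exact measurable_of_mem_iSup_comap (i := Sum.inr (Sum.inl ℓ)) ⟨_, rfl⟩
    · exact measurable_of_mem_iSup_comap (i := Sum.inr (Sum.inr (Sum.inl ℓ))) ⟨_, rfl⟩
    · exact measurable_of_mem_iSup_comap (i := Sum.inr (Sum.inr (Sum.inr (ℓ, j)))) ⟨_, rfl⟩

/-- The first `n` waiting times and marks are independent of the following ones. -/
theorem indepFun_past (h : IsLimitFamily P β w ε Q U) (hg : Measurable (Function.uncurry g))
    (n : ℕ) : IndepFun (fun ω => (factorProduct α g s w ε Q U n ω, ∑ k ∈ Finset.range n, w k ω))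
      (fun ω => (w n ω, limitMark ε Q U n ω)) P := by
  -- The arrival to which a variable belongs: the past is `r < n`, the next arrival is `r = n`.
  let r : ℕ ⊕ ℕ ⊕ ℕ ⊕ (ℕ × ℕ) → ℕ := Sum.elim id (Sum.elim id (Sum.elim id Prod.fst))
  refine indepFun_of_measurable_iSup h.indep h.measurable_elim
    (S := {i | r i < n}) (T := {i | r i = n}) ?_ ?_ ?_
  · rw [Set.disjoint_left]
    intro i (hi : r i < n) (hi' : r i = n)
    exact hi.ne hi'
  · have hw : ∀ ℓ < n, Measurable[⨆ i ∈ {i | r i < n}, MeasurableSpace.comap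
        ((Sum.elim w (Sum.elim ε (Sum.elim (fun ℓ ω => (Q ℓ ω : ℝ)) U)) :
          ℕ ⊕ ℕ ⊕ ℕ ⊕ (ℕ × ℕ) → Ω → ℝ) i) inferInstance] (w ℓ) := fun ℓ hℓ =>
      measurable_of_mem_iSup_comap (F := (Sum.elim w (Sum.elim ε (Sum.elim
        (fun ℓ ω => (Q ℓ ω : ℝ)) U)))) (S := {i | r i < n}) (i := Sum.inl ℓ) hℓ
    refine (measurable_factorProduct hg hw (fun ℓ hℓ => ?_) (fun ℓ hℓ => ?_)
      fun ℓ hℓ j => ?_).prodMk (measurable_partialSum hw)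
    · exact measurable_of_mem_iSup_comap (i := Sum.inr (Sum.inl ℓ)) hℓ
    · exact measurable_of_mem_iSup_comap (i := Sum.inr (Sum.inr (Sum.inl ℓ))) hℓ
    · exact measurable_of_mem_iSup_comap (i := Sum.inr (Sum.inr (Sum.inr (ℓ, j)))) hℓ
  · refine Measurable.prodMk ?_ (measurable_limitMark ?_ ?_ fun j => ?_)
    · exact measurable_of_mem_iSup_comap (i := Sum.inl n) rfl
    · exact measurable_of_mem_iSup_comap (i := Sum.inr (Sum.inl n)) rfl
    · exact measurable_of_mem_iSup_comap (i := Sum.inr (Sum.inr (Sum.inl n))) rfl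
    · exact measurable_of_mem_iSup_comap (i := Sum.inr (Sum.inr (Sum.inr (n, j)))) rfl

section

variable [IsProbabilityMeasure P]

theorem map_U (h : IsLimitFamily P β w ε Q U) (ℓ : ℕ) :
    P.map (fun ω j => U (ℓ, j) ω) = uniformSeq := by
  have hinj : Function.Injective fun j : ℕ =>
      (Sum.inr (Sum.inr (Sum.inr (ℓ, j))) : ℕ ⊕ ℕ ⊕ ℕ ⊕ (ℕ × ℕ)) := fun i j hij => by
    simpa using hij
  have h1 := h.indep.precomp hinj
  have h2 := (iIndepFun_iff_map_fun_eq_infinitePi_map fun j => h.measurable_U (ℓ, j)).1 h1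
  refine h2.trans ?_
  unfold uniformSeq
  congr 1
  ext1 j
  exact (h.law_U (ℓ, j)).map_eq

theorem map_mark (h : IsLimitFamily P β w ε Q U) (ℓ : ℕ) :
    P.map (limitMark ε Q U ℓ) = rademacherLaw.prod ((P.map (Q ℓ)).prod uniformSeq) := by
  have hQm : Measurable fun ω => (Q ℓ ω : ℝ) :=
    (measurable_of_countable (fun k : ℕ => (k : ℝ))).comp (h.measurable_Q ℓ)
  have hUm : Measurable fun ω j => U (ℓ, j) ω :=
    measurable_pi_lambda _ fun j => h.measurable_U (ℓ, j)
  have hfloor : Q ℓ = fun ω => ⌊(Q ℓ ω : ℝ)⌋₊ := by simp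
  have i1 : IndepFun (Q ℓ) (fun ω j => U (ℓ, j) ω) P := by
    refine indepFun_of_measurable_iSup h.indep h.measurable_elim
      (S := {Sum.inr (Sum.inr (Sum.inl ℓ))})
      (T := Set.range fun p => Sum.inr (Sum.inr (Sum.inr p))) ?_ ?_ ?_
    · rw [Set.disjoint_left]
      rintro _ rfl ⟨j, hj⟩
      simp at hj
    · rw [hfloor]
      exact Nat.measurable_floor.comp
        (measurable_of_mem_iSup_comap (i := Sum.inr (Sum.inr (Sum.inl ℓ))) rfl)
    · refine measurable_seq fun j => ?_
      exact measurable_of_mem_iSup_comap (i := Sum.inr (Sum.inr (Sum.inr (ℓ, j)))) ⟨_, rfl⟩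
  have i2 : IndepFun (ε ℓ) (fun ω => (Q ℓ ω, fun j => U (ℓ, j) ω)) P := by
    refine indepFun_of_measurable_iSup h.indep h.measurable_elim
      (S := {Sum.inr (Sum.inl ℓ)}) (T := Set.range fun p => Sum.inr (Sum.inr p)) ?_ ?_ ?_
    · rw [Set.disjoint_left]
      rintro _ rfl ⟨j, hj⟩
      simp at hj
    · exact measurable_of_mem_iSup_comap (i := Sum.inr (Sum.inl ℓ)) rfl
    · refine Measurable.prodMk ?_ (measurable_seq fun j => ?_)
      · rw [hfloor]
        exact Nat.measurable_floor.comp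
          (measurable_of_mem_iSup_comap (i := Sum.inr (Sum.inr (Sum.inl ℓ))) ⟨_, rfl⟩)
      · exact measurable_of_mem_iSup_comap (i := Sum.inr (Sum.inr (Sum.inr (ℓ, j)))) ⟨_, rfl⟩
  have e1 := (indepFun_iff_map_prod_eq_prod_map_map (h.measurable_Q ℓ).aemeasurable
    hUm.aemeasurable).1 i1
  have e2 := (indepFun_iff_map_prod_eq_prod_map_map (h.measurable_ε ℓ).aemeasurable
    ((h.measurable_Q ℓ).prodMk hUm).aemeasurable).1 i2
  rw [h.map_U ℓ] at e1
  rw [e1, (h.law_ε ℓ).map_eq] at e2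
  exact e2

end

theorem real_map_Q (h : IsLimitFamily P β w ε Q U) (hβ_pos : 0 < β) (hβ_lt : β < 1) (ℓ : ℕ)
    {k : ℕ} (hk : k ≠ 0) : (P.map (Q ℓ)).real {k} = sibuyaWeight β k := by
  rw [measureReal_def, Measure.map_apply (h.measurable_Q ℓ) (measurableSet_singleton k)]
  have h1 : P (Q ℓ ⁻¹' {k}) = _ := h.law_Q ℓ k (Nat.one_le_iff_ne_zero.2 hk)
  have h2 := sibuyaWeight_nonneg hβ_pos hβ_lt k
  rw [sibuyaWeight, if_neg hk] at h2
  rw [h1, ENNReal.toReal_ofReal h2, sibuyaWeight, if_neg hk]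

variable [IsProbabilityMeasure P]

/-- The weights are probabilities of disjoint events, so no Gamma identity is needed. -/
theorem summable_sibuyaWeight (h : IsLimitFamily P β w ε Q U) (hβ_pos : 0 < β) (hβ_lt : β < 1) :
    Summable (sibuyaWeight β) := by
  have hp := Measure.isProbabilityMeasure_map (μ := P) (h.measurable_Q 0).aemeasurable
  have h1 : ∑' k : ℕ, (P.map (Q 0)) {k} ≤ 1 := by
    refine (tsum_measure_le_measure_univ (fun k => (measurableSet_singleton k).nullMeasurableSet)
      ?_).trans prob_le_one
    intro i j hij
    exact (Set.disjoint_singleton.2 hij).aedisjoint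
  have h2 := ENNReal.summable_toReal (h1.trans_lt ENNReal.one_lt_top).ne
  refine Summable.of_nonneg_of_le (sibuyaWeight_nonneg hβ_pos hβ_lt) (fun k => ?_) h2
  rcases eq_or_ne k 0 with rfl | hk
  · simp [sibuyaWeight]
  · rw [← h.real_map_Q hβ_pos hβ_lt 0 hk]
    exact le_rfl

instance : IsProbabilityMeasure rademacherLaw := ⟨by
  simp [rademacherLaw, ENNReal.inv_two_add_inv_two]⟩

theorem integral_rademacherLaw (f : ℝ → ℂ) : ∫ x, f x ∂rademacherLaw = (f 1 + f (-1)) / 2 := by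
  have hi : ∀ x : ℝ, Integrable f ((2⁻¹ : ℝ≥0∞) • Measure.dirac x) := fun x =>
    (integrable_dirac (by simp)).smul_measure (by simp)
  rw [rademacherLaw, integral_add_measure (hi 1) (hi (-1)), integral_smul_measure,
    integral_smul_measure, integral_dirac, integral_dirac]
  simp
  ring

/-- The expected defect of a mark at position `y`. -/
theorem integral_markFactor (h : IsLimitFamily P β w ε Q U) (hβ_pos : 0 < β) (hβ_lt : β < 1)
    (hg : Measurable (Function.uncurry g)) (ℓ : ℕ) (y : ℝ) :
    ∫ p, markFactor α g s p y ∂(P.map (limitMark ε Q U ℓ)) = 1 - sibuyaDefect α β g s y := by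
  have hQp := Measure.isProbabilityMeasure_map (μ := P) (h.measurable_Q ℓ).aemeasurable
  have hmp := Measure.isProbabilityMeasure_map (μ := P) (h.measurable_mark ℓ).aemeasurable
  let c := y ^ (-(1 / α))
  have hi : Integrable (fun p => markFactor α g s p y) (P.map (limitMark ε Q U ℓ)) :=
    .of_bound (measurable_markFactor hg measurable_id measurable_const).aestronglyMeasurable 1
      (ae_of_all _ fun p => (norm_markFactor p y).le)
  have hid : Integrable (fun p : ℝ × ℕ × (ℕ → ℝ) => expDefect (rankSum g s p.2.1 (p.1 * c) p.2.2))
      (P.map (limitMark ε Q U ℓ)) := (integrable_const 1).sub hi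
  have h1 : ∫ p : ℝ × ℕ × (ℕ → ℝ), expDefect (rankSum g s p.2.1 (p.1 * c) p.2.2)
      ∂(P.map (limitMark ε Q U ℓ)) = sibuyaDefect α β g s y := by
    have hmd : ∀ z : ℝ, ∫ q : ℕ × (ℕ → ℝ), expDefect (rankSum g s q.1 z q.2)
        ∂((P.map (Q ℓ)).prod uniformSeq) = ∑' k, (sibuyaWeight β k : ℂ) * meanDefect g s k z := by
      intro z
      have hm : Measurable fun q : ℕ × (ℕ → ℝ) => expDefect (rankSum g s q.1 z q.2) :=
        measurable_expDefect.comp ((measurable_rankSum_count (s := s) hg).comp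
          (f := fun q : ℕ × (ℕ → ℝ) => (q.1, z, q.2)) (by fun_prop))
      rw [integral_prod _ (.of_bound hm.aestronglyMeasurable 2
        (ae_of_all _ fun q => norm_expDefect_le _))]
      have hk : Integrable (fun k => meanDefect g s k z) (P.map (Q ℓ)) :=
        .of_bound (measurable_of_countable _).aestronglyMeasurable 2
          (ae_of_all _ fun k => norm_meanDefect_le k z)
      change ∫ k, meanDefect g s k z ∂(P.map (Q ℓ)) = _
      rw [integral_countable hk]
      refine tsum_congr fun k => ?_
      -- The law of `Q` is prescribed for `k ≥ 1` only; `k = 0` does not matter since an empty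
      -- cluster has no defect.
      rcases eq_or_ne k 0 with rfl | hk
      · simp
      · rw [h.real_map_Q hβ_pos hβ_lt ℓ hk, Complex.real_smul]
    have hs' : ∀ z : ℝ, Summable fun k => (sibuyaWeight β k : ℂ) * meanDefect g s k z := fun z => by
      refine Summable.of_norm_bounded ((h.summable_sibuyaWeight hβ_pos hβ_lt).mul_right 2)
        fun k => ?_
      rw [norm_mul, Complex.norm_real, Real.norm_of_nonneg (sibuyaWeight_nonneg hβ_pos hβ_lt k)]
      exact mul_le_mul_of_nonneg_left (norm_meanDefect_le k z)
        (sibuyaWeight_nonneg hβ_pos hβ_lt k)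
    rw [h.map_mark ℓ] at hid ⊢
    rw [integral_prod _ hid, integral_rademacherLaw]
    simp only [one_mul, neg_one_mul, hmd]
    rw [← (hs' _).tsum_add (hs' _), ← tsum_div_const]
    refine tsum_congr fun k => ?_
    simp only [symMeanDefect, c]
    ring
  rw [← h1]
  change _ = 1 - ∫ p, (1 - markFactor α g s p y) ∂_
  rw [integral_sub (integrable_const _) hi]
  simp

end IsLimitFamily

end LimitFamily

/-! ### Clusters as point measures and order statistics -/

section RankCluster

instance : SecondCountableTopology {x : EReal // x ≠ 0} :=
  TopologicalSpace.Subtype.secondCountableTopology {x : EReal | x ≠ 0}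

/-- The point measure with points at the times `t j`, `j < k`, where the mark of a point is `y` with
the sign that `s` attaches to the rank of its time. -/
def rankCluster (s : ℕ → ℝ) (k : ℕ) (y : ℝ) (t : ℕ → ℝ) : Measure MarkSpace :=
  ∑ j ∈ Finset.range k,
    pointMass (s (Finset.card {i ∈ Finset.range k | t i ≤ t j}) * y) (t j)

theorem isDiracSum_rankCluster (s : ℕ → ℝ) (k : ℕ) (y : ℝ) (t : ℕ → ℝ) :
    IsDiracSum (rankCluster s k y t) :=
  .finsetSum _ fun _ => .pointMass _ _

instance (s : ℕ → ℝ) (k : ℕ) (y : ℝ) (t : ℕ → ℝ) : IsFiniteMeasure (rankCluster s k y t) := by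
  unfold rankCluster
  infer_instance

theorem integrable_of_isFiniteMeasure (f : C_c(MarkSpace, ℝ)) (μ : Measure MarkSpace)
    [IsFiniteMeasure μ] : Integrable f μ :=
  f.continuous.integrable_of_hasCompactSupport f.hasCompactSupport

theorem integral_rankCluster (f : C_c(MarkSpace, ℝ)) (s : ℕ → ℝ) (k : ℕ) (y : ℝ) (t : ℕ → ℝ) :
    ∫ x, f x ∂(rankCluster s k y t) = rankSum (markExtend f) s k y t := by
  rw [rankCluster, integral_finsetSum_measure fun j _ => integrable_of_isFiniteMeasure f _]
  simp only [integral_pointMass, rankSum]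

theorem rankCluster_apply_eq_zero {K : Set MarkSpace} {δ : ℝ} {s : ℕ → ℝ}
    (hK : ∀ x t : ℝ, |x| < δ → pointMass x t K = 0) (hs : ∀ k, |s k| = 1) (k : ℕ) {y : ℝ}
    (hy : |y| < δ) (t : ℕ → ℝ) : rankCluster s k y t K = 0 := by
  rw [rankCluster, Measure.finsetSum_apply]
  exact Finset.sum_eq_zero fun j _ => hK _ _ (by rwa [abs_mul, hs, one_mul])

/-- The rank of the `j`-th order statistic. -/
theorem card_le_orderStatistic {u : ℕ → ℝ} (hu : Function.Injective u) (k : ℕ) (j : Fin k) :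
    Finset.card {i ∈ Finset.range k | u i ≤ orderStatistic u k j} = (j : ℕ) + 1 := by
  let v : Fin k → ℝ := fun i => u i
  have hmono : StrictMono (v ∘ Tuple.sort v) := (Tuple.monotone_sort v).strictMono_of_injective
    ((hu.comp Fin.val_injective).comp (Tuple.sort v).injective)
  rw [Finset.card_filter, Finset.sum_range, ← Equiv.sum_comp (Tuple.sort v)]
  have h : ∀ i : Fin k, (u (Tuple.sort v i) ≤ orderStatistic u k j) ↔ i ≤ j := fun i =>
    hmono.le_iff_le
  simp_rw [h]
  rw [← Finset.card_filter, ← Fin.card_Iic j]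
  congr 1
  ext i
  simp

/-- The sorting permutation reindexes the points. Without ties, the order statistic with index `j`,
counted from 0, has rank `j + 1`. -/
theorem sum_pointMass_orderStatistic {u : ℕ → ℝ} (hu : Function.Injective u) (s : ℕ → ℝ) (k : ℕ)
    (y : ℝ) : ∑ j : Fin k, pointMass (s ((j : ℕ) + 1) * y) (orderStatistic u k j) =
      rankCluster s k y u := by
  rw [rankCluster, Finset.sum_range,
    ← Equiv.sum_comp (Tuple.sort fun i : Fin k => u i)
      (fun j : Fin k => pointMass (s (Finset.card {i ∈ Finset.range k | u i ≤ u j}) * y) (u j))]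
  refine Finset.sum_congr rfl fun j _ => ?_
  rw [← card_le_orderStatistic hu k j]
  rfl

end RankCluster

/-! ### Almost sure properties of the limit process -/

section LimitProcess

/-- The Poisson cluster process with the sign pattern `s`. -/
def clusterProcess {Ω : Type*} (α : ℝ) (s : ℕ → ℝ) (w ε : ℕ → Ω → ℝ) (Q : ℕ → Ω → ℕ)
    (U : ℕ × ℕ → Ω → ℝ) (ω : Ω) : Measure MarkSpace :=
  Measure.sum fun ℓ : ℕ => rankCluster s (Q ℓ ω) (ε ℓ ω * arrivalTime w ℓ ω ^ (-(1 / α)))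
    fun j => U (ℓ, j) ω

theorem limitProcess_eq_clusterProcess {Ω : Type*} (α : ℝ) (w ε : ℕ → Ω → ℝ) (Q : ℕ → Ω → ℕ)
    (U : ℕ × ℕ → Ω → ℝ) (ω : Ω) :
    limitProcess α w ε Q U ω = clusterProcess α (fun _ => 1) w ε Q U ω := by
  simp [limitProcess, clusterProcess, rankCluster]

theorem signedLimitProcess_eq_clusterProcess {Ω : Type*} (α : ℝ) (w ε : ℕ → Ω → ℝ) (Q : ℕ → Ω → ℕ)
    (U : ℕ × ℕ → Ω → ℝ) {ω : Ω} (hU : ∀ ℓ, Function.Injective fun j => U (ℓ, j) ω) :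
    signedLimitProcess α w ε Q U ω = clusterProcess α (fun k => (-1) ^ k) w ε Q U ω := by
  unfold signedLimitProcess clusterProcess
  congr 1
  ext1 ℓ
  rw [← sum_pointMass_orderStatistic (hU ℓ)]
  simp only [mul_assoc]

variable {α β δ : ℝ} {g : ℝ → ℝ → ℝ} {s : ℕ → ℝ} {Ω : Type*} {w ε : ℕ → Ω → ℝ} {Q : ℕ → Ω → ℕ}
  {U : ℕ × ℕ → Ω → ℝ}

theorem eventually_abs_mul_rpow_arrivalTime_lt (hα : 0 < α) (hδ : 0 < δ) {ω : Ω}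
    (hε : ∀ ℓ, |ε ℓ ω| = 1) (hw : Tendsto (fun ℓ => arrivalTime w ℓ ω) atTop atTop) :
    ∀ᶠ ℓ in atTop, |ε ℓ ω * arrivalTime w ℓ ω ^ (-(1 / α))| < δ := by
  filter_upwards [hw.eventually_gt_atTop (δ ^ (-α))] with ℓ hℓ
  rw [abs_mul, hε, one_mul]
  exact abs_rpow_neg_inv_lt hα hδ hℓ

/-- Arrival times tend to infinity, so all but finitely many clusters have marks too small to meet a
given compact set. -/
theorem isRadonPointMeasure_clusterProcess (hα : 0 < α) (hs : ∀ k, |s k| = 1) {ω : Ω}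
    (hε : ∀ ℓ, |ε ℓ ω| = 1) (hw : Tendsto (fun ℓ => arrivalTime w ℓ ω) atTop atTop) :
    IsRadonPointMeasure (clusterProcess α s w ε Q U ω) := by
  refine (IsDiracSum.sum fun ℓ => isDiracSum_rankCluster _ _ _ _).isRadonPointMeasure fun K hK => ?_
  obtain ⟨δ, hδ, hK0⟩ := exists_pointMass_apply_eq_zero hK
  obtain ⟨N, hN⟩ := eventually_atTop.1 (eventually_abs_mul_rpow_arrivalTime_lt hα hδ hε hw)
  rw [Measure.sum_apply _ hK.measurableSet, tsum_eq_sum (s := Finset.range N) fun ℓ hℓ =>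
    rankCluster_apply_eq_zero hK0 hs _ (hN ℓ (by simpa using hℓ)) _]
  exact ENNReal.sum_lt_top.2 fun ℓ _ => measure_lt_top _ _

theorem tendsto_integral_clusterProcess (hα : 0 < α) (hs : ∀ k, |s k| = 1) {ω : Ω}
    (hε : ∀ ℓ, |ε ℓ ω| = 1) (hw : Tendsto (fun ℓ => arrivalTime w ℓ ω) atTop atTop)
    (f : C_c(MarkSpace, ℝ)) :
    Tendsto (fun n => ∑ ℓ ∈ Finset.range n, rankSum (markExtend f) s (Q ℓ ω)
        (ε ℓ ω * arrivalTime w ℓ ω ^ (-(1 / α))) fun j => U (ℓ, j) ω) atTop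
      (𝓝 (∫ x, f x ∂(clusterProcess α s w ε Q U ω))) := by
  have h := (hasSum_integral_measure (PointMeasureSpace.integrable
    ⟨_, isRadonPointMeasure_clusterProcess (Q := Q) (U := U) hα hs hε hw⟩ f)).tendsto_sum_nat
  simp only [integral_rankCluster] at h
  exact h

theorem factorProduct_eq (n : ℕ) (ω : Ω) : factorProduct α g s w ε Q U n ω =
    Complex.exp (Complex.I * ((∑ ℓ ∈ Finset.range n, rankSum g s (Q ℓ ω)
      (ε ℓ ω * arrivalTime w ℓ ω ^ (-(1 / α))) fun j => U (ℓ, j) ω : ℝ) : ℂ)) := by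
  rw [Complex.ofReal_sum, Finset.mul_sum, Complex.exp_sum]
  rfl

namespace IsLimitFamily

variable [MeasurableSpace Ω] {P : Measure Ω}

theorem ae_w_pos (h : IsLimitFamily P β w ε Q U) : ∀ᵐ ω ∂P, ∀ ℓ, 0 < w ℓ ω := by
  refine ae_all_iff.2 fun ℓ => ?_
  have h1 : ∀ᵐ x ∂(expMeasure 1), (0 : ℝ) < x := by
    have he : expMeasure 1 = volume.withDensity (exponentialPDF 1) := rfl
    have hm : Measurable (exponentialPDF 1) := (measurable_exponentialPDFReal 1).ennreal_ofReal
    rw [he, ae_withDensity_iff hm]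
    have hne : ∀ᵐ x : ℝ, x ≠ 0 := by simp [ae_iff]
    filter_upwards [hne] with x hx0 hx
    by_contra hlt
    exact hx (exponentialPDF_of_neg (lt_of_le_of_ne (not_lt.1 hlt) hx0))
  rw [← (h.law_w ℓ).map_eq] at h1
  exact ae_of_ae_map (h.measurable_w ℓ).aemeasurable h1

theorem ae_abs_ε (h : IsLimitFamily P β w ε Q U) : ∀ᵐ ω ∂P, ∀ ℓ, |ε ℓ ω| = 1 := by
  refine ae_all_iff.2 fun ℓ => ?_
  have h1 : ∀ᵐ x ∂rademacherLaw, |x| = 1 := by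
    have hm : MeasurableSet {x : ℝ | |x| = 1}ᶜ :=
      (measurableSet_eq_fun measurable_abs measurable_const).compl
    rw [ae_iff]
    change rademacherLaw {x : ℝ | |x| = 1}ᶜ = 0
    simp [rademacherLaw, Measure.dirac_apply' _ hm]
  rw [← (h.law_ε ℓ).map_eq] at h1
  exact ae_of_ae_map (h.measurable_ε ℓ).aemeasurable h1

variable [IsProbabilityMeasure P]

theorem ae_U_injective (h : IsLimitFamily P β w ε Q U) :
    ∀ᵐ ω ∂P, ∀ ℓ, Function.Injective fun j => U (ℓ, j) ω := by
  refine ae_all_iff.2 fun ℓ => ?_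
  have h1 := ae_uniformSeq_injective
  rw [← h.map_U ℓ] at h1
  exact ae_of_ae_map (measurable_seq fun j => h.measurable_U (ℓ, j)).aemeasurable h1

/-- The strong law is applied to the waiting times truncated to `[0, 1]`: these are trivially
integrable, have positive mean and bound the waiting times from below. -/
theorem ae_tendsto_arrivalTime (h : IsLimitFamily P β w ε Q U) :
    ∀ᵐ ω ∂P, Tendsto (fun ℓ => arrivalTime w ℓ ω) atTop atTop := by
  let V : ℕ → Ω → ℝ := fun ℓ ω => max 0 (min (w ℓ ω) 1)
  have hφ : Measurable fun x : ℝ => max 0 (min x 1) := by fun_prop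
  have hV : ∀ ℓ, Measurable (V ℓ) := fun ℓ => hφ.comp (h.measurable_w ℓ)
  have hi : Integrable (V 0) P := by
    refine .of_bound (hV 0).aestronglyMeasurable 1 (ae_of_all _ fun ω => ?_)
    rw [Real.norm_of_nonneg (le_max_left _ _)]
    exact max_le zero_le_one (min_le_right _ _)
  have hind : iIndepFun w P := h.indep.precomp (g := Sum.inl) Sum.inl_injective
  have hslln := strong_law_ae_real V hi
    (fun i j hij => (hind.indepFun hij).comp hφ hφ) fun i =>
      (IdentDistrib.mk (h.measurable_w i).aemeasurable (h.measurable_w 0).aemeasurable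
        ((h.law_w i).map_eq.trans (h.law_w 0).map_eq.symm)).comp hφ
  have hpos : 0 < ∫ ω, V 0 ω ∂P := by
    refine (integral_pos_iff_support_of_nonneg (fun ω => le_max_left _ _) hi).2 ?_
    have hfull : P (Function.support (V 0)) = 1 := by
      refine (measure_congr (eventuallyEq_univ.2 ?_)).trans measure_univ
      filter_upwards [h.ae_w_pos] with ω hω
      exact (lt_max_of_lt_right (lt_min (hω 0) one_pos)).ne'
    exact hfull.symm ▸ one_pos
  filter_upwards [hslln, h.ae_w_pos] with ω h1 hω
  have h2 : Tendsto (fun n : ℕ => ∑ i ∈ Finset.range n, V i ω) atTop atTop := by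
    refine (h1.pos_mul_atTop hpos tendsto_natCast_atTop_atTop).congr' ?_
    filter_upwards [eventually_ne_atTop 0] with n hn
    exact div_mul_cancel₀ _ (by exact_mod_cast hn)
  refine tendsto_atTop_mono (fun ℓ => ?_) (h2.comp (tendsto_add_atTop_nat 1))
  exact Finset.sum_le_sum fun i _ => max_le (hω i).le (min_le_left _ _)

end IsLimitFamily

end LimitProcess

/-! ### Characteristic functional of the limit -/

section CharacteristicFunctional

namespace IsLimitFamily

variable {α β δ : ℝ} {s : ℕ → ℝ} {Ω : Type*} [MeasurableSpace Ω] {P : Measure Ω}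
  {w ε : ℕ → Ω → ℝ} {Q : ℕ → Ω → ℕ} {U : ℕ × ℕ → Ω → ℝ}

theorem factorProduct_measurable {g : ℝ → ℝ → ℝ} (h : IsLimitFamily P β w ε Q U)
    (hg : Measurable (Function.uncurry g)) (n : ℕ) :
    Measurable (factorProduct α g s w ε Q U n) :=
  measurable_factorProduct hg (fun ℓ _ => h.measurable_w ℓ) (fun ℓ _ => h.measurable_ε ℓ)
    (fun ℓ _ => (measurable_of_countable (fun k : ℕ => (k : ℝ))).comp (h.measurable_Q ℓ))
    fun ℓ _ j => h.measurable_U (ℓ, j)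

variable [IsProbabilityMeasure P]

theorem exists_ae_norm_factorProduct_mul_le {g : ℝ → ℝ → ℝ} (h : IsLimitFamily P β w ε Q U)
    (hα : 0 < α) (hβ_pos : 0 < β) (hβ_lt : β < 1) (hg : IsTestFunction g δ)
    (hs : ∀ k, |s k| = 1) :
    ∃ M, ∀ n, ∀ᵐ ω ∂P, ‖factorProduct α g s w ε Q U n ω *
      poissonFunctional (sibuyaDefect α β g s) (∑ k ∈ Finset.range n, w k ω)‖ ≤ M := by
  have hβs := h.summable_sibuyaWeight hβ_pos hβ_lt
  obtain ⟨M, hM⟩ := exists_norm_poissonFunctional_le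
    (measurable_sibuyaDefect (α := α) (s := s) hβ_pos hβ_lt hβs hg)
    (norm_sibuyaDefect_le hβ_pos hβ_lt hβs) (fun y hy => sibuyaDefect_eq_zero hα hg hs hy)
  refine ⟨M, fun n => ?_⟩
  filter_upwards [h.ae_w_pos] with ω hω
  rw [norm_mul, norm_factorProduct, one_mul]
  exact hM _ (Finset.sum_nonneg fun k _ => (hω k).le)

/-- The products of the factors of the first `n` arrivals, compensated, have constant mean. -/
theorem integral_factorProduct_mul {g : ℝ → ℝ → ℝ} (h : IsLimitFamily P β w ε Q U)
    (hα : 0 < α) (hβ_pos : 0 < β) (hβ_lt : β < 1) (hg : IsTestFunction g δ)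
    (hs : ∀ k, |s k| = 1) (n : ℕ) :
    ∫ ω, factorProduct α g s w ε Q U n ω *
      poissonFunctional (sibuyaDefect α β g s) (∑ k ∈ Finset.range n, w k ω) ∂P =
      Complex.exp (-∫ y in Set.Ioi 0, sibuyaDefect α β g s y) := by
  have hβs := h.summable_sibuyaWeight hβ_pos hβ_lt
  have hDm := measurable_sibuyaDefect (α := α) (s := s) hβ_pos hβ_lt hβs hg
  have hDb := norm_sibuyaDefect_le (α := α) (g := g) (s := s) hβ_pos hβ_lt hβs
  have hΦ := continuous_poissonFunctional hDm hDb
  obtain ⟨M, hM⟩ := h.exists_ae_norm_factorProduct_mul_le hα hβ_pos hβ_lt hg hs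
  set D := sibuyaDefect α β g s with hD
  induction n with
  | zero => simp [factorProduct, poissonFunctional_zero]
  | succ n ih =>
    rw [← ih]
    -- `Y` is the past and `Z` the next arrival. By independence the next mark is integrated out,
    -- giving `1 - D`, and then the waiting time, where the renewal equation restores the
    -- compensator of step `n`.
    let Y : Ω → ℂ × ℝ := fun ω => (factorProduct α g s w ε Q U n ω, ∑ k ∈ Finset.range n, w k ω)
    let Z : Ω → ℝ × ℝ × ℕ × (ℕ → ℝ) := fun ω => (w n ω, limitMark ε Q U n ω)
    have hY : Measurable Y := (h.factorProduct_measurable hg.measurable n).prodMk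
      (measurable_partialSum fun ℓ _ => h.measurable_w ℓ)
    have hZ : Measurable Z := (h.measurable_w n).prodMk (h.measurable_mark n)
    have hYp := Measure.isProbabilityMeasure_map (μ := P) hY.aemeasurable
    have hZp := Measure.isProbabilityMeasure_map (μ := P) hZ.aemeasurable
    have hmp := Measure.isProbabilityMeasure_map (μ := P) (h.measurable_mark n).aemeasurable
    have hep : IsProbabilityMeasure (expMeasure 1) := isProbabilityMeasure_expMeasure one_pos
    let G : (ℂ × ℝ) × (ℝ × ℝ × ℕ × (ℕ → ℝ)) → ℂ := fun z =>
      z.1.1 * (markFactor α g s z.2.2 (z.1.2 + z.2.1) * poissonFunctional D (z.1.2 + z.2.1))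
    have hG : Measurable G := by
      have h1 : Measurable fun z : (ℂ × ℝ) × (ℝ × ℝ × ℕ × (ℕ → ℝ)) =>
          markFactor α g s z.2.2 (z.1.2 + z.2.1) :=
        measurable_markFactor hg.measurable (by fun_prop) (by fun_prop)
      have h2 := hΦ.measurable
      fun_prop
    have e1 : ∀ ω, factorProduct α g s w ε Q U (n + 1) ω *
        poissonFunctional D (∑ k ∈ Finset.range (n + 1), w k ω) = G (Y ω, Z ω) := fun ω => by
      simp only [factorProduct, Finset.prod_range_succ, arrivalTime, Finset.sum_range_succ, G, Y, Z]
      ring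
    have hjoint : P.map (fun ω => (Y ω, Z ω)) = (P.map Y).prod (P.map Z) :=
      (indepFun_iff_map_prod_eq_prod_map_map hY.aemeasurable hZ.aemeasurable).1
        (h.indepFun_past hg.measurable n)
    have hZmap : P.map Z = (expMeasure 1).prod (P.map (limitMark ε Q U n)) := by
      rw [← (h.law_w n).map_eq]
      exact (indepFun_iff_map_prod_eq_prod_map_map (h.measurable_w n).aemeasurable
        (h.measurable_mark n).aemeasurable).1 (h.indepFun_w_mark n)
    have hGi : Integrable G ((P.map Y).prod (P.map Z)) := by
      rw [← hjoint, integrable_map_measure hG.aestronglyMeasurable (hY.prodMk hZ).aemeasurable]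
      refine .of_bound (hG.comp (hY.prodMk hZ)).aestronglyMeasurable M ?_
      filter_upwards [hM (n + 1)] with ω hω
      rwa [e1] at hω
    simp_rw [e1]
    rw [← integral_map (f := G) (hY.prodMk hZ).aemeasurable hG.aestronglyMeasurable, hjoint,
      integral_prod _ hGi]
    have hYpos : ∀ᵐ y ∂(P.map Y), 0 ≤ y.2 := by
      rw [ae_map_iff hY.aemeasurable (measurableSet_le measurable_const measurable_snd)]
      filter_upwards [h.ae_w_pos] with ω hω
      have : 0 ≤ ∑ k ∈ Finset.range n, w k ω := Finset.sum_nonneg fun k _ => (hω k).le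
      exact this
    have hin : ∀ᵐ y ∂(P.map Y), ∫ z, G (y, z) ∂(P.map Z) = y.1 * poissonFunctional D y.2 := by
      filter_upwards [hYpos, hGi.prod_right_ae] with y hy hi
      rw [hZmap] at hi ⊢
      rw [integral_prod _ hi]
      simp only [G]
      simp_rw [integral_const_mul, integral_mul_const]
      rw [← integral_mul_poissonFunctional hDm hDb
        (fun y hy => sibuyaDefect_eq_zero hα hg hs hy)
        (fun x hx => continuousAt_sibuyaDefect hβ_pos hβ_lt hβs hg hs hx) hy]
      congr 1
      refine integral_congr_ae (ae_of_all _ fun v => ?_)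
      simp only
      rw [h.integral_markFactor hβ_pos hβ_lt hg.measurable n]
    rw [integral_congr_ae hin]
    have h3 : Measurable fun y : ℂ × ℝ => y.1 * poissonFunctional D y.2 := by
      have h2 := hΦ.measurable
      fun_prop
    rw [integral_map hY.aemeasurable h3.aestronglyMeasurable]

variable (f : C_c(MarkSpace, ℝ))

theorem ae_tendsto_integral (h : IsLimitFamily P β w ε Q U) (hα : 0 < α) (hs : ∀ k, |s k| = 1) :
    ∀ᵐ ω ∂P, Tendsto (fun n => ∑ ℓ ∈ Finset.range n, rankSum (markExtend f) s (Q ℓ ω)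
        (ε ℓ ω * arrivalTime w ℓ ω ^ (-(1 / α))) fun j => U (ℓ, j) ω) atTop
      (𝓝 (∫ x, f x ∂(clusterProcess α s w ε Q U ω))) := by
  filter_upwards [h.ae_abs_ε, h.ae_tendsto_arrivalTime] with ω hε hw
  exact tendsto_integral_clusterProcess hα hs hε hw f

theorem ae_isRadonPointMeasure (h : IsLimitFamily P β w ε Q U) (hα : 0 < α)
    (hs : ∀ k, |s k| = 1) : ∀ᵐ ω ∂P, IsRadonPointMeasure (clusterProcess α s w ε Q U ω) := by
  filter_upwards [h.ae_abs_ε, h.ae_tendsto_arrivalTime] with ω hε hw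
  exact isRadonPointMeasure_clusterProcess hα hs hε hw

theorem aemeasurable_integral (h : IsLimitFamily P β w ε Q U) (hα : 0 < α)
    (hs : ∀ k, |s k| = 1) :
    AEMeasurable (fun ω => ∫ x, f x ∂(clusterProcess α s w ε Q U ω)) P := by
  obtain ⟨δ, hδ⟩ := exists_isTestFunction f
  refine aemeasurable_of_tendsto_metrizable_ae atTop (fun n => ?_) (h.ae_tendsto_integral f hα hs)
  refine (Finset.measurable_sum _ fun ℓ _ => ?_).aemeasurable
  have hm := h.measurable_mark ℓ
  have hw : Measurable (arrivalTime w ℓ) := measurable_partialSum fun k _ => h.measurable_w k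
  exact (measurable_rankSum_count (s := s) hδ.measurable).comp
    (f := fun ω => ((limitMark ε Q U ℓ ω).2.1, (limitMark ε Q U ℓ ω).1 *
      arrivalTime w ℓ ω ^ (-(1 / α)), (limitMark ε Q U ℓ ω).2.2))
    (hm.snd.fst.prodMk ((hm.fst.mul (hw.pow_const _)).prodMk hm.snd.snd))

/-- The characteristic functional of the limit. -/
theorem integral_exp_integral_clusterProcess (h : IsLimitFamily P β w ε Q U) (hα : 0 < α)
    (hβ_pos : 0 < β) (hβ_lt : β < 1) (hs : ∀ k, |s k| = 1) :
    ∫ ω, Complex.exp (Complex.I * ((∫ x, f x ∂(clusterProcess α s w ε Q U ω) : ℝ) : ℂ)) ∂P =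
      Complex.exp (-∫ y in Set.Ioi 0, sibuyaDefect α β (markExtend f) s y) := by
  obtain ⟨δ, hg⟩ := exists_isTestFunction f
  have hβs := h.summable_sibuyaWeight hβ_pos hβ_lt
  have hDm := measurable_sibuyaDefect (α := α) (s := s) hβ_pos hβ_lt hβs hg
  have hDb := norm_sibuyaDefect_le (α := α) (g := markExtend f) (s := s) hβ_pos hβ_lt hβs
  have hΦ := continuous_poissonFunctional hDm hDb
  obtain ⟨M, hM⟩ := h.exists_ae_norm_factorProduct_mul_le hα hβ_pos hβ_lt hg hs
  -- The compensated means are constant in `n`. They also tend to the functional of the limit: the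
  -- compensator equals 1 once the arrival time exceeds `δ ^ (-α)`.
  refine tendsto_nhds_unique (l := atTop) ?_ (tendsto_const_nhds.congr fun n =>
    (h.integral_factorProduct_mul hα hβ_pos hβ_lt hg hs n).symm)
  refine tendsto_integral_of_dominated_convergence (fun _ => M) (fun n => ?_)
    (integrable_const _) hM ?_
  · exact ((h.factorProduct_measurable hg.measurable n).mul (hΦ.measurable.comp
      (measurable_partialSum fun ℓ _ => h.measurable_w ℓ))).aestronglyMeasurable
  · filter_upwards [h.ae_tendsto_integral f hα hs, h.ae_tendsto_arrivalTime] with ω h1 h2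
    have h2' : Tendsto (fun n => ∑ k ∈ Finset.range n, w k ω) atTop atTop :=
      (tendsto_add_atTop_iff_nat 1).1 h2
    have h3 : Tendsto (fun n => factorProduct α (markExtend f) s w ε Q U n ω) atTop
        (𝓝 (Complex.exp (Complex.I *
          ((∫ x, f x ∂(clusterProcess α s w ε Q U ω) : ℝ) : ℂ)))) := by
      simp_rw [factorProduct_eq]
      exact ((Complex.continuous_exp.comp (continuous_const.mul
        Complex.continuous_ofReal)).tendsto _).comp h1
    refine (h3.congr' ?_)
    filter_upwards [h2'.eventually_ge_atTop (δ ^ (-α)), h2'.eventually_ge_atTop 0] with n hn hn0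
    rw [poissonFunctional_eq_one (fun y hy => sibuyaDefect_eq_zero hα hg hs hy) hn hn0, mul_one]

end IsLimitFamily

end CharacteristicFunctional

/-! ### Complex powers converging to an exponential -/

section PowerLimit

/-- If `k → ∞` and `k z → t` then `(1 + z) ^ k → exp t`. -/
theorem tendsto_one_add_pow_exp {ι : Type*} {l : Filter ι} {k : ι → ℕ} (hk : Tendsto k l atTop)
    {z : ι → ℂ} {t : ℂ} (h : Tendsto (fun n => k n * z n) l (𝓝 t)) :
    Tendsto (fun n => (1 + z n) ^ k n) l (𝓝 (Complex.exp t)) := by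
  have hk' : Tendsto (fun n => (k n : ℝ)⁻¹) l (𝓝 0) :=
    tendsto_inv_atTop_zero.comp (tendsto_natCast_atTop_atTop.comp hk)
  have hz : Tendsto z l (𝓝 0) := by
    have h1 := ((Complex.continuous_ofReal.tendsto _).comp hk').mul h
    simp only [Complex.ofReal_zero, zero_mul] at h1
    refine h1.congr' ?_
    filter_upwards [hk.eventually_ne_atTop 0] with n hn
    have hn' : (k n : ℂ) ≠ 0 := by exact_mod_cast hn
    simp [hn']
  have hlog : Tendsto (fun n => k n * Complex.log (1 + z n)) l (𝓝 t) := by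
    -- `log (1 + z) - z = O(z ^ 2)`, and `k z ^ 2` tends to 0 because `k z` converges while `z → 0`.
    have hO : (fun n => (k n : ℂ) * (Complex.log (1 + z n) - z n)) =O[l]
        fun n => k n * z n * z n := by
      simp_rw [mul_assoc, ← sq]
      exact (Asymptotics.isBigO_refl _ _).mul (Complex.log_sub_self_isBigO.comp_tendsto hz)
    have h0 := hO.trans_tendsto (by simpa using h.mul hz)
    have h1 := h0.add h
    rw [zero_add] at h1
    exact h1.congr fun n => by ring
  refine ((Complex.continuous_exp.tendsto _).comp hlog).congr' ?_
  have h1 : ∀ᶠ n in l, z n ≠ -1 := hz.eventually_ne (by simp)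
  filter_upwards [h1] with n hn
  have hne : 1 + z n ≠ 0 := fun h => hn (by linear_combination h)
  simp [Complex.exp_nat_mul, Complex.exp_log hne]

end PowerLimit

/-! ### The sample as a sum of row contributions -/

section SampleSum

/-- The sum of a test function over the points with times `(j + 1) / n`, `j < n`, with
multiplicities `e j`, where the mark of a point is `y` with the sign that `s` attaches to the number
of points up to its time. -/
def sampleSum (g : ℝ → ℝ → ℝ) (s : ℕ → ℝ) (n : ℕ) (y : ℝ) (e : ℕ → ℕ) : ℝ :=
  ∑ j ∈ Finset.range n,
    (e j : ℝ) * g (s (∑ k ∈ Finset.range (j + 1), e k) * y) (((j : ℝ) + 1) / n)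

variable {g : ℝ → ℝ → ℝ} {s : ℕ → ℝ}

theorem measurable_sampleSum (hg : Measurable (Function.uncurry g)) (n : ℕ) {γ : Type*}
    {mγ : MeasurableSpace γ} {y : γ → ℝ} (hy : Measurable y) {e : γ → ℕ → ℕ} (he : Measurable e) :
    Measurable fun b => sampleSum g s n (y b) (e b) := by
  have he' : ∀ j, Measurable fun b => e b j := fun j => (measurable_pi_apply j).comp he
  refine Finset.measurable_sum _ fun j _ => Measurable.mul ?_ ?_
  · exact (measurable_of_countable (fun k : ℕ => (k : ℝ))).comp (he' j)
  · refine hg.comp (Measurable.prodMk (Measurable.mul ?_ hy) measurable_const)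
    exact (measurable_of_countable s).comp (Finset.measurable_sum _ fun k _ => he' k)

/-- For a 0–1 pattern, the running number of successes at a success is its rank in `S`. -/
theorem sampleSum_eq_gridSum {n : ℕ} {S : Finset ℕ} (hS : S ⊆ Finset.range n) {e : ℕ → ℕ}
    (he : ∀ j < n, e j = if j ∈ S then 1 else 0) (y : ℝ) :
    sampleSum g s n y e = gridSum g s n S y := by
  unfold sampleSum gridSum
  rw [← Finset.sum_subset hS fun j hj hjS => by simp [he j (Finset.mem_range.1 hj), hjS]]
  refine Finset.sum_congr rfl fun j hj => ?_
  have hjn := Finset.mem_range.1 (hS hj)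
  have h1 : ∑ k ∈ Finset.range (j + 1), e k = Finset.card {i ∈ S | i ≤ j} := by
    rw [Finset.sum_congr rfl fun k hk => he k (lt_of_le_of_lt
      (Nat.lt_succ_iff.1 (Finset.mem_range.1 hk)) hjn), ← Finset.sum_filter,
      ← Finset.card_eq_sum_ones]
    congr 1
    ext k
    simp [and_comm]
  rw [he j hjn, if_pos hj, h1]
  simp

/-- The point process of a sample, with the sign pattern `s`. -/
def sampleProcess {Ω : Type*} (α' : ℝ) (a : ℕ → ℝ) (s : ℕ → ℝ) (m : ℕ → ℕ) (X q : ℕ → Ω → ℝ)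
    (η : ℕ → ℕ → Ω → ℕ) (n : ℕ) (ω : Ω) : Measure MarkSpace :=
  ∑ i ∈ Finset.range (m n), ∑ j ∈ Finset.range n,
    η i j ω • pointMass (s (successCount η i j ω) * (X i ω / (a n * q i ω ^ (1 / α'))))
      (((j : ℝ) + 1) / n)

variable {Ω : Type*} {α' : ℝ} {a : ℕ → ℝ} {m : ℕ → ℕ} {X q : ℕ → Ω → ℝ} {η : ℕ → ℕ → Ω → ℕ}

theorem summandProcess_eq_sampleProcess :
    summandProcess α' a m X q η = sampleProcess α' a (fun _ => 1) m X q η := by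
  funext n ω
  simp [summandProcess, sampleProcess]

theorem signedSummandProcess_eq_sampleProcess :
    signedSummandProcess α' a m X q η = sampleProcess α' a (fun k => (-1) ^ k) m X q η := by
  funext n ω
  simp [signedSummandProcess, sampleProcess, mul_div_assoc]

instance (n : ℕ) (ω : Ω) : IsFiniteMeasure (sampleProcess α' a s m X q η n ω) := by
  unfold sampleProcess
  infer_instance

theorem isRadonPointMeasure_sampleProcess (n : ℕ) (ω : Ω) :
    IsRadonPointMeasure (sampleProcess α' a s m X q η n ω) :=
  IsDiracSum.isRadonPointMeasure (.finsetSum _ fun _ => .finsetSum _ fun _ =>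
    (IsDiracSum.pointMass _ _).nsmul _) fun _ _ => measure_lt_top _ _

theorem integral_sampleProcess (f : C_c(MarkSpace, ℝ)) (n : ℕ) (ω : Ω) :
    ∫ x, f x ∂(sampleProcess α' a s m X q η n ω) =
      ∑ i ∈ Finset.range (m n), sampleSum (markExtend f) s n
        (X i ω / (a n * q i ω ^ (1 / α'))) fun j => η i j ω := by
  rw [sampleProcess, integral_finsetSum_measure fun i _ => integrable_of_isFiniteMeasure f _]
  refine Finset.sum_congr rfl fun i _ => ?_
  rw [integral_finsetSum_measure fun i _ => integrable_of_isFiniteMeasure f _]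
  refine Finset.sum_congr rfl fun j _ => ?_
  rw [← Nat.cast_smul_eq_nsmul ℝ≥0∞, integral_smul_measure, integral_pointMass]
  simp [successCount]

end SampleSum

/-! ### Conditional Bernoulli trials and the functional of the sample -/

section Bernoulli

/-- The probability of a pattern of successes among `n` Bernoulli trials. -/
theorem prod_ite_ofReal {n : ℕ} {S : Finset ℕ} (hS : S ⊆ Finset.range n) (p : ℝ) :
    ∏ j ∈ Finset.range n, ENNReal.ofReal (if j ∈ S then p else 1 - p) =
      ENNReal.ofReal p ^ S.card * ENNReal.ofReal (1 - p) ^ (n - S.card) := by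
  have h1 : ∀ j, ENNReal.ofReal (if j ∈ S then p else 1 - p) =
      if j ∈ S then ENNReal.ofReal p else ENNReal.ofReal (1 - p) := fun j => apply_ite _ _ _ _
  simp_rw [h1]
  rw [Finset.prod_ite, Finset.prod_const, Finset.prod_const, Finset.filter_mem_eq_inter,
    Finset.inter_eq_right.2 hS, ← Finset.sdiff_eq_filter, Finset.card_sdiff_of_subset hS,
    Finset.card_range]

/-- The event that the successes among the first `n` trials are those in `S`. -/
def successPattern {Ω : Type*} (η : ℕ → ℕ → Ω → ℕ) (i n : ℕ) (S : Finset ℕ) : Set Ω :=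
  {ω | ∀ j < n, η i j ω = if j ∈ S then 1 else 0}

theorem pairwiseDisjoint_successPattern {Ω : Type*} (η : ℕ → ℕ → Ω → ℕ) (i n : ℕ) :
    ((Finset.range n).powerset : Set (Finset ℕ)).PairwiseDisjoint (successPattern η i n) := by
  intro S hS T hT hST
  refine Set.disjoint_left.2 fun ω h1 h2 => hST ?_
  simp only [Finset.coe_powerset, Set.mem_preimage, Set.mem_powerset_iff, Finset.coe_subset]
    at hS hT
  ext j
  by_cases hj : j < n
  · have h3 := (h1 j hj).symm.trans (h2 j hj)
    by_cases hjS : j ∈ S <;> by_cases hjT : j ∈ T <;> simp_all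
  · exact ⟨fun h => absurd (Finset.mem_range.1 (hS h)) hj,
      fun h => absurd (Finset.mem_range.1 (hT h)) hj⟩

namespace IsAggregatedSample

variable {Ω : Type*} [MeasurableSpace Ω] {P : Measure Ω} {ν π : Measure ℝ} {X q : ℕ → Ω → ℝ}
  {η : ℕ → ℕ → Ω → ℕ}

theorem measurableSet_successPattern (h : IsAggregatedSample P ν π X q η) (i n : ℕ) (S : Finset ℕ) :
    MeasurableSet (successPattern η i n S) := by
  have : successPattern η i n S = ⋂ j, ⋂ (_ : j < n), η i j ⁻¹' {if j ∈ S then 1 else 0} := by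
    ext
    simp [successPattern]
  rw [this]
  exact .iInter fun j => .iInter fun _ => h.measurable_η i j (measurableSet_singleton _)

/-- The joint law of the parameter and a pattern of successes. -/
theorem map_restrict_successPattern (h : IsAggregatedSample P ν π X q η) (i n : ℕ) {S : Finset ℕ}
    (hS : S ⊆ Finset.range n) :
    (P.restrict (successPattern η i n S)).map (q i) =
      π.withDensity fun p => ENNReal.ofReal p ^ S.card * ENNReal.ofReal (1 - p) ^ (n - S.card) := by
  ext B hB
  have h1 := h.bernoulli i n S B hB
  simp_rw [prod_ite_ofReal hS] at h1
  rw [Measure.map_apply (h.measurable_q i) hB,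
    Measure.restrict_apply (h.measurable_q i hB), withDensity_apply _ hB, ← (h.law_q i).map_eq,
    setLIntegral_map hB (by fun_prop) (h.measurable_q i)]
  exact h1


variable [IsProbabilityMeasure P]

/-- The trials are a priori arbitrary natural numbers. That they are almost surely 0 or 1 follows
because the probabilities of the patterns add up to the mean of `(q + (1 - q)) ^ n = 1`. -/
theorem ae_mem_successPattern (h : IsAggregatedSample P ν π X q η)
    (hπ : ∀ᵐ p ∂π, p ∈ Set.Ioo (0 : ℝ) 1) (i n : ℕ) :
    ∀ᵐ ω ∂P, ω ∈ ⋃ S ∈ (Finset.range n).powerset, successPattern η i n S := by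
  have hπp : IsProbabilityMeasure π := by
    rw [← (h.law_q i).map_eq]
    exact Measure.isProbabilityMeasure_map (h.measurable_q i).aemeasurable
  have hm : MeasurableSet (⋃ S ∈ (Finset.range n).powerset, successPattern η i n S) :=
    Finset.measurableSet_biUnion _ fun S _ => h.measurableSet_successPattern i n S
  refine (mem_ae_iff_prob_eq_one hm).2 ?_
  rw [measure_biUnion_finset (pairwiseDisjoint_successPattern η i n)
    fun S _ => h.measurableSet_successPattern i n S]
  have h1 : ∀ S ∈ (Finset.range n).powerset, P (successPattern η i n S) =
      ∫⁻ p, ENNReal.ofReal p ^ S.card * ENNReal.ofReal (1 - p) ^ (n - S.card) ∂π := by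
    intro S hS
    have h2 := congrArg (fun μ => μ Set.univ)
      (h.map_restrict_successPattern i n (Finset.mem_powerset.1 hS))
    simpa [Measure.map_apply (h.measurable_q i) MeasurableSet.univ] using h2
  rw [Finset.sum_congr rfl h1, ← lintegral_finsetSum _ fun S _ => by fun_prop]
  have h3 : ∀ᵐ p ∂π, ∑ S ∈ (Finset.range n).powerset,
      ENNReal.ofReal p ^ S.card * ENNReal.ofReal (1 - p) ^ (n - S.card) = 1 := by
    filter_upwards [hπ] with p hp
    have h4 := Finset.sum_pow_mul_eq_add_pow (ENNReal.ofReal p) (ENNReal.ofReal (1 - p))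
      (Finset.range n)
    rw [Finset.card_range, ← ENNReal.ofReal_add hp.1.le (sub_nonneg.2 hp.2.le)] at h4
    simpa using h4
  rw [lintegral_congr_ae h3]
  simp

/-- The expectation of a function of the parameter and the first `n` trials. -/
theorem integral_eq_sum_successPattern (h : IsAggregatedSample P ν π X q η)
    (hπ : ∀ᵐ p ∂π, p ∈ Set.Ioo (0 : ℝ) 1) (i n : ℕ) {F : Ω → ℂ} (hF : Integrable F P)
    {H : Finset ℕ → ℝ → ℂ} (hH : ∀ S, Measurable (H S))
    (hFH : ∀ S, S ⊆ Finset.range n → ∀ ω ∈ successPattern η i n S, F ω = H S (q i ω)) :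
    ∫ ω, F ω ∂P = ∑ S ∈ (Finset.range n).powerset,
      ∫ p, ((p ^ S.card * (1 - p) ^ (n - S.card) : ℝ) : ℂ) * H S p ∂π := by
  rw [← Measure.restrict_eq_self_of_ae_mem (h.ae_mem_successPattern hπ i n),
    integral_biUnion_finset _ (fun S _ => h.measurableSet_successPattern i n S)
      (pairwiseDisjoint_successPattern η i n) fun S _ => hF.integrableOn]
  refine Finset.sum_congr rfl fun S hS => ?_
  have hS' := Finset.mem_powerset.1 hS
  rw [setIntegral_congr_fun (h.measurableSet_successPattern i n S) (hFH S hS'),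
    ← integral_map (φ := q i) (f := H S) (h.measurable_q i).aemeasurable
      (hH S).aestronglyMeasurable, h.map_restrict_successPattern i n hS',
    integral_withDensity_eq_integral_toReal_smul (by fun_prop)
      (ae_of_all _ fun p => ENNReal.mul_lt_top (by simp) (by simp))]
  refine integral_congr_ae ?_
  filter_upwards [hπ] with p hp
  rw [ENNReal.toReal_mul, ENNReal.toReal_pow, ENNReal.toReal_pow, ENNReal.toReal_ofReal hp.1.le,
    ENNReal.toReal_ofReal (sub_nonneg.2 hp.2.le), Complex.real_smul]

/-- The expected defect of one summand. -/
theorem integral_expDefect_sampleSum [IsProbabilityMeasure ν] {g : ℝ → ℝ → ℝ} {s : ℕ → ℝ}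
    (h : IsAggregatedSample P ν π X q η) (hπ : ∀ᵐ p ∂π, p ∈ Set.Ioo (0 : ℝ) 1)
    (hg : Measurable (Function.uncurry g)) {c : ℝ → ℝ} (hc : Measurable c) (i n : ℕ) :
    ∫ ω, expDefect (sampleSum g s n (X i ω / c (q i ω)) fun j => η i j ω) ∂P =
      ∫ p, (∫ x, binomialDefect g s n p (x / c p) ∂ν) ∂π := by
  have hπp : IsProbabilityMeasure π := by
    rw [← (h.law_q i).map_eq]
    exact Measure.isProbabilityMeasure_map (h.measurable_q i).aemeasurable
  let W : Ω → ℝ × (ℕ → ℕ) := fun ω => (q i ω, fun j => η i j ω)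
  have hW : Measurable W :=
    (h.measurable_q i).prodMk (measurable_pi_lambda _ fun j => h.measurable_η i j)
  have hWp := Measure.isProbabilityMeasure_map (μ := P) hW.aemeasurable
  let G : ℝ × ℝ × (ℕ → ℕ) → ℂ := fun z => expDefect (sampleSum g s n (z.1 / c z.2.1) z.2.2)
  have hG : Measurable G :=
    measurable_expDefect.comp (measurable_sampleSum hg n (by fun_prop) (by fun_prop))
  have hjoint : P.map (fun ω => (X i ω, W ω)) = ν.prod (P.map W) := by
    rw [← (h.law_X i).map_eq]
    exact (indepFun_iff_map_prod_eq_prod_map_map (h.measurable_X i).aemeasurable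
      hW.aemeasurable).1 (h.indep_X i)
  -- `X` is integrated out first by independence; what remains depends on the parameter and the
  -- pattern only.
  have h1 : ∫ ω, G (X i ω, W ω) ∂P = ∫ ω, (∫ x, G (x, W ω) ∂ν) ∂P := by
    rw [← integral_map (φ := fun ω => (X i ω, W ω)) (f := G)
      ((h.measurable_X i).prodMk hW).aemeasurable hG.aestronglyMeasurable, hjoint,
      integral_prod_symm _ (.of_bound hG.aestronglyMeasurable 2
        (ae_of_all _ fun z => norm_expDefect_le _))]
    exact integral_map hW.aemeasurable
      hG.stronglyMeasurable.integral_prod_left'.aestronglyMeasurable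
  refine h1.trans ?_
  have hgrid : ∀ S, Measurable fun z : ℝ × ℝ => expDefect (gridSum g s n S (z.2 / c z.1)) :=
    fun S => measurable_expDefect.comp (Finset.measurable_sum _ fun j _ =>
      hg.comp (Measurable.prodMk (by fun_prop) measurable_const))
  have hHm : ∀ S, Measurable fun p => ∫ x, expDefect (gridSum g s n S (x / c p)) ∂ν := fun S =>
    (hgrid S).stronglyMeasurable.integral_prod_right.measurable
  have hGb : ∀ y, ‖∫ x, G (x, y) ∂ν‖ ≤ 2 := fun y =>
    (norm_integral_le_of_norm_le_const (ae_of_all _ fun x => norm_expDefect_le _)).trans (by simp)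
  have hHb : ∀ S p, ‖∫ x, expDefect (gridSum g s n S (x / c p)) ∂ν‖ ≤ 2 := fun S p =>
    (norm_integral_le_of_norm_le_const (ae_of_all _ fun x => norm_expDefect_le _)).trans (by simp)
  rw [h.integral_eq_sum_successPattern hπ i n (H := fun S p => ∫ x, expDefect
    (gridSum g s n S (x / c p)) ∂ν) ?_ hHm ?_]
  · rw [← integral_finsetSum]
    · refine integral_congr_ae (ae_of_all _ fun p => ?_)
      simp only [binomialDefect]
      rw [integral_finsetSum]
      · simp_rw [integral_const_mul]
      · intro S _
        refine Integrable.const_mul (.of_bound ((hgrid S).comp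
          (measurable_prodMk_left (x := p))).aestronglyMeasurable 2
            (ae_of_all _ fun x => norm_expDefect_le _)) _
    · intro S _
      refine .of_bound (Measurable.mul (by fun_prop) (hHm S)).aestronglyMeasurable 2 ?_
      filter_upwards [hπ] with p hp
      have hp1 : 0 ≤ 1 - p := sub_nonneg.2 hp.2.le
      have h2 : p ^ S.card * (1 - p) ^ (n - S.card) ≤ 1 :=
        mul_le_one₀ (pow_le_one₀ hp.1.le hp.2.le) (pow_nonneg hp1 _)
          (pow_le_one₀ hp1 (by linarith [hp.1]))
      rw [norm_mul, Complex.norm_real,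
        Real.norm_of_nonneg (mul_nonneg (pow_nonneg hp.1.le _) (pow_nonneg hp1 _))]
      exact (mul_le_mul h2 (hHb S p) (norm_nonneg _) zero_le_one).trans (by simp)
  · exact .of_bound (hG.stronglyMeasurable.integral_prod_left'.comp_measurable
      hW).aestronglyMeasurable 2 (ae_of_all _ fun ω => hGb _)
  · intro S hS ω hω
    simp only [G, W]
    simp_rw [sampleSum_eq_gridSum hS hω]

/-- The characteristic functional of a sample. -/
theorem integral_exp_integral_sampleProcess [IsProbabilityMeasure ν] {s : ℕ → ℝ} {α' : ℝ}
    {a : ℕ → ℝ} {m : ℕ → ℕ} (h : IsAggregatedSample P ν π X q η)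
    (hπ : ∀ᵐ p ∂π, p ∈ Set.Ioo (0 : ℝ) 1) (f : C_c(MarkSpace, ℝ)) (n : ℕ) :
    ∫ ω, Complex.exp (Complex.I *
        ((∫ x, f x ∂(sampleProcess α' a s m X q η n ω) : ℝ) : ℂ)) ∂P =
      (1 + -∫ p, (∫ x, binomialDefect (markExtend f) s n p (x / (a n * p ^ (1 / α'))) ∂ν) ∂π) ^
        m n := by
  obtain ⟨δ, hg⟩ := exists_isTestFunction f
  let V : ℕ → Ω → ℝ × ℝ × (ℕ → ℕ) := fun i ω => (X i ω, q i ω, fun j => η i j ω)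
  have hV : ∀ i, Measurable (V i) := fun i => (h.measurable_X i).prodMk
    ((h.measurable_q i).prodMk (measurable_pi_lambda _ fun j => h.measurable_η i j))
  let φ : ℝ × ℝ × (ℕ → ℕ) → ℂ := fun z => Complex.exp (Complex.I *
    ((sampleSum (markExtend f) s n (z.1 / (a n * z.2.1 ^ (1 / α'))) z.2.2 : ℝ) : ℂ))
  have hφ : Measurable φ := by
    have := measurable_sampleSum (s := s) hg.measurable n
      (y := fun z : ℝ × ℝ × (ℕ → ℕ) => z.1 / (a n * z.2.1 ^ (1 / α'))) (by fun_prop)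
      (e := fun z => z.2.2) (by fun_prop)
    fun_prop
  have hprod : ∀ ω, Complex.exp (Complex.I *
      ((∫ x, f x ∂(sampleProcess α' a s m X q η n ω) : ℝ) : ℂ)) =
      ∏ i : Fin (m n), φ (V i ω) := fun ω => by
    rw [integral_sampleProcess, Complex.ofReal_sum, Finset.mul_sum, Complex.exp_sum,
      Finset.prod_range]
  have hone : ∀ i, ∫ ω, φ (V i ω) ∂P = 1 + -∫ p, (∫ x, binomialDefect (markExtend f) s n p
      (x / (a n * p ^ (1 / α'))) ∂ν) ∂π := fun i => by
    rw [← h.integral_expDefect_sampleSum hπ hg.measurable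
      (c := fun p => a n * p ^ (1 / α')) (by fun_prop) i n]
    have hi : Integrable (fun ω => φ (V i ω)) P := .of_bound (hφ.comp (hV i)).aestronglyMeasurable 1
      (ae_of_all _ fun ω => by
        simp only [φ]
        rw [mul_comm, Complex.norm_exp_ofReal_mul_I])
    change _ = 1 + -∫ ω, (1 - φ (V i ω)) ∂P
    rw [integral_sub (integrable_const _) hi]
    simp
  simp_rw [hprod]
  have hind : iIndepFun (fun (i : Fin (m n)) => V i) P := h.indep.precomp Fin.val_injective
  rw [hind.integral_fun_prod_comp (f := fun _ => φ) (fun i => (hV i).aemeasurable)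
    fun i => hφ.aestronglyMeasurable]
  simp [hone]

end IsAggregatedSample

end Bernoulli

/-! ### Convergence for a general sign pattern -/

section Convergence

theorem toPointMeasure_of_isRadonPointMeasure {E : Type*} [TopologicalSpace E] [MeasurableSpace E]
    {μ : Measure E} (h : IsRadonPointMeasure μ) : (toPointMeasure μ).1 = μ := by
  have : toPointMeasure μ = ⟨μ, h⟩ := dif_pos h
  rw [this]

/-- `m n` is the product of the given divergent ratio and `n ^ (1 - ρ) / L n`, which diverges
because `ρ < 1`. -/
theorem tendsto_atTop_of_scaling {L : ℝ → ℝ} {m : ℕ → ℕ} {ρ : ℝ} (hρ : ρ < 1)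
    (hL : IsSlowlyVarying L)
    (hm : Tendsto (fun n : ℕ => (m n : ℝ) * L n / (n : ℝ) ^ (1 - ρ)) atTop atTop) :
    Tendsto m atTop atTop := by
  have h1 := (hL.tendsto_rpow_div (sub_pos.2 hρ)).comp tendsto_natCast_atTop_atTop
  refine tendsto_natCast_atTop_iff (R := ℝ).1 ((hm.atTop_mul_atTop₀ h1).congr' ?_)
  filter_upwards [tendsto_natCast_atTop_atTop.eventually hL.2.1, eventually_gt_atTop 0]
    with n hn hn0
  have hn' : (0 : ℝ) < (n : ℝ) ^ (1 - ρ) := Real.rpow_pos_of_pos (by exact_mod_cast hn0) _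
  have h3 : L (n : ℝ) ≠ 0 := ne_of_gt hn
  simp only [Function.comp_apply]
  field_simp

theorem pointProcessConverges_sampleProcess {Ω Ω' : Type*} [MeasurableSpace Ω] [MeasurableSpace Ω']
    {P : Measure Ω} [IsProbabilityMeasure P] {P' : Measure Ω'} [IsProbabilityMeasure P']
    {α α' β ρ C : ℝ} {L : ℝ → ℝ} {ν : Measure ℝ} {m : ℕ → ℕ}
    {X q : ℕ → Ω → ℝ} {η : ℕ → ℕ → Ω → ℕ}
    {w ε : ℕ → Ω' → ℝ} {Q : ℕ → Ω' → ℕ} {U : ℕ × ℕ → Ω' → ℝ}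
    (hα : 0 < α) (hα' : 0 < α') (hρ : ρ < 1) (hC : 0 < C)
    (hL : IsSlowlyVarying L) (hL_nonneg : ∀ x, 1 < x → 0 ≤ L x)
    (hν_symm : ν.map (fun x => -x) = ν)
    (hν_tail : Asymptotics.IsEquivalent atTop (absTail ν) (fun x : ℝ => C * x ^ (-α)))
    (hβ : β = α / α' - 1 + ρ) (hβ_pos : 0 < β) (hβ_lt : β < 1)
    (hm_pos : ∀ n, 1 ≤ n → 0 < m n)
    (hm : Tendsto (fun n : ℕ => (m n : ℝ) * L n / (n : ℝ) ^ (1 - ρ)) atTop atTop)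
    (hsample : IsAggregatedSample P ν (parameterLaw ρ L) X q η)
    (hlimit : IsLimitFamily P' β w ε Q U) {s : ℕ → ℝ} (hs : ∀ k, |s k| = 1) :
    PointProcessConverges P P' (sampleProcess α' (scaling α β C L m) s m X q η)
      (clusterProcess α s w ε Q U) := by
  have hνp : IsProbabilityMeasure ν := by
    rw [← (hsample.law_X 0).map_eq]
    exact Measure.isProbabilityMeasure_map (hsample.measurable_X 0).aemeasurable
  have hπp : IsProbabilityMeasure (parameterLaw ρ L) := by
    rw [← (hsample.law_q 0).map_eq]
    exact Measure.isProbabilityMeasure_map (hsample.measurable_q 0).aemeasurable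
  have hRadon := hlimit.ae_isRadonPointMeasure hα hs
  have hlim : ∀ f : C_c(MarkSpace, ℝ), ∀ᵐ ω ∂P',
      ∫ x, f x ∂(toPointMeasure (clusterProcess α s w ε Q U ω)).1 =
        ∫ x, f x ∂(clusterProcess α s w ε Q U ω) := fun f => by
    filter_upwards [hRadon] with ω hω
    rw [toPointMeasure_of_isRadonPointMeasure hω]
  refine ⟨fun n => ae_of_all _ fun ω => isRadonPointMeasure_sampleProcess n ω, hRadon,
    tendstoInDistribution_of_charFunctional (fun n f => ?_) (fun f => ?_) fun f => ?_⟩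
  · obtain ⟨δ, hg⟩ := exists_isTestFunction f
    simp_rw [toPointMeasure_of_isRadonPointMeasure (isRadonPointMeasure_sampleProcess _ _),
      integral_sampleProcess]
    refine (Finset.measurable_sum _ fun i _ => ?_).aemeasurable
    have h1 := hsample.measurable_X i
    have h2 := hsample.measurable_q i
    exact measurable_sampleSum hg.measurable n (by fun_prop)
      (measurable_pi_lambda _ fun j => hsample.measurable_η i j)
  · exact (hlimit.aemeasurable_integral f hα hs).congr ((hlim f).mono fun ω h => h.symm)
  · obtain ⟨δ, hg⟩ := exists_isTestFunction f
    simp_rw [toPointMeasure_of_isRadonPointMeasure (isRadonPointMeasure_sampleProcess _ _),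
      hsample.integral_exp_integral_sampleProcess parameterLaw_ae_mem f]
    have hexp : ∫ ω, Complex.exp (Complex.I *
        ((∫ x, f x ∂(toPointMeasure (clusterProcess α s w ε Q U ω)).1 : ℝ) : ℂ)) ∂P' =
        ∫ ω, Complex.exp (Complex.I * ((∫ x, f x ∂(clusterProcess α s w ε Q U ω) : ℝ) : ℂ)) ∂P' :=
      integral_congr_ae ((hlim f).mono fun ω h => by simp only [h])
    rw [hexp, hlimit.integral_exp_integral_clusterProcess f hα hβ_pos hβ_lt hs,
      ← integral_rpow_mul_symPoissonDefect hα hC hβ_pos hβ_lt hg hs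
        (hlimit.summable_sibuyaWeight hβ_pos hβ_lt)]
    -- Both functionals are now explicit: a power `(1 - d_n) ^ m n` and an exponential. Only the
    -- limit of `m n * d_n` is left.
    refine tendsto_one_add_pow_exp (tendsto_atTop_of_scaling hρ hL hm) ?_
    simp_rw [mul_neg]
    exact (tendsto_integral_binomialDefect hα hα' hC hL hL_nonneg hν_symm hν_tail hβ hβ_pos hβ_lt
      hm_pos hm hg hs).neg

/-- Almost surely equal limits are interchangeable. -/
theorem PointProcessConverges.congr_limit {E : Type*} [TopologicalSpace E] [MeasurableSpace E]
    {Ω Ω' : Type*} [MeasurableSpace Ω] [MeasurableSpace Ω'] {P : Measure Ω}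
    [IsProbabilityMeasure P] {P' : Measure Ω'} [IsProbabilityMeasure P'] {N : ℕ → Ω → Measure E}
    {N' N'' : Ω' → Measure E} (h : PointProcessConverges P P' N N') (h' : N' =ᵐ[P'] N'') :
    PointProcessConverges P P' N N'' := by
  refine ⟨h.1, ?_, ?_⟩
  · filter_upwards [h.2.1, h'] with ω h1 h2
    rwa [← h2]
  · refine h.2.2.congr (fun _ => ae_eq_refl _) ?_
    filter_upwards [h'] with ω h2
    rw [h2]

end Convergence

end

theorem mainTheorem4 {Ω Ω' : Type*} [MeasurableSpace Ω] [MeasurableSpace Ω']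
    (P : Measure Ω) [IsProbabilityMeasure P] (P' : Measure Ω') [IsProbabilityMeasure P']
    (α α' β ρ C : ℝ) (L : ℝ → ℝ) (ν : Measure ℝ) (m : ℕ → ℕ)
    (X q : ℕ → Ω → ℝ) (η : ℕ → ℕ → Ω → ℕ)
    (w ε : ℕ → Ω' → ℝ) (Q : ℕ → Ω' → ℕ) (U : ℕ × ℕ → Ω' → ℝ)
    (hα : 0 < α) (hα' : 0 < α') (hρ : ρ < 1) (hC : 0 < C)
    -- the density of `q`
    (hL : IsSlowlyVarying L) (hL_nonneg : ∀ x, 1 < x → 0 ≤ L x)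
    -- the law `ν` of `𝒳` is symmetric, with `ℙ(|𝒳| > x) ∼ C x ^ (-α)`
    (hν_symm : ν.map (fun x => -x) = ν)
    (hν_tail : Asymptotics.IsEquivalent atTop (fun x : ℝ => ν.real {y | x < |y|})
      (fun x : ℝ => C * x ^ (-α)))
    (hβ : β = α / α' - 1 + ρ) (hβ_pos : 0 < β) (hβ_lt : β < 1)
    -- the increasing sequence `(m_n)_{n ≥ 1}` of positive integers
    (hm_pos : ∀ n, 1 ≤ n → 0 < m n) (hm_mono : MonotoneOn m (Set.Ici 1))
    (hm : Tendsto (fun n : ℕ => (m n : ℝ) * L n / (n : ℝ) ^ (1 - ρ)) atTop atTop)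
    (hm_growth : 2 ≤ α → ∃ κ K : ℝ, 0 < κ ∧ (2 < α → κ < 2 * β / (α - 2)) ∧
      ∀ n : ℕ, 1 ≤ n → (m n : ℝ) ≤ K * (n : ℝ) ^ κ)
    (hsample : IsAggregatedSample P ν (parameterLaw ρ L) X q η)
    (hlimit : IsLimitFamily P' β w ε Q U) :
    PointProcessConverges P P'
        (summandProcess α' (scaling α β C L m) m X q η)
        (limitProcess α w ε Q U) ∧
      PointProcessConverges P P'
        (signedSummandProcess α' (scaling α β C L m) m X q η)
        (signedLimitProcess α w ε Q U) := by
  refine ⟨?_, ?_⟩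
  · rw [summandProcess_eq_sampleProcess]
    refine (pointProcessConverges_sampleProcess hα hα' hρ hC hL hL_nonneg hν_symm hν_tail hβ hβ_pos
      hβ_lt hm_pos hm hsample hlimit (s := fun _ => 1) (by simp)).congr_limit ?_
    exact ae_of_all _ fun ω => (limitProcess_eq_clusterProcess α w ε Q U ω).symm
  · rw [signedSummandProcess_eq_sampleProcess]
    refine (pointProcessConverges_sampleProcess hα hα' hρ hC hL hL_nonneg hν_symm hν_tail hβ hβ_pos
      hβ_lt hm_pos hm hsample hlimit (s := fun k => (-1) ^ k) (by simp)).congr_limit ?_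
    -- Order statistics carry well-defined ranks only when there are no ties, so here the two limits
    -- agree almost surely.
    filter_upwards [hlimit.ae_U_injective] with ω hω
    exact (signedLimitProcess_eq_clusterProcess α w ε Q U hω).symm
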